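/- Notation. Let $\mathbf t=(t_0,t_1,t_2,\dots)$, $x=t_0$, and let $[z^{-1}]$ be the vector with components $(2k-1)!!\,z^{-2k-1}$, $k\ge 0$, where $(-1)!!=1$. A tau-function of the KdV hierarchy is a formal power series $\tau\in\mathbb C[[t_0,t_1,\dots]]$ with $\tau(\mathbf 0)\neq 0$ (so that $\log\tau$ is a formal power series) such that, identically in $\mathbf t$ and $\tilde{\mathbf t}$ and for all $p=0,1,2,\dots$, $$\operatorname*{res}_{z=\infty}\ \tau(\mathbf t-[z^{-1}])\,\tau(\tilde{\mathbf t}+[z^{-1}])\,\exp\Big(\sum_{j\ge 0}\frac{t_j-\tilde t_j}{(2j+1)!!}z^{2j+1}\Big)z^{2p}\,dz=0,$$ where the residue is minus the coefficient of $z^{-1}$. Put $\vartheta(z;\mathbf t)=\sum_{j\ge0}t_j\frac{z^{2j+1}}{(2j+1)!!}$, $u=\partial_x^2\log\tau$, $$\psi(z;\mathbf t)=\frac{\tau(\mathbf t-[z^{-1}])}{\tau(\mathbf t)}e^{\vartheta(z;\mathbf t)},\qquad \psi^*(z;\mathbf t)=\frac{\tau(\mathbf t+[z^{-1}])}{\tau(\mathbf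 t)}e^{-\vartheta(z;\mathbf t)},\qquad \mathcal R=\psi\psi^*,$$ $$\Psi=\begin{pmatrix}\psi&\psi^*\\-\psi_x&-\psi^*_x\end{pmatrix},\qquad \sigma_3=\begin{pmatrix}1&0\\0&-1\end{pmatrix},$$ all regarded as formal power series in $\mathbf t$ whose coefficients are formal Laurent series in $z^{-1}$. For $n\ge 1$ let $$F_n(z_1,\dots,z_n;\mathbf t)=\sum_{k_1,\dots,k_n\ge 0}\frac{\partial^n\log\tau}{\partial t_{k_1}\cdots\partial t_{k_n}}(\mathbf t)\prod_{i=1}^n\frac{(2k_i+1)!!}{z_i^{2k_i+2}}.$$ Theorem. Let $\tau$ be any tau-function of the KdV hierarchy. Then $\det\Psi$ is invertible and the following three expressions are equal: $$\Theta(z;\mathbf t):=z\,\Psi\,\sigma_3\,\Psi^{-1}=\frac12\begin{pmatrix}-\mathcal R_x&-2\mathcal R\\ \mathcal R_{xx}-2(z^2-2u)\mathcal R&\mathcal R_x\end{pmatrix}=\frac12\begin{pmatrix}-(\psi\psi^*)_x&-2\psi\psi^*\\2\psi_x\psi^*_x&(\psi\psi^*)_x\end{pmatrix}.$$ Moreover,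 for every $n\ge 2$, $$F_n(z_1,\dots,z_n;\mathbf t)=-\frac1n\sum_{r\in S_n}\frac{\operatorname{Tr}\big(\Theta(z_{r_1};\mathbf t)\cdots\Theta(z_{r_n};\mathbf t)\big)}{\prod_{j=1}^n\big(z_{r_j}^2-z_{r_{j+1}}^2\big)}-\delta_{n,2}\frac{z_1^2+z_2^2}{(z_1^2-z_2^2)^2},$$ where $r_{n+1}=r_1$; this is an identity of formal power series in $\mathbf t$ with coefficients in the field of fractions of $\mathbb C[[z_1^{-1},\dots,z_n^{-1}]]$. -/

import Mathlib

open scoped BigOperators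

noncomputable section

namespace KdV

/-- The Fock space `ℂ[[t₀, t₁, t₂, …]]` of formal power series in the times. -/
abbrev TimeSeries : Type := MvPowerSeries ℕ ℂ

/-- Formal Laurent series in `z⁻¹`, i.e. expansions at `z = ∞`.  The uniformizer of Mathlib's
`LaurentSeries` plays the role of `z⁻¹`, so the coefficient of index `m` is that of `z ^ (-m)`. -/
abbrev AtInfinity : Type := LaurentSeries ℂ

/-- Formal power series in the times, with coefficients formal Laurent series in `z⁻¹`. -/
abbrev WaveRing : Type := MvPowerSeries ℕ AtInfinity

/-- The spectral variable `z`, as a Laurent series in `z⁻¹`. -/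
def z : AtInfinity := HahnSeries.single (-1) 1

/-- A series in the times regarded as one whose coefficients do not depend on `z`. -/
def toWave : TimeSeries →+* WaveRing := MvPowerSeries.map HahnSeries.C

/-- The linear form `∑ j, c j * t j` in (possibly infinitely many) variables `t j`. -/
def linearSeries {σ R : Type} [Semiring R] (c : σ → R) : MvPowerSeries σ R :=
  open Classical in fun d => ∑ j ∈ d.support, if d = Finsupp.single j 1 then c j else 0

theorem coeff_single_linearSeries {σ R : Type} [Semiring R] (c : σ → R) (j : σ) :
    MvPowerSeries.coeff (Finsupp.single j 1) (linearSeries c) = c j := by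
  classical
  change (∑ i ∈ (Finsupp.single j 1 : σ →₀ ℕ).support,
    if (Finsupp.single j 1 : σ →₀ ℕ) = Finsupp.single i 1 then c i else 0) = c j
  rw [Finsupp.support_single j one_ne_zero]
  simp

theorem coeff_linearSeries_of_ne {σ R : Type} [Semiring R] (c : σ → R) (d : σ →₀ ℕ)
    (hd : ∀ j, d ≠ Finsupp.single j 1) : MvPowerSeries.coeff d (linearSeries c) = 0 := by
  classical
  exact Finset.sum_eq_zero fun j _ => if_neg (hd j)

theorem constantCoeff_linearSeries {σ R : Type} [Semiring R] (c : σ → R) :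
    MvPowerSeries.constantCoeff (linearSeries c) = 0 := by
  rw [← MvPowerSeries.coeff_zero_eq_constantCoeff_apply]
  refine coeff_linearSeries_of_ne c 0 fun j h => ?_
  simpa using DFunLike.congr_fun h j

/-- The formal exponential of a series without constant term. -/
def expSeries {σ : Type} (f : MvPowerSeries σ AtInfinity) : MvPowerSeries σ AtInfinity :=
  (PowerSeries.exp ℂ).subst f

/-- The substituted series `t_k + ε (2k-1)!! w ^ (2k+1)`, where the times are the variables
`some k` and `w` is the variable `none`; for `k = 0` the double factorial `(-1)!!` is `1`. -/
def miwaArg (ε : ℂ) (k : ℕ) : MvPowerSeries (Option ℕ) ℂ :=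
  MvPowerSeries.X (some k) +
    MvPowerSeries.C (ε * (Nat.doubleFactorial (2 * k - 1) : ℂ)) *
      MvPowerSeries.X none ^ (2 * k + 1)

theorem hasSubst_miwaArg (ε : ℂ) : MvPowerSeries.HasSubst (miwaArg ε) where
  const_coeff k := by simp [miwaArg]
  coeff_zero d := by
    classical
    refine Set.Finite.subset
      ((d.support.preimage some ((Option.some_injective ℕ).injOn)).finite_toSet.union
        (Set.finite_le_nat (d none))) ?_
    intro k hk
    by_contra hcon
    simp only [Set.mem_union, Finset.mem_coe, Finset.mem_preimage, Finsupp.mem_support_iff,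
      Set.mem_ofPred_eq, not_or, not_not, not_le] at hcon
    apply hk
    rw [miwaArg, map_add, MvPowerSeries.coeff_X, MvPowerSeries.coeff_C_mul,
      MvPowerSeries.coeff_X_pow, if_neg, if_neg]
    · simp
    · intro h
      have h2 := hcon.2
      rw [h] at h2
      simp at h2
      omega
    · intro h
      have h1 := hcon.1
      rw [h] at h1
      simp at h1

/-- `τ(t + ε [z⁻¹])`, where `[z⁻¹]` has the `k`-th component `(2k-1)!! z ^ (-(2k+1))`.  The
substitution is made in `ℂ[[t, w]]`; then the powers of `w = z⁻¹` are collected in the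
coefficients. -/
def miwaShift (ε : ℂ) (τ : TimeSeries) : WaveRing := fun d =>
  HahnSeries.ofPowerSeries ℤ ℂ
    (PowerSeries.mk fun m =>
      MvPowerSeries.coeff (d.optionElim m) (MvPowerSeries.subst (miwaArg ε) τ))

/-- The coefficient of `z⁻¹`, up to sign the formal residue at `z = ∞` of `f dz`, vanishes. -/
def ResVanishes (f : AtInfinity) : Prop := - HahnSeries.coeff f 1 = 0

/-- The phase difference `∑ j, (t_j - t̃_j) z ^ (2j+1) / (2j+1)!!`; the variables `Sum.inl j` are
the `t_j` and the variables `Sum.inr j` are the `t̃_j`. -/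
def phaseDiff : MvPowerSeries (ℕ ⊕ ℕ) AtInfinity :=
  linearSeries (Sum.elim
    (fun j => ((Nat.doubleFactorial (2 * j + 1) : ℂ)⁻¹) • z ^ (2 * j + 1))
    (fun j => -(((Nat.doubleFactorial (2 * j + 1) : ℂ)⁻¹) • z ^ (2 * j + 1))))

/-- The Hirota bilinear identities of the KdV hierarchy:
`res_{z=∞} τ(t - [z⁻¹]) τ(t̃ + [z⁻¹]) exp(∑ (t_j - t̃_j) z^(2j+1)/(2j+1)!!) z^(2p) dz = 0`
for all `p`, identically in `t` and `t̃`. -/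
def IsTauFunction (τ : TimeSeries) : Prop :=
  ∀ (p : ℕ) (d : ℕ ⊕ ℕ →₀ ℕ), ResVanishes
    (MvPowerSeries.coeff d
      (MvPowerSeries.rename (Function.Embedding.inl : ℕ ↪ ℕ ⊕ ℕ) (miwaShift (-1) τ) *
        MvPowerSeries.rename (Function.Embedding.inr : ℕ ↪ ℕ ⊕ ℕ) (miwaShift 1 τ) *
        expSeries phaseDiff * MvPowerSeries.C (z ^ (2 * p))))

/-- The phase `ϑ(z; t) = ∑ j, t_j z ^ (2j+1) / (2j+1)!!`. -/
def phase : WaveRing :=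
  linearSeries fun j => ((Nat.doubleFactorial (2 * j + 1) : ℂ)⁻¹) • z ^ (2 * j + 1)

/-- The wave function `ψ(z; t) = τ(t - [z⁻¹]) / τ(t) * exp ϑ(z; t)`. -/
def psi (τ : TimeSeries) : WaveRing := miwaShift (-1) τ * toWave τ⁻¹ * expSeries phase

/-- The dual wave function `ψ*(z; t) = τ(t + [z⁻¹]) / τ(t) * exp (-ϑ(z; t))`. -/
def psiStar (τ : TimeSeries) : WaveRing := miwaShift 1 τ * toWave τ⁻¹ * expSeries (-phase)

/-- The derivative with respect to `x = t₀`. -/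
def dx (f : WaveRing) : WaveRing := MvPowerSeries.pderiv AtInfinity 0 f

/-- The formal logarithm of a series `τ` with `τ(0) ≠ 0`: `log τ(0) + log (1 + (τ / τ(0) - 1))`. -/
def logSeries (τ : TimeSeries) : TimeSeries :=
  MvPowerSeries.C (Complex.log (MvPowerSeries.constantCoeff τ)) +
    (PowerSeries.log ℂ).subst (MvPowerSeries.C (MvPowerSeries.constantCoeff τ)⁻¹ * τ - 1)

/-- The solution `u = ∂ₓ² log τ` of the KdV hierarchy. -/
def potential (τ : TimeSeries) : TimeSeries :=
  MvPowerSeries.pderiv ℂ 0 (MvPowerSeries.pderiv ℂ 0 (logSeries τ))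

/-- The correlation function `∂ⁿ log τ / ∂t_{k₁} ⋯ ∂t_{kₙ}`. -/
def correlation (τ : TimeSeries) {n : ℕ} (k : Fin n → ℕ) : TimeSeries :=
  (List.ofFn k).foldr (fun j f => MvPowerSeries.pderiv ℂ j f) (logSeries τ)

/-- `R = ψ ψ*`. -/
def resolvent (τ : TimeSeries) : WaveRing := psi τ * psiStar τ

/-- The matrix `Ψ`. -/
def Psi (τ : TimeSeries) : Matrix (Fin 2) (Fin 2) WaveRing :=
  !![psi τ, psiStar τ; -dx (psi τ), -dx (psiStar τ)]

/-- The Pauli matrix `σ₃`. -/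
def sigma3 : Matrix (Fin 2) (Fin 2) WaveRing := !![1, 0; 0, -1]

/-- The spectral variable `z` as an element of `WaveRing`. -/
def zW : WaveRing := MvPowerSeries.C z

/-- `1 / 2` as an element of `WaveRing`. -/
def halfW : WaveRing := MvPowerSeries.C (HahnSeries.C (1 / 2))

/-- The matrix `Θ = z Ψ σ₃ Ψ⁻¹`. -/
def Theta (τ : TimeSeries) : Matrix (Fin 2) (Fin 2) WaveRing :=
  zW • (Psi τ * sigma3 * (Psi τ)⁻¹)

/-- The field of fractions of `ℂ[[z₁⁻¹, …, zₙ⁻¹]]`. -/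
abbrev SpectralField (n : ℕ) : Type := FractionRing (MvPowerSeries (Fin n) ℂ)

/-- The spectral variable `zᵢ`, the inverse of the `i`-th variable of `ℂ[[z₁⁻¹, …, zₙ⁻¹]]`. -/
def zAt {n : ℕ} (i : Fin n) : SpectralField n :=
  (algebraMap (MvPowerSeries (Fin n) ℂ) (SpectralField n) (MvPowerSeries.X i))⁻¹

theorem evalHom_injective {n : ℕ} (i : Fin n) : Function.Injective
    ((algebraMap (MvPowerSeries (Fin n) ℂ) (SpectralField n)).comp
      (PowerSeries.toMvPowerSeries (R := ℂ) i).toRingHom) :=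
  (IsFractionRing.injective (MvPowerSeries (Fin n) ℂ) (SpectralField n)).comp
    (PowerSeries.toMvPowerSeries_injective i)

/-- The substitution `f(z) ↦ f(zᵢ)` on Laurent series in `z⁻¹`. -/
def specialize {n : ℕ} (i : Fin n) : AtInfinity →+* SpectralField n :=
  IsFractionRing.lift (A := PowerSeries ℂ) (evalHom_injective i)

theorem specialize_z {n : ℕ} (i : Fin n) : specialize i z = zAt i := by
  have h : z = (algebraMap (PowerSeries ℂ) AtInfinity PowerSeries.X)⁻¹ := by
    refine eq_inv_of_mul_eq_one_left ?_
    change z * HahnSeries.ofPowerSeries ℤ ℂ PowerSeries.X = 1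
    rw [HahnSeries.ofPowerSeries_X, z, HahnSeries.single_mul_single]
    simp
  rw [h, map_inv₀, specialize, IsFractionRing.lift_algebraMap, zAt]
  simp

/-- The matrix `Θ(zᵢ; t)`. -/
def ThetaAt (τ : TimeSeries) {n : ℕ} (i : Fin n) :
    Matrix (Fin 2) (Fin 2) (MvPowerSeries ℕ (SpectralField n)) :=
  (Theta τ).map (MvPowerSeries.map (specialize i))

/-- The generating function
`F_n = ∑ k₁ … kₙ, ⟨⟨τ_{k₁} ⋯ τ_{kₙ}⟩⟩(t) ∏ i, (2kᵢ+1)!! / zᵢ ^ (2kᵢ+2)`,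
as a power series in the times with coefficients in `ℂ[[z₁⁻¹, …, zₙ⁻¹]]`.  At most one `k`
contributes to the coefficient of `∏ i, zᵢ ^ (-eᵢ)`, and its entries satisfy `kᵢ < eᵢ`. -/
def generatingSeries (τ : TimeSeries) (n : ℕ) : MvPowerSeries ℕ (MvPowerSeries (Fin n) ℂ) :=
  fun d e => ∑ k ∈ Fintype.piFinset fun i => Finset.range (e i),
    if ∀ i, e i = 2 * k i + 2 then
      MvPowerSeries.coeff d (correlation τ k) *
        ∏ i, (Nat.doubleFactorial (2 * k i + 1) : ℂ)
    else 0

/-- The generating function `F_n(z₁, …, zₙ; t)`, with coefficients in the field of fractions. -/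
def generatingFunction (τ : TimeSeries) (n : ℕ) : MvPowerSeries ℕ (SpectralField n) :=
  MvPowerSeries.map (algebraMap (MvPowerSeries (Fin n) ℂ) (SpectralField n))
    (generatingSeries τ n)

end KdV

end

/-!
The proof describes the correlation functions by loop operators acting on the wave functions.

Write `[v]` for the vector with components `(2 k - 1)!! v ^ (2 k + 1)` and
`∇(v) = ∑ k, (2 k + 1)!! v ^ (2 k) ∂/∂t_k`. The shift `f(t) ↦ f(t + [v])` is the solution of
`d/dv = ∇(v)` with initial value `f` (`derivative_shift`, `coeff_miwaHom`); thus Miwa shifts become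
formal Taylor expansions and all infinite sums are power series in `v`.

Wave functions. The bilinear identities say that the products of `ψ(t)` and `ψ*(t')` contain no odd
negative powers of `z` (`IsTauFunction.mem_residueFree`). Since `ψ*` is `ψ` with `z` replaced by
`-z`, a combination of such products that is odd in `z` and has no positive powers of `z` vanishes
(`eq_zero_of_odd`). This gives the Wronskian `ψ* ψₓ - ψ ψ*ₓ = 2 z` (`wronskian`), hence the
determinant of `Ψ` and the third form of `Θ` (`Theta_eq`); then the Schrödinger equation
(`dx_dx_psi`), which yields the second form of `Θ`; and the flows of `ψ` (`two_mul_flow_psi`), with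
the Lax equation for `R = ψ ψ*` (`flow_resolvent`).

Two points. With times differing by a shift, the bilinear identity becomes the differential Fay
identity (`IsTauFunction.fay`, `IsTauFunction.fay_psi`). It expresses the one-point function
`N = ∇ log τ` by `ψ` and `ψ*`, and its flows by the resolvent (`two_mul_flow_nablaLog`). Summation
over all flows gives, for the loop operators `∇_i` in the variables `z_i`, the formulas for
`∇_i R(z_j)` (`nabla_resolventAt`) and `∇_i N(z_j)` (`nabla_onePoint`). The sums over `k` are
evaluated by recursions in `k`, so that denominators `z_i ^ 2 - z_j ^ 2` occur only as
factors to be cancelled. In matrix form these are the loop equation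
`∇_i Θ(z_j) = [Θ(z_i) / (z_i ^ 2 - z_j ^ 2) + Q_i, Θ(z_j)]` (`hasMatrixNabla_ThetaAt`) and
`∇_i N(z_j) = (Tr Θ(z_i) Θ(z_j) - z_i ^ 2 - z_j ^ 2) / (z_i ^ 2 - z_j ^ 2) ^ 2`
(`toFraction_nabla_onePoint`).

All points. The generating function is the iterated loop derivative of `log τ`
(`generatingSeries_eq`). Applied to `Tr (Θ(z_a) Θ(z_{p₁}) ⋯)`, weighted by the cyclic product of the
`1 / (z_s ^ 2 - z_t ^ 2)`, the loop operator `∇_w` produces commutators which telescope, by partial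
fractions, to the sum over all insertions of `w` in the cycle (`hasNabla_cycleTrace`). By induction,
starting from the two-point function, the generating function is minus the sum over all cycles
through a fixed point (`toFraction_foldr_nabla`), and cyclic invariance turns this into the sum over
all permutations divided by `n` (`sum_perm_cyclicTerm`). The self-interaction term of the two-point
function is constant in the times and dies at the next step.
-/

noncomputable section

namespace KdV

/-! ### Coefficientwise maps and derivations of power series -/

section General

variable {σ κ A B : Type} [CommRing A] [CommRing B] [Algebra ℂ A] [Algebra ℂ B]

/-- Application of an additive map to every coefficient of a power series. -/
def coeffMap {σ A B : Type} [CommRing A] [CommRing B] (l : A →+ B) :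
    MvPowerSeries σ A →+ MvPowerSeries σ B where
  toFun f := fun d => l (MvPowerSeries.coeff d f)
  map_zero' := by
    ext d
    exact (congrArg l (map_zero (MvPowerSeries.coeff d))).trans (map_zero l)
  map_add' f g := by
    ext d
    exact (congrArg l (map_add (MvPowerSeries.coeff d) f g)).trans (map_add l _ _)

@[simp] theorem coeff_coeffMap {σ A B : Type} [CommRing A] [CommRing B] (l : A →+ B)
    (f : MvPowerSeries σ A) (d : σ →₀ ℕ) :
    MvPowerSeries.coeff d (coeffMap l f) = l (MvPowerSeries.coeff d f) := rfl

theorem map_mul_natCast_add_one {A B : Type} [CommRing A] [CommRing B] (l : A →+ B) (a : A)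
    (n : ℕ) :
    l (a * ((n : A) + 1)) = l a * ((n : B) + 1) := by
  have h := map_nsmul l (n + 1) a
  rw [nsmul_eq_mul, nsmul_eq_mul] at h
  push_cast at h
  rw [mul_comm, h, mul_comm]

theorem coeffMap_pderiv {σ A B : Type} [CommRing A] [CommRing B] (l : A →+ B) (i : σ)
    (f : MvPowerSeries σ A) :
    coeffMap l (MvPowerSeries.pderiv A i f) = MvPowerSeries.pderiv B i (coeffMap l f) := by
  ext d
  rw [coeff_coeffMap, MvPowerSeries.coeff_pderiv, MvPowerSeries.coeff_pderiv, coeff_coeffMap,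
    map_mul_natCast_add_one]

theorem map_pderiv {σ A B : Type} [CommRing A] [CommRing B] (φ : A →+* B) (i : σ)
    (f : MvPowerSeries σ A) :
    MvPowerSeries.map φ (MvPowerSeries.pderiv A i f) =
      MvPowerSeries.pderiv B i (MvPowerSeries.map φ f) := by
  ext d
  simp [MvPowerSeries.coeff_pderiv]

theorem pderiv_comm {σ A : Type} [CommRing A] (i j : σ) (f : MvPowerSeries σ A) :
    MvPowerSeries.pderiv A i (MvPowerSeries.pderiv A j f) =
      MvPowerSeries.pderiv A j (MvPowerSeries.pderiv A i f) := by
  classical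
  ext d
  simp only [MvPowerSeries.coeff_pderiv, Finsupp.add_apply, Finsupp.single_apply]
  rw [add_right_comm]
  by_cases h : i = j
  · subst h; rfl
  · rw [if_neg h, if_neg (Ne.symm h)]
    push_cast
    ring

/-- A derivation of the coefficient ring acts coefficientwise as a derivation. -/
theorem coeffMap_mul {σ A : Type} [CommRing A] (l : A →+ A)
    (hl : ∀ a b, l (a * b) = l a * b + a * l b) (f g : MvPowerSeries σ A) :
    coeffMap l (f * g) = coeffMap l f * g + f * coeffMap l g := by
  classical
  ext d
  simp only [coeff_coeffMap, map_add, MvPowerSeries.coeff_mul, map_sum, hl,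
    Finset.sum_add_distrib]

/-- A derivation of the coefficient ring that kills the constants, acting coefficientwise. -/
def coeffDerivation (l : A →+ A) (hl : ∀ a b, l (a * b) = l a * b + a * l b)
    (hc : ∀ c : ℂ, l (algebraMap ℂ A c) = 0) :
    Derivation ℂ (MvPowerSeries σ A) (MvPowerSeries σ A) :=
  Derivation.mk'
    { toFun := coeffMap l
      map_add' := map_add (coeffMap l)
      map_smul' := fun c f => by
        ext d
        change l (c • MvPowerSeries.coeff d f) = c • l (MvPowerSeries.coeff d f)
        rw [Algebra.smul_def, Algebra.smul_def, hl, hc, zero_mul, zero_add] }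
    (fun a b => by
      change coeffMap l (a * b) = a * coeffMap l b + b * coeffMap l a
      rw [coeffMap_mul l hl]
      ring)

/-- A series divisible by all powers of a series without constant term vanishes. -/
theorem eq_zero_of_forall_pow_dvd {σ A : Type} [CommRing A] {f g : MvPowerSeries σ A}
    (hf : MvPowerSeries.constantCoeff f = 0) (h : ∀ n : ℕ, f ^ n ∣ g) : g = 0 := by
  classical
  ext d
  obtain ⟨q, rfl⟩ := h (d.degree + 1)
  rw [map_zero]
  apply MvPowerSeries.coeff_of_lt_order
  refine lt_of_lt_of_le ?_ (MvPowerSeries.le_order_mul)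
  refine lt_of_lt_of_le ?_ (le_add_of_nonneg_right zero_le)
  refine lt_of_lt_of_le ?_ (MvPowerSeries.le_order_pow_of_constantCoeff_eq_zero (d.degree + 1) hf)
  exact_mod_cast Nat.lt_succ_self _

/-- Chain rule for the substitution into a power series in one variable.  Both sides agree on
polynomials, and modulo every power of `f` a power series is a polynomial. -/
theorem derivation_subst (D : Derivation ℂ (MvPowerSeries σ A) (MvPowerSeries σ A))
    (g : PowerSeries ℂ) {f : MvPowerSeries σ A} (hf : MvPowerSeries.constantCoeff f = 0) :
    D (g.subst f) = (PowerSeries.derivative ℂ g).subst f * D f := by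
  have hs : PowerSeries.HasSubst f := PowerSeries.HasSubst.of_constantCoeff_zero hf
  rw [← sub_eq_zero]
  refine eq_zero_of_forall_pow_dvd hf fun n => ?_
  have hg := g.eq_X_pow_mul_shift_add_trunc (n + 1)
  set q := PowerSeries.mk fun i => PowerSeries.coeff (i + (n + 1)) g
  set p := g.trunc (n + 1)
  have hg' : PowerSeries.derivative ℂ g =
      PowerSeries.X ^ n * ((n + 1 : ℕ) • q + PowerSeries.X * PowerSeries.derivative ℂ q)
        + ((Polynomial.derivative p : Polynomial ℂ) : PowerSeries ℂ) := by
    rw [hg, map_add, Derivation.leibniz, PowerSeries.derivative_coe, Derivation.leibniz_pow,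
      PowerSeries.derivative_X]
    simp only [smul_eq_mul, nsmul_eq_mul, Nat.add_sub_cancel]
    ring
  rw [hg', hg]
  simp only [← PowerSeries.coe_substAlgHom hs, map_add, map_mul, map_pow, map_natCast,
    PowerSeries.substAlgHom_X, PowerSeries.substAlgHom_coe, Derivation.map_aeval,
    Derivation.leibniz, Derivation.leibniz_pow, smul_eq_mul, nsmul_eq_mul, Nat.add_sub_cancel]
  refine ⟨f * D ((PowerSeries.substAlgHom hs) q) -
    f * PowerSeries.substAlgHom hs (PowerSeries.derivative ℂ q) * D f, ?_⟩
  ring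

/-- Algebra maps that preserve the vanishing of the constant term commute with substitution. -/
theorem algHom_subst (φ : MvPowerSeries σ A →ₐ[ℂ] MvPowerSeries κ B)
    (g : PowerSeries ℂ) {f : MvPowerSeries σ A} (hf : MvPowerSeries.constantCoeff f = 0)
    (hφ : MvPowerSeries.constantCoeff (φ f) = 0) :
    φ (g.subst f) = g.subst (φ f) := by
  have hs : PowerSeries.HasSubst f := PowerSeries.HasSubst.of_constantCoeff_zero hf
  have hs' : PowerSeries.HasSubst (φ f) := PowerSeries.HasSubst.of_constantCoeff_zero hφ
  rw [← sub_eq_zero]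
  refine eq_zero_of_forall_pow_dvd hφ fun n => ?_
  have hg := g.eq_X_pow_mul_shift_add_trunc n
  rw [hg]
  simp only [← PowerSeries.coe_substAlgHom hs, ← PowerSeries.coe_substAlgHom hs', map_add,
    map_mul, map_pow, PowerSeries.substAlgHom_X, PowerSeries.substAlgHom_coe,
    ← Polynomial.aeval_algHom_apply]
  rw [add_sub_add_right_eq_sub, ← mul_sub]
  exact dvd_mul_right _ _

theorem constantCoeff_subst_of_constantCoeff_eq_zero (g : PowerSeries ℂ) {f : MvPowerSeries σ A}
    (hf : MvPowerSeries.constantCoeff f = 0) :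
    MvPowerSeries.constantCoeff (g.subst f) = algebraMap ℂ A (PowerSeries.constantCoeff g) := by
  have hs : PowerSeries.HasSubst f := PowerSeries.HasSubst.of_constantCoeff_zero hf
  have hg := g.eq_X_pow_mul_shift_add_trunc 1
  rw [hg]
  simp only [← PowerSeries.coe_substAlgHom hs, map_add,
    map_mul, map_pow, PowerSeries.substAlgHom_X, PowerSeries.substAlgHom_coe, hf]
  rw [PowerSeries.trunc_one_left]
  simp [MvPowerSeries.algebraMap_apply]

/-- A partial derivative, as a derivation over `ℂ`. -/
def pderivC (i : σ) : Derivation ℂ (MvPowerSeries σ A) (MvPowerSeries σ A) :=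
  Derivation.mk'
    { toFun := MvPowerSeries.pderiv A i
      map_add' := map_add _
      map_smul' := fun c f => by
        ext d
        simp [MvPowerSeries.coeff_pderiv] }
    (fun a b => Derivation.leibniz (MvPowerSeries.pderiv A i) a b)

theorem pderiv_subst (g : PowerSeries ℂ) {f : MvPowerSeries σ A}
    (hf : MvPowerSeries.constantCoeff f = 0) (i : σ) :
    MvPowerSeries.pderiv A i (g.subst f) =
      (PowerSeries.derivative ℂ g).subst f * MvPowerSeries.pderiv A i f :=
  derivation_subst (pderivC i) g hf

theorem pderiv_mul {σ A : Type} [CommRing A] (i : σ) (f g : MvPowerSeries σ A) :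
    MvPowerSeries.pderiv A i (f * g) =
      MvPowerSeries.pderiv A i f * g + f * MvPowerSeries.pderiv A i g := by
  rw [Derivation.leibniz, smul_eq_mul, smul_eq_mul]
  ring

theorem pderiv_C_mul {σ A : Type} [CommRing A] (i : σ) (a : A) (g : MvPowerSeries σ A) :
    MvPowerSeries.pderiv A i (MvPowerSeries.C a * g) =
      MvPowerSeries.C a * MvPowerSeries.pderiv A i g := by
  rw [pderiv_mul, MvPowerSeries.pderiv_C, zero_mul, zero_add]

end General

theorem isAddTorsionFree_of_algebra {A : Type} [CommRing A] [Algebra ℂ A] :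
    IsAddTorsionFree A := by
  have : Module ℚ A := Module.compHom A (algebraMap ℚ ℂ)
  exact .of_module_rat A

instance : IsAddTorsionFree AtInfinity := isAddTorsionFree_of_algebra

/-! ### Laurent series in the inverse of the spectral variable -/

/-- Multiplication of the coefficient of `z ^ (-n)` by `c n`. -/
def coeffScale (c : ℤ → ℂ) : AtInfinity →+ AtInfinity where
  toFun f := ⟨fun n => c n * f.coeff n, f.isPWO_support.mono fun n hn h => hn (by simp [h])⟩
  map_zero' := by ext n; simp
  map_add' f g := by ext n; simp [mul_add]

@[simp] theorem coeff_coeffScale (c : ℤ → ℂ) (f : AtInfinity) (n : ℤ) :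
    (coeffScale c f).coeff n = c n * f.coeff n := rfl

theorem support_coeffScale_subset (c : ℤ → ℂ) (f : AtInfinity) :
    (coeffScale c f).support ⊆ f.support := fun n hn h => hn (by simp [h])

theorem coeff_mul_coeffScale (c c' : ℤ → ℂ) (f g : AtInfinity) (n : ℤ) :
    (coeffScale c f * coeffScale c' g).coeff n =
      ∑ ij ∈ Finset.antidiagonal f.isPWO_support g.isPWO_support n,
        (c ij.1 * c' ij.2) * (f.coeff ij.1 * g.coeff ij.2) := by
  rw [HahnSeries.coeff_mul_left' f.isPWO_support (support_coeffScale_subset _ f)]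
  refine Finset.sum_subset_zero_on_sdiff (fun ij hij => ?_) (fun ij hij => ?_) fun ij _ => ?_
  · obtain ⟨h1, h2, h3⟩ := Finset.mem_antidiagonal.mp hij
    exact Finset.mem_antidiagonal.mpr ⟨h1, support_coeffScale_subset _ g h2, h3⟩
  · obtain ⟨h1, h2⟩ := Finset.mem_sdiff.mp hij
    obtain ⟨h3, h4, h5⟩ := Finset.mem_antidiagonal.mp h1
    have h6 : c' ij.2 * g.coeff ij.2 = 0 := by
      by_contra h
      exact h2 (Finset.mem_antidiagonal.mpr ⟨h3, h, h5⟩)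
    rw [mul_mul_mul_comm, h6, mul_zero]
  · rw [coeff_coeffScale, coeff_coeffScale, mul_mul_mul_comm]

/-- The ring automorphism `f(z) ↦ f(-z)`. -/
def reflect : AtInfinity →+* AtInfinity :=
  { coeffScale fun n => (-1 : ℂ) ^ n with
    map_one' := by
      ext n
      change (coeffScale (fun n => (-1 : ℂ) ^ n) 1).coeff n = _
      rw [coeff_coeffScale, HahnSeries.coeff_one]
      split_ifs with h
      · simp [h]
      · simp
    map_mul' := fun f g => by
      ext n
      change (coeffScale (fun n => (-1 : ℂ) ^ n) (f * g)).coeff n =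
        (coeffScale (fun n => (-1 : ℂ) ^ n) f * coeffScale (fun n => (-1 : ℂ) ^ n) g).coeff n
      rw [coeff_mul_coeffScale, coeff_coeffScale, HahnSeries.coeff_mul, Finset.mul_sum]
      refine Finset.sum_congr rfl fun ij hij => ?_
      have h : ij.1 + ij.2 = n := (Finset.mem_antidiagonal.mp hij).2.2
      rw [← h, zpow_add₀ (by norm_num)] }

theorem coeff_reflect (f : AtInfinity) (n : ℤ) :
    (reflect f).coeff n = (-1 : ℂ) ^ n * f.coeff n := rfl

/-- The Euler operator `z d/dz`. -/
def eulerOp : AtInfinity →+ AtInfinity := coeffScale fun n => -(n : ℂ)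

theorem eulerOp_mul (f g : AtInfinity) : eulerOp (f * g) = eulerOp f * g + f * eulerOp g := by
  ext n
  have e1 := coeff_mul_coeffScale (fun n => -(n : ℂ)) (fun _ => 1) f g n
  have e2 := coeff_mul_coeffScale (fun _ => 1) (fun n => -(n : ℂ)) f g n
  have e3 : ∀ f, coeffScale (fun _ => 1) f = f := fun f => by ext n; simp
  rw [e3] at e1 e2
  rw [HahnSeries.coeff_add, eulerOp, e1, e2, coeff_coeffScale, HahnSeries.coeff_mul,
    Finset.mul_sum, ← Finset.sum_add_distrib]
  refine Finset.sum_congr rfl fun ij hij => ?_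
  have h : ij.1 + ij.2 = n := (Finset.mem_antidiagonal.mp hij).2.2
  simp only [← h]
  push_cast
  ring

/-- The derivation `d/dz`. -/
def dz : AtInfinity →+ AtInfinity :=
  (AddMonoidHom.mulLeft (HahnSeries.single (1 : ℤ) (1 : ℂ) : AtInfinity)).comp eulerOp

theorem dz_mul (f g : AtInfinity) : dz (f * g) = dz f * g + f * dz g := by
  simp only [dz, AddMonoidHom.comp_apply, AddMonoidHom.coe_mulLeft, eulerOp_mul]
  ring

theorem coeff_dz (f : AtInfinity) (n : ℤ) :
    (dz f).coeff n = -((n : ℂ) - 1) * f.coeff (n - 1) := by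
  have := HahnSeries.coeff_single_mul_add (r := (1 : ℂ)) (x := eulerOp f) (a := n - 1) (b := 1)
  rw [sub_add_cancel] at this
  rw [dz, AddMonoidHom.comp_apply, AddMonoidHom.coe_mulLeft, this, one_mul, eulerOp,
    coeff_coeffScale]
  push_cast
  ring

theorem z_pow (k : ℕ) : z ^ k = HahnSeries.single (-(k : ℤ)) (1 : ℂ) := by
  rw [z, HahnSeries.single_pow]
  simp

theorem coeff_z_pow_mul (k : ℕ) (f : AtInfinity) (n : ℤ) :
    (z ^ k * f).coeff n = f.coeff (n + k) := by
  have := HahnSeries.coeff_single_mul_add (r := (1 : ℂ)) (x := f) (a := n + k) (b := -(k : ℤ))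
  rw [add_neg_cancel_right] at this
  rw [z_pow, this, one_mul]

theorem algebraMap_atInfinity (c : ℂ) : algebraMap ℂ AtInfinity c = HahnSeries.C c := by
  rw [HahnSeries.algebraMap_apply']
  simp

theorem dz_C (c : ℂ) : dz (HahnSeries.C c) = 0 := by
  ext n
  rw [coeff_dz, HahnSeries.C_apply, HahnSeries.coeff_single]
  split_ifs with h
  · simp [sub_eq_zero.mp h]
  · simp

theorem dz_z : dz z = 1 := by
  ext n
  rw [coeff_dz, z, HahnSeries.coeff_single, HahnSeries.coeff_one]
  by_cases h : n = 0
  · simp [h]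
  · rw [if_neg h, if_neg (by omega), mul_zero]

theorem reflect_C (c : ℂ) : reflect (HahnSeries.C c) = HahnSeries.C c := by
  ext n
  rw [coeff_reflect, HahnSeries.C_apply, HahnSeries.coeff_single]
  split_ifs with h
  · simp [h]
  · simp

theorem reflect_z : reflect z = -z := by
  ext n
  rw [coeff_reflect, HahnSeries.coeff_neg, z, HahnSeries.coeff_single]
  split_ifs with h
  · simp [h]
  · simp

theorem smul_atInfinity (c : ℂ) (f : AtInfinity) : c • f = HahnSeries.C c * f := by
  ext n
  simp

/-! ### Operations on series in the times with Laurent coefficients -/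

/-- The substitution `z ↦ -z`. -/
def reflectW : WaveRing →+* WaveRing := MvPowerSeries.map reflect

/-- The derivation `∂/∂z`. -/
def dzW : WaveRing →+ WaveRing := coeffMap dz

/-- The coefficient of `z ^ (-n)`. -/
def cf (n : ℤ) : WaveRing →+ TimeSeries :=
  coeffMap { toFun := fun f => f.coeff n, map_zero' := rfl, map_add' := fun _ _ => rfl }

theorem coeff_cf (n : ℤ) (f : WaveRing) (d : ℕ →₀ ℕ) :
    MvPowerSeries.coeff d (cf n f) = (MvPowerSeries.coeff d f).coeff n := rfl

theorem cf_ext {f g : WaveRing} (h : ∀ n, cf n f = cf n g) : f = g := by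
  ext d n
  exact congrArg (MvPowerSeries.coeff d) (h n)

theorem coeff_toWave (t : TimeSeries) (d : ℕ →₀ ℕ) :
    MvPowerSeries.coeff d (toWave t) = HahnSeries.C (MvPowerSeries.coeff d t) := rfl

theorem cf_toWave_mul (n : ℤ) (t : TimeSeries) (f : WaveRing) :
    cf n (toWave t * f) = t * cf n f := by
  classical
  ext d
  rw [coeff_cf, MvPowerSeries.coeff_mul, MvPowerSeries.coeff_mul, HahnSeries.coeff_sum]
  refine Finset.sum_congr rfl fun p _ => ?_
  rw [coeff_toWave, HahnSeries.C_mul_eq_smul, HahnSeries.coeff_smul, smul_eq_mul, coeff_cf]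

theorem cf_one (n : ℤ) : cf n 1 = if n = 0 then 1 else 0 := by
  classical
  ext d
  rw [coeff_cf, MvPowerSeries.coeff_one]
  by_cases hd : d = 0
  · by_cases hn : n = 0 <;> simp [hd, hn, MvPowerSeries.coeff_one]
  · by_cases hn : n = 0 <;> simp [hd, hn, MvPowerSeries.coeff_one]

theorem cf_toWave (n : ℤ) (t : TimeSeries) : cf n (toWave t) = if n = 0 then t else 0 := by
  have h := cf_toWave_mul n t 1
  rw [mul_one, cf_one] at h
  rw [h]
  split_ifs <;> simp

theorem cf_zW_pow_mul (n : ℤ) (k : ℕ) (f : WaveRing) :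
    cf n (zW ^ k * f) = cf (n + k) f := by
  ext d
  rw [coeff_cf, coeff_cf, zW, ← map_pow, MvPowerSeries.coeff_C_mul, coeff_z_pow_mul]

theorem cf_zW_mul (n : ℤ) (f : WaveRing) : cf n (zW * f) = cf (n + 1) f := by
  simpa using cf_zW_pow_mul n 1 f

theorem cf_pderiv (n : ℤ) (k : ℕ) (f : WaveRing) :
    cf n (MvPowerSeries.pderiv AtInfinity k f) = MvPowerSeries.pderiv ℂ k (cf n f) :=
  coeffMap_pderiv _ _ _

theorem cf_reflectW (n : ℤ) (f : WaveRing) :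
    cf n (reflectW f) = MvPowerSeries.C ((-1 : ℂ) ^ n) * cf n f := by
  ext d
  rw [coeff_cf, reflectW, MvPowerSeries.coeff_map, MvPowerSeries.coeff_C_mul, coeff_reflect,
    coeff_cf]

theorem cf_dzW (n : ℤ) (f : WaveRing) :
    cf n (dzW f) = MvPowerSeries.C (-((n : ℂ) - 1)) * cf (n - 1) f := by
  ext d
  rw [coeff_cf, dzW, coeff_coeffMap, MvPowerSeries.coeff_C_mul, coeff_dz, coeff_cf]

theorem reflectW_reflectW (f : WaveRing) : reflectW (reflectW f) = f := by
  refine cf_ext fun n => ?_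
  rw [cf_reflectW, cf_reflectW, ← mul_assoc, ← map_mul, ← mul_zpow]
  simp

theorem reflectW_pderiv (k : ℕ) (f : WaveRing) :
    reflectW (MvPowerSeries.pderiv AtInfinity k f) =
      MvPowerSeries.pderiv AtInfinity k (reflectW f) := map_pderiv _ _ _

theorem reflectW_dx (f : WaveRing) : reflectW (dx f) = dx (reflectW f) := map_pderiv _ _ _

theorem reflectW_toWave (t : TimeSeries) : reflectW (toWave t) = toWave t := by
  ext d
  rw [reflectW, MvPowerSeries.coeff_map, coeff_toWave, reflect_C]

theorem reflectW_zW : reflectW zW = -zW := by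
  rw [reflectW, zW, MvPowerSeries.map_C, reflect_z, map_neg]

theorem pderiv_toWave (k : ℕ) (t : TimeSeries) :
    MvPowerSeries.pderiv AtInfinity k (toWave t) = toWave (MvPowerSeries.pderiv ℂ k t) :=
  (map_pderiv _ _ _).symm

theorem pderiv_zW (k : ℕ) : MvPowerSeries.pderiv AtInfinity k zW = 0 := MvPowerSeries.pderiv_C

theorem dx_mul (f g : WaveRing) : dx (f * g) = dx f * g + f * dx g := pderiv_mul _ _ _

theorem dx_add (f g : WaveRing) : dx (f + g) = dx f + dx g := map_add _ _ _

theorem dx_sub (f g : WaveRing) : dx (f - g) = dx f - dx g := map_sub _ _ _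

theorem dx_zW : dx zW = 0 := pderiv_zW 0

theorem dx_zW_sq_mul (f : WaveRing) : dx (zW ^ 2 * f) = zW ^ 2 * dx f := by
  rw [dx_mul, pow_two, dx_mul, dx_zW]
  ring

theorem cf_dx (n : ℤ) (f : WaveRing) : cf n (dx f) = MvPowerSeries.pderiv ℂ 0 (cf n f) :=
  cf_pderiv _ _ _

theorem dzW_mul (f g : WaveRing) : dzW (f * g) = dzW f * g + f * dzW g :=
  coeffMap_mul dz dz_mul f g

theorem dzW_dx (f : WaveRing) : dzW (dx f) = dx (dzW f) := coeffMap_pderiv _ _ _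

theorem dzW_C (a : AtInfinity) : dzW (MvPowerSeries.C a) = MvPowerSeries.C (dz a) := by
  classical
  ext1 d
  rw [dzW, coeff_coeffMap, MvPowerSeries.coeff_C, MvPowerSeries.coeff_C]
  split_ifs <;> simp

theorem dzW_toWave (t : TimeSeries) : dzW (toWave t) = 0 := by
  ext1 d
  rw [dzW, coeff_coeffMap, coeff_toWave, dz_C, map_zero]

theorem dzW_zW : dzW zW = 1 := by rw [zW, dzW_C, dz_z, map_one]

theorem zW_mul_inv : zW * MvPowerSeries.C (HahnSeries.single (1 : ℤ) (1 : ℂ)) = (1 : WaveRing) := by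
  rw [zW, ← map_mul, z, HahnSeries.single_mul_single]
  simp

theorem isUnit_zW : IsUnit zW := IsUnit.of_mul_eq_one _ zW_mul_inv

theorem isUnit_two_zW : IsUnit (2 * zW) := by
  refine IsUnit.mul ?_ isUnit_zW
  refine IsUnit.of_mul_eq_one (MvPowerSeries.C (HahnSeries.C (1 / 2 : ℂ))) ?_
  have : (2 : WaveRing) = MvPowerSeries.C (HahnSeries.C (2 : ℂ)) := by
    rw [map_ofNat HahnSeries.C, map_ofNat]
  rw [this, ← map_mul, ← map_mul]
  norm_num

/-! ### Exponentials, logarithms and the phase -/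

section Exponential

variable {σ : Type}

theorem pderiv_expSeries {f : MvPowerSeries σ AtInfinity}
    (hf : MvPowerSeries.constantCoeff f = 0) (i : σ) :
    MvPowerSeries.pderiv AtInfinity i (expSeries f) =
      expSeries f * MvPowerSeries.pderiv AtInfinity i f := by
  rw [expSeries, pderiv_subst _ hf, PowerSeries.derivative_exp]

theorem constantCoeff_expSeries {f : MvPowerSeries σ AtInfinity}
    (hf : MvPowerSeries.constantCoeff f = 0) :
    MvPowerSeries.constantCoeff (expSeries f) = 1 := by
  rw [expSeries, constantCoeff_subst_of_constantCoeff_eq_zero _ hf]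
  simp

theorem expSeries_mul_expSeries_neg {f : MvPowerSeries σ AtInfinity}
    (hf : MvPowerSeries.constantCoeff f = 0) : expSeries f * expSeries (-f) = 1 := by
  have hf' : MvPowerSeries.constantCoeff (-f) = 0 := by rw [map_neg, hf, neg_zero]
  refine MvPowerSeries.pderiv.ext (fun i => ?_) ?_
  · rw [pderiv_mul, pderiv_expSeries hf, pderiv_expSeries hf', map_neg, ← map_one MvPowerSeries.C,
      MvPowerSeries.pderiv_C]
    ring
  · rw [map_mul, constantCoeff_expSeries hf, constantCoeff_expSeries hf', mul_one, map_one]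

theorem expSeries_add {f g : MvPowerSeries σ AtInfinity}
    (hf : MvPowerSeries.constantCoeff f = 0) (hg : MvPowerSeries.constantCoeff g = 0) :
    expSeries (f + g) = expSeries f * expSeries g := by
  have hfg : MvPowerSeries.constantCoeff (f + g) = 0 := by rw [map_add, hf, hg, add_zero]
  have hfg' : MvPowerSeries.constantCoeff (-(f + g)) = 0 := by rw [map_neg, hfg, neg_zero]
  have key : expSeries (-(f + g)) * (expSeries f * expSeries g) = 1 := by
    refine MvPowerSeries.pderiv.ext (fun i => ?_) ?_
    · rw [pderiv_mul, pderiv_mul, pderiv_expSeries hf, pderiv_expSeries hg,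
        pderiv_expSeries hfg', map_neg, map_add, ← map_one MvPowerSeries.C, MvPowerSeries.pderiv_C]
      ring
    · rw [map_mul, map_mul, constantCoeff_expSeries hf, constantCoeff_expSeries hg,
        constantCoeff_expSeries hfg', mul_one, mul_one, map_one]
  calc expSeries (f + g) = expSeries (f + g) * 1 := (mul_one _).symm
    _ = (expSeries (f + g) * expSeries (-(f + g))) * (expSeries f * expSeries g) := by
        rw [← key]; ring
    _ = _ := by rw [expSeries_mul_expSeries_neg hfg, one_mul]

theorem pderiv_linearSeries {R : Type} [CommRing R] (c : σ → R) (i : σ) :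
    MvPowerSeries.pderiv R i (linearSeries c) = MvPowerSeries.C (c i) := by
  classical
  ext d
  rw [MvPowerSeries.coeff_pderiv, MvPowerSeries.coeff_C]
  by_cases hd : d = 0
  · rw [hd, zero_add, coeff_single_linearSeries]
    simp
  · rw [if_neg hd, coeff_linearSeries_of_ne, zero_mul]
    intro j hj
    apply hd
    have h1 := congrArg Finsupp.degree hj
    simp only [map_add, Finsupp.degree_single] at h1
    exact (Finsupp.degree_eq_zero_iff d).mp (by omega)

end Exponential

/-- The function `z ^ (2 k + 1) / (2 k + 1)!!` multiplying `t k` in the phase. -/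
def phaseCoeff (k : ℕ) : AtInfinity := ((Nat.doubleFactorial (2 * k + 1) : ℂ)⁻¹) • z ^ (2 * k + 1)

theorem constantCoeff_phase : MvPowerSeries.constantCoeff phase = 0 :=
  constantCoeff_linearSeries _

theorem constantCoeff_neg_phase : MvPowerSeries.constantCoeff (-phase) = 0 := by
  rw [map_neg, constantCoeff_phase, neg_zero]

theorem pderiv_phase (k : ℕ) :
    MvPowerSeries.pderiv AtInfinity k phase = MvPowerSeries.C (phaseCoeff k) :=
  pderiv_linearSeries _ _

theorem pderiv_exp_phase (k : ℕ) :
    MvPowerSeries.pderiv AtInfinity k (expSeries phase) =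
      MvPowerSeries.C (phaseCoeff k) * expSeries phase := by
  rw [pderiv_expSeries constantCoeff_phase, pderiv_phase, mul_comm]

theorem pderiv_exp_neg_phase (k : ℕ) :
    MvPowerSeries.pderiv AtInfinity k (expSeries (-phase)) =
      -(MvPowerSeries.C (phaseCoeff k) * expSeries (-phase)) := by
  rw [pderiv_expSeries constantCoeff_neg_phase, map_neg, pderiv_phase]
  ring

theorem exp_phase_mul_exp_neg_phase : expSeries phase * expSeries (-phase) = 1 :=
  expSeries_mul_expSeries_neg constantCoeff_phase

theorem phaseCoeff_zero : phaseCoeff 0 = z := by simp [phaseCoeff]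

theorem reflect_phaseCoeff (k : ℕ) : reflect (phaseCoeff k) = -phaseCoeff k := by
  rw [phaseCoeff, smul_atInfinity, map_mul, map_pow, reflect_C, reflect_z,
    Odd.neg_pow (⟨k, rfl⟩ : Odd (2 * k + 1)) z, mul_neg]

theorem reflectW_phase : reflectW phase = -phase := by
  refine MvPowerSeries.pderiv.ext (fun i => ?_) ?_
  · rw [← reflectW_pderiv, map_neg, pderiv_phase, reflectW, MvPowerSeries.map_C,
      reflect_phaseCoeff, map_neg]
  · rw [reflectW, MvPowerSeries.constantCoeff_map, constantCoeff_phase, map_zero,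
      constantCoeff_neg_phase]

/-- The substitution `z ↦ -z`, as an algebra homomorphism. -/
def reflectAlg : AtInfinity →ₐ[ℂ] AtInfinity where
  toRingHom := reflect
  commutes' c := by
    change reflect _ = _
    rw [algebraMap_atInfinity, reflect_C]

theorem reflectW_exp_phase : reflectW (expSeries phase) = expSeries (-phase) := by
  have h := algHom_subst (MvPowerSeries.mapAlgHom (σ := ℕ) reflectAlg) (PowerSeries.exp ℂ)
    constantCoeff_phase (by
      change MvPowerSeries.constantCoeff (reflectW phase) = 0
      rw [reflectW_phase, constantCoeff_neg_phase])
  change reflectW (expSeries phase) = (PowerSeries.exp ℂ).subst (reflectW phase) at h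
  rw [h, reflectW_phase, expSeries]

theorem dzW_exp_phase : dzW (expSeries phase) = expSeries phase * dzW phase := by
  have h := derivation_subst (coeffDerivation dz dz_mul fun c => by
    rw [algebraMap_atInfinity, dz_C]) (PowerSeries.exp ℂ) constantCoeff_phase
  rw [PowerSeries.derivative_exp] at h
  exact h

theorem dzW_exp_neg_phase : dzW (expSeries (-phase)) = -(expSeries (-phase) * dzW phase) := by
  have h := congrArg dzW exp_phase_mul_exp_neg_phase
  rw [dzW_mul, dzW_exp_phase, ← map_one toWave, dzW_toWave] at h
  linear_combination expSeries (-phase) * h -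
    (dzW (expSeries (-phase)) + expSeries (-phase) * dzW phase) * exp_phase_mul_exp_neg_phase

theorem pderiv_logSeries {τ : TimeSeries} (hτ : MvPowerSeries.constantCoeff τ ≠ 0) (k : ℕ) :
    MvPowerSeries.pderiv ℂ k (logSeries τ) = τ⁻¹ * MvPowerSeries.pderiv ℂ k τ := by
  set c := MvPowerSeries.constantCoeff τ with hc
  set f := MvPowerSeries.C c⁻¹ * τ - 1 with hf
  have hf0 : MvPowerSeries.constantCoeff f = 0 := by
    rw [hf, map_sub, map_mul, MvPowerSeries.constantCoeff_C, ← hc, inv_mul_cancel₀ hτ, map_one,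
      sub_self]
  have hs : PowerSeries.HasSubst f := PowerSeries.HasSubst.of_constantCoeff_zero hf0
  have h1 : (PowerSeries.derivative ℂ (PowerSeries.log ℂ)) * (1 + PowerSeries.X) = 1 := by
    rw [PowerSeries.deriv_log, mul_add, mul_one]
    ext n
    cases n with
    | zero => simp
    | succ n => simp [PowerSeries.coeff_succ_mul_X, PowerSeries.coeff_one, pow_succ]
  have h2 := congrArg (PowerSeries.substAlgHom hs) h1
  rw [map_mul, map_add, map_one, PowerSeries.substAlgHom_X, PowerSeries.coe_substAlgHom] at h2
  have h3 : 1 + f = MvPowerSeries.C c⁻¹ * τ := by rw [hf]; ring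
  rw [h3] at h2
  have h4 : τ * τ⁻¹ = 1 := MvPowerSeries.mul_inv_cancel _ hτ
  have h5 : MvPowerSeries.pderiv ℂ k f = MvPowerSeries.C c⁻¹ * MvPowerSeries.pderiv ℂ k τ := by
    rw [hf, map_sub, pderiv_C_mul, ← map_one MvPowerSeries.C, MvPowerSeries.pderiv_C, sub_zero]
  rw [logSeries, map_add, MvPowerSeries.pderiv_C, zero_add, ← hc, ← hf, pderiv_subst _ hf0, h5]
  linear_combination (τ⁻¹ * MvPowerSeries.pderiv ℂ k τ) * h2 -
    (PowerSeries.subst f (PowerSeries.derivative ℂ (PowerSeries.log ℂ))) *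
      (MvPowerSeries.C c⁻¹ * MvPowerSeries.pderiv ℂ k τ) * h4

/-! ### Miwa shifts as formal Taylor expansions -/

section Nabla

variable {A : Type} [CommRing A]

/-- The operator `∑ k, (2 k + 1)!! v ^ (2 k) ∂/∂t_k` on power series in `v`. -/
def nablaV (y : PowerSeries (MvPowerSeries ℕ A)) : PowerSeries (MvPowerSeries ℕ A) :=
  PowerSeries.mk fun n => ∑ k ∈ Finset.range (n / 2 + 1),
    Nat.doubleFactorial (2 * k + 1) •
      MvPowerSeries.pderiv A k (PowerSeries.coeff (n - 2 * k) y)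

/-- A partial sum of `nablaV`. -/
def nablaVTrunc (N : ℕ) (y : PowerSeries (MvPowerSeries ℕ A)) : PowerSeries (MvPowerSeries ℕ A) :=
  ∑ k ∈ Finset.range N, PowerSeries.X ^ (2 * k) * Nat.doubleFactorial (2 * k + 1) •
    (coeffMap (σ := Unit) (MvPowerSeries.pderiv A k : MvPowerSeries ℕ A →+ MvPowerSeries ℕ A) y :
      PowerSeries (MvPowerSeries ℕ A))

theorem coeff_nablaVTrunc {N n : ℕ} (h : n < N) (y : PowerSeries (MvPowerSeries ℕ A)) :
    PowerSeries.coeff n (nablaVTrunc N y) = PowerSeries.coeff n (nablaV y) := by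
  rw [nablaVTrunc, nablaV, PowerSeries.coeff_mk, map_sum]
  symm
  refine (Finset.sum_congr rfl fun k hk => ?_).trans
    (Finset.sum_subset (s₁ := Finset.range (n / 2 + 1)) ?_ ?_)
  · have hk' : 2 * k ≤ n := by
      have := Finset.mem_range.mp hk
      omega
    rw [PowerSeries.coeff_X_pow_mul', if_pos hk', map_nsmul]
    rfl
  · intro k hk
    have := Finset.mem_range.mp hk
    exact Finset.mem_range.mpr (by omega)
  · intro k _ hk
    have hk' : ¬ 2 * k ≤ n := by
      intro h
      exact hk (Finset.mem_range.mpr (by omega))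
    rw [PowerSeries.coeff_X_pow_mul', if_neg hk']

theorem nablaVTrunc_mul (N : ℕ) (y w : PowerSeries (MvPowerSeries ℕ A)) :
    nablaVTrunc N (y * w) = nablaVTrunc N y * w + y * nablaVTrunc N w := by
  simp only [nablaVTrunc, Finset.sum_mul, Finset.mul_sum, ← Finset.sum_add_distrib]
  refine Finset.sum_congr rfl fun k _ => ?_
  have h := coeffMap_mul (σ := Unit)
    (MvPowerSeries.pderiv A k : MvPowerSeries ℕ A →+ MvPowerSeries ℕ A)
    (fun a b => pderiv_mul k a b) y w
  have h' : (coeffMap (σ := Unit)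
      (MvPowerSeries.pderiv A k : MvPowerSeries ℕ A →+ MvPowerSeries ℕ A) (y * w) :
        PowerSeries (MvPowerSeries ℕ A)) = _ := h
  rw [h', smul_add, mul_add]
  simp only [nsmul_eq_mul]
  ring

theorem nablaV_mul (y w : PowerSeries (MvPowerSeries ℕ A)) :
    nablaV (y * w) = nablaV y * w + y * nablaV w := by
  ext1 n
  rw [← coeff_nablaVTrunc n.lt_succ_self, nablaVTrunc_mul, map_add, map_add,
    PowerSeries.coeff_mul, PowerSeries.coeff_mul, PowerSeries.coeff_mul, PowerSeries.coeff_mul]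
  congr 1 <;> refine Finset.sum_congr rfl fun p hp => ?_
  · rw [coeff_nablaVTrunc (by have := Finset.HasAntidiagonal.mem_antidiagonal.mp hp; omega)]
  · rw [coeff_nablaVTrunc (by have := Finset.HasAntidiagonal.mem_antidiagonal.mp hp; omega)]

theorem nablaV_add (y w : PowerSeries (MvPowerSeries ℕ A)) :
    nablaV (y + w) = nablaV y + nablaV w := by
  ext1 n
  simp only [nablaV, PowerSeries.coeff_mk, map_add, smul_add, Finset.sum_add_distrib]

theorem coeff_nablaV_C (f : MvPowerSeries ℕ A) (n : ℕ) :
    PowerSeries.coeff n (nablaV (PowerSeries.C f)) =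
      if n = 2 * (n / 2) then
        Nat.doubleFactorial (2 * (n / 2) + 1) • MvPowerSeries.pderiv A (n / 2) f else 0 := by
  rw [nablaV, PowerSeries.coeff_mk, Finset.sum_eq_single (n / 2)]
  · rw [PowerSeries.coeff_C]
    by_cases h : n = 2 * (n / 2)
    · rw [if_pos h, if_pos (by omega)]
    · rw [if_neg h, if_neg (by omega), map_zero, smul_zero]
  · intro k hk hne
    have := Finset.mem_range.mp hk
    rw [PowerSeries.coeff_C, if_neg (by omega), map_zero, smul_zero]
  · intro h
    exact absurd (Finset.mem_range.mpr (by omega)) h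

theorem nablaV_natCast_mul_X_pow (c m : ℕ) :
    nablaV (PowerSeries.C (c : MvPowerSeries ℕ A) * PowerSeries.X ^ m) = 0 := by
  ext1 n
  rw [nablaV, PowerSeries.coeff_mk, map_zero]
  refine Finset.sum_eq_zero fun k _ => ?_
  rw [PowerSeries.coeff_C_mul, PowerSeries.coeff_X_pow, mul_ite, mul_one, mul_zero, apply_ite
    (MvPowerSeries.pderiv A k), map_zero, ← map_natCast MvPowerSeries.C, MvPowerSeries.pderiv_C,
    ite_self, smul_zero]

end Nabla

section Taylor

variable {A B : Type} [CommRing A] [CommRing B] [Algebra ℂ A] [Algebra ℂ B]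

/-- The coefficient of `v ^ m` in the Taylor expansion of `f(t + [v])`, the `k`-th time being
shifted by `(2 k - 1)!! v ^ (2 k + 1)`.  The recursion expresses that the derivative of the
shifted series with respect to `v` is its image under `∑ k, (2 k + 1)!! v ^ (2 k) ∂/∂t_k`. -/
def taylor (f : MvPowerSeries ℕ A) : ℕ → MvPowerSeries ℕ A
  | 0 => f
  | m + 1 => MvPowerSeries.C (algebraMap ℂ A ((m : ℂ) + 1)⁻¹) *
      ∑ k ∈ Finset.range (m / 2 + 1),
        Nat.doubleFactorial (2 * k + 1) • MvPowerSeries.pderiv A k (taylor f (m - 2 * k))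
  decreasing_by omega

theorem taylor_zero (f : MvPowerSeries ℕ A) : taylor f 0 = f := by rw [taylor]

theorem taylor_succ' (f : MvPowerSeries ℕ A) (m : ℕ) :
    taylor f (m + 1) = MvPowerSeries.C (algebraMap ℂ A ((m : ℂ) + 1)⁻¹) *
      ∑ k ∈ Finset.range (m / 2 + 1),
        Nat.doubleFactorial (2 * k + 1) • MvPowerSeries.pderiv A k (taylor f (m - 2 * k)) := by
  rw [taylor]

theorem taylor_succ (f : MvPowerSeries ℕ A) (m : ℕ) :
    ((m : MvPowerSeries ℕ A) + 1) * taylor f (m + 1) =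
      ∑ k ∈ Finset.range (m / 2 + 1),
        Nat.doubleFactorial (2 * k + 1) • MvPowerSeries.pderiv A k (taylor f (m - 2 * k)) := by
  have h : ((m : MvPowerSeries ℕ A) + 1) =
      MvPowerSeries.C (algebraMap ℂ A ((m : ℂ) + 1)) := by simp
  rw [taylor_succ', h, ← mul_assoc, ← map_mul, ← map_mul, mul_inv_cancel₀, map_one, map_one, one_mul]
  exact_mod_cast Nat.succ_ne_zero m

theorem natCast_add_one_mul_cancel {a b : MvPowerSeries ℕ A} (m : ℕ)
    (h : ((m : MvPowerSeries ℕ A) + 1) * a = ((m : MvPowerSeries ℕ A) + 1) * b) : a = b := by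
  have h1 : MvPowerSeries.C (algebraMap ℂ A ((m : ℂ) + 1)⁻¹) * ((m : MvPowerSeries ℕ A) + 1) = 1 := by
    have h : ((m : MvPowerSeries ℕ A) + 1) =
      MvPowerSeries.C (algebraMap ℂ A ((m : ℂ) + 1)) := by simp
    rw [h, ← map_mul, ← map_mul, inv_mul_cancel₀, map_one, map_one]
    exact_mod_cast Nat.succ_ne_zero m
  calc a = MvPowerSeries.C (algebraMap ℂ A ((m : ℂ) + 1)⁻¹) * ((m : MvPowerSeries ℕ A) + 1) * a := by
        rw [h1, one_mul]
    _ = b := by rw [mul_assoc, h, ← mul_assoc, h1, one_mul]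

/-- Any additive map commuting with the time derivatives commutes with Taylor expansion. -/
theorem map_taylor (φ : MvPowerSeries ℕ A →+ MvPowerSeries ℕ B)
    (hφ : ∀ k f, φ (MvPowerSeries.pderiv A k f) = MvPowerSeries.pderiv B k (φ f))
    (f : MvPowerSeries ℕ A) (m : ℕ) : φ (taylor f m) = taylor (φ f) m := by
  induction m using Nat.strong_induction_on with
  | _ m ih =>
    cases m with
    | zero => rw [taylor_zero, taylor_zero]
    | succ m =>
      apply natCast_add_one_mul_cancel m
      rw [taylor_succ]
      have h := congrArg φ (taylor_succ f m)
      rw [← Nat.cast_add_one, ← nsmul_eq_mul, map_nsmul, nsmul_eq_mul, Nat.cast_add_one] at h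
      rw [h, map_sum]
      refine Finset.sum_congr rfl fun k hk => ?_
      rw [map_nsmul, hφ, ih _ (by omega)]

theorem taylor_pderiv (f : MvPowerSeries ℕ A) (k m : ℕ) :
    MvPowerSeries.pderiv A k (taylor f m) = taylor (MvPowerSeries.pderiv A k f) m :=
  map_taylor (MvPowerSeries.pderiv A k : MvPowerSeries ℕ A →+ MvPowerSeries ℕ A)
    (fun j f => pderiv_comm k j f) f m

/-- The Taylor expansion of `f(t + [v])` as a power series in `v`. -/
def shift (f : MvPowerSeries ℕ A) : PowerSeries (MvPowerSeries ℕ A) :=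
  PowerSeries.mk (taylor f)

@[simp] theorem coeff_shift (f : MvPowerSeries ℕ A) (m : ℕ) :
    PowerSeries.coeff m (shift f) = taylor f m := PowerSeries.coeff_mk _ _

/-- The Taylor expansion solves the differential equation `d/dv = ∑ k, (2 k + 1)!! v ^ (2 k) ∂/∂t_k`. -/
theorem derivative_shift (f : MvPowerSeries ℕ A) :
    PowerSeries.derivative _ (shift f) = nablaV (shift f) := by
  ext1 n
  rw [PowerSeries.coeff_derivative, coeff_shift, mul_comm, taylor_succ, nablaV,
    PowerSeries.coeff_mk]
  simp only [coeff_shift]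

/-- The differential equation and the initial value determine the Taylor expansion. -/
theorem eq_shift_of_derivative {y : PowerSeries (MvPowerSeries ℕ A)}
    (h : PowerSeries.derivative _ y = nablaV y) : y = shift (PowerSeries.constantCoeff y) := by
  ext1 n
  induction n using Nat.strong_induction_on with
  | _ n ih =>
    cases n with
    | zero => rw [coeff_shift, taylor_zero, PowerSeries.coeff_zero_eq_constantCoeff_apply]
    | succ n =>
      apply natCast_add_one_mul_cancel n
      rw [mul_comm, ← PowerSeries.coeff_derivative, h, coeff_shift, taylor_succ, nablaV,
        PowerSeries.coeff_mk]
      refine Finset.sum_congr rfl fun k _ => ?_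
      rw [ih _ (by omega), coeff_shift]

theorem shift_mul (f g : MvPowerSeries ℕ A) : shift (f * g) = shift f * shift g := by
  have h : PowerSeries.derivative _ (shift f * shift g) = nablaV (shift f * shift g) := by
    rw [Derivation.leibniz, nablaV_mul, derivative_shift, derivative_shift]
    simp only [smul_eq_mul]
    ring
  rw [eq_shift_of_derivative h, map_mul]
  congr 2 <;> rw [← PowerSeries.coeff_zero_eq_constantCoeff_apply, coeff_shift, taylor_zero]

theorem shift_C (a : A) : shift (MvPowerSeries.C a : MvPowerSeries ℕ A) =
    PowerSeries.C (MvPowerSeries.C a) := by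
  symm
  have h : PowerSeries.derivative _ (PowerSeries.C (MvPowerSeries.C a : MvPowerSeries ℕ A)) =
      nablaV (PowerSeries.C (MvPowerSeries.C a)) := by
    ext1 n
    rw [nablaV, PowerSeries.coeff_mk, PowerSeries.derivative_C, map_zero]
    refine (Finset.sum_eq_zero fun k _ => ?_).symm
    rw [PowerSeries.coeff_C]
    split_ifs
    · rw [MvPowerSeries.pderiv_C, smul_zero]
    · rw [map_zero, smul_zero]
  rw [eq_shift_of_derivative h, PowerSeries.constantCoeff_C]

theorem shift_add (f g : MvPowerSeries ℕ A) : shift (f + g) = shift f + shift g := by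
  have h : PowerSeries.derivative _ (shift f + shift g) = nablaV (shift f + shift g) := by
    rw [map_add, nablaV_add, derivative_shift, derivative_shift]
  rw [eq_shift_of_derivative h, map_add]
  congr 2 <;> rw [← PowerSeries.coeff_zero_eq_constantCoeff_apply, coeff_shift, taylor_zero]

theorem taylor_C_mul (c : A) (f : MvPowerSeries ℕ A) (m : ℕ) :
    taylor (MvPowerSeries.C c * f) m = MvPowerSeries.C c * taylor f m := by
  rw [← coeff_shift, shift_mul, shift_C, PowerSeries.coeff_C_mul, coeff_shift]

theorem taylor_add (f g : MvPowerSeries ℕ A) (m : ℕ) :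
    taylor (f + g) m = taylor f m + taylor g m := by
  rw [← coeff_shift, shift_add, map_add, coeff_shift, coeff_shift]

/-- The Taylor expansion, as a ring homomorphism. -/
def shiftHom : MvPowerSeries ℕ A →+* PowerSeries (MvPowerSeries ℕ A) where
  toFun := shift
  map_one' := by rw [← map_one MvPowerSeries.C, shift_C]; simp
  map_mul' := shift_mul
  map_zero' := by rw [← map_zero MvPowerSeries.C, shift_C]; simp
  map_add' := shift_add

theorem shift_X (k : ℕ) : shift (MvPowerSeries.X k : MvPowerSeries ℕ A) =
    PowerSeries.C (MvPowerSeries.X k) +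
      PowerSeries.C (Nat.doubleFactorial (2 * k - 1) : MvPowerSeries ℕ A) *
        PowerSeries.X ^ (2 * k + 1) := by
  have hdf : (2 * k + 1) * Nat.doubleFactorial (2 * k - 1) = Nat.doubleFactorial (2 * k + 1) := by
    cases k with
    | zero => simp
    | succ k => exact (Nat.doubleFactorial_add_two _).symm
  symm
  rw [eq_shift_of_derivative (y := _ + _)]
  · simp
  · rw [nablaV_add, nablaV_natCast_mul_X_pow, add_zero]
    ext1 n
    rw [coeff_nablaV_C, map_add, PowerSeries.derivative_C, zero_add,
      PowerSeries.coeff_derivative, PowerSeries.coeff_C_mul, PowerSeries.coeff_X_pow]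
    by_cases hn : n = 2 * k
    · subst hn
      have h2 : 2 * k / 2 = k := by omega
      rw [if_pos rfl, h2, if_pos rfl, MvPowerSeries.pderiv_X_self, ← hdf]
      simp
      ring
    · rw [if_neg (by omega)]
      split_ifs with h
      · rw [MvPowerSeries.pderiv_X_of_ne (by omega)]
        simp
      · simp

end Taylor

/-! ### Comparison of the Miwa shift with the Taylor expansion -/

/-- A functional on power series depends on finitely many coefficients only. -/
def Finitary (l : TimeSeries → ℂ) : Prop :=
  ∃ S : Finset (ℕ →₀ ℕ), ∀ f, (∀ d ∈ S, MvPowerSeries.coeff d f = 0) → l f = 0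

/-- Additive functionals that depend on finitely many coefficients are determined by their
values on polynomials. -/
theorem Finitary.ext {l l' : TimeSeries →+ ℂ} (h : Finitary l) (h' : Finitary l')
    (hp : ∀ p : MvPolynomial ℕ ℂ, l p = l' p) (f : TimeSeries) : l f = l' f := by
  classical
  obtain ⟨S, hS⟩ := h
  obtain ⟨S', hS'⟩ := h'
  set p : MvPolynomial ℕ ℂ :=
    ∑ d ∈ S ∪ S', MvPolynomial.monomial d (MvPowerSeries.coeff d f) with hpdef
  have hc : ∀ d ∈ S ∪ S', MvPowerSeries.coeff d (f - (p : TimeSeries)) = 0 := by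
    intro d hd
    rw [map_sub, MvPolynomial.coeff_coe, hpdef, MvPolynomial.coeff_sum]
    simp only [MvPolynomial.coeff_monomial]
    rw [Finset.sum_ite_eq' (S ∪ S') d, if_pos hd, sub_self]
  have h1 := hS _ fun d hd => hc d (Finset.mem_union_left _ hd)
  have h2 := hS' _ fun d hd => hc d (Finset.mem_union_right _ hd)
  rw [map_sub, sub_eq_zero] at h1 h2
  rw [h1, h2, hp]

theorem finitary_coeff_taylor (m : ℕ) :
    ∀ d : ℕ →₀ ℕ, Finitary fun f => MvPowerSeries.coeff d (taylor f m) := by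
  classical
  induction m using Nat.strong_induction_on with
  | _ m ih =>
    intro d
    cases m with
    | zero =>
      refine ⟨{d}, fun f hf => ?_⟩
      change MvPowerSeries.coeff d (taylor f 0) = 0
      rw [taylor_zero]
      exact hf d (Finset.mem_singleton_self d)
    | succ m =>
      choose S hS using fun k : ℕ => ih (m - 2 * k) (by omega) (d + Finsupp.single k 1)
      refine ⟨(Finset.range (m / 2 + 1)).biUnion S, fun f hf => ?_⟩
      change MvPowerSeries.coeff d (taylor f (m + 1)) = 0
      rw [taylor_succ', MvPowerSeries.coeff_C_mul, map_sum, Finset.sum_eq_zero, mul_zero]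
      intro k hk
      have h := hS k f fun d' hd' => hf d' (Finset.mem_biUnion.mpr ⟨k, hk, hd'⟩)
      rw [map_nsmul, MvPowerSeries.coeff_pderiv]
      have h' : MvPowerSeries.coeff (d + Finsupp.single k 1) (taylor f (m - 2 * k)) = 0 := h
      rw [h', zero_mul, smul_zero]

theorem finitary_coeff_subst {κ : Type} {a : ℕ → MvPowerSeries κ ℂ} (ha : MvPowerSeries.HasSubst a)
    (e : κ →₀ ℕ) :
    Finitary fun f => MvPowerSeries.coeff e (MvPowerSeries.subst a f) := by
  have hfin := MvPowerSeries.coeff_subst_finite ha (fun _ => 1 : MvPowerSeries ℕ ℂ) e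
  refine ⟨hfin.toFinset, fun f hf => ?_⟩
  change MvPowerSeries.coeff e (MvPowerSeries.subst a f) = 0
  rw [MvPowerSeries.coeff_subst ha]
  refine finsum_eq_zero_of_forall_eq_zero fun d => ?_
  by_cases hd : d ∈ hfin.toFinset
  · rw [hf d hd, zero_smul]
  · have h1 : MvPowerSeries.coeff d (fun _ => 1 : MvPowerSeries ℕ ℂ) •
        MvPowerSeries.coeff e (d.prod fun s e => a s ^ e) = 0 := by
      by_contra h
      exact hd (hfin.mem_toFinset.mpr h)
    have h2 : MvPowerSeries.coeff d (fun _ => 1 : MvPowerSeries ℕ ℂ) = 1 := rfl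
    rw [h2, one_smul] at h1
    rw [h1, smul_zero]

/-- The substitution of the Miwa shift, with the powers of `z⁻¹` collected. -/
def miwaHom (ε : ℂ) : TimeSeries →+* PowerSeries TimeSeries :=
  ((MvPowerSeries.optionEquivLeft ℕ ℂ).toRingEquiv.toRingHom).comp
    (MvPowerSeries.substAlgHom (R := ℂ) (hasSubst_miwaArg ε)).toRingHom

theorem miwaHom_apply (ε : ℂ) (f : TimeSeries) : miwaHom ε f =
    MvPowerSeries.optionEquivLeft ℕ ℂ (MvPowerSeries.subst (miwaArg ε) f) := by
  rw [← MvPowerSeries.coe_substAlgHom (hasSubst_miwaArg ε)]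
  rfl

theorem rescale_C {R : Type} [CommRing R] (a b : R) :
    PowerSeries.rescale a (PowerSeries.C b) = PowerSeries.C b := by
  ext n
  rw [PowerSeries.coeff_rescale, PowerSeries.coeff_C]
  split_ifs with h
  · rw [h, pow_zero, one_mul]
  · rw [mul_zero]

/-- The Miwa shift by `ε [z⁻¹]` with `ε = ±1` is the Taylor expansion in `v = ε z⁻¹`. -/
theorem miwaHom_coe {ε : ℂ} (hε : ε ^ 2 = 1) (p : MvPolynomial ℕ ℂ) :
    miwaHom ε p = PowerSeries.rescale (MvPowerSeries.C ε : TimeSeries) (shift (p : TimeSeries)) := by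
  have h : (miwaHom ε).comp (MvPolynomial.coeToMvPowerSeries.ringHom (R := ℂ)) =
      ((PowerSeries.rescale (MvPowerSeries.C ε : TimeSeries)).comp shiftHom).comp
        (MvPolynomial.coeToMvPowerSeries.ringHom (R := ℂ)) := by
    apply MvPolynomial.ringHom_ext
    · intro c
      change miwaHom ε (MvPolynomial.C c : MvPolynomial ℕ ℂ) =
        PowerSeries.rescale _ (shift ((MvPolynomial.C c : MvPolynomial ℕ ℂ) : TimeSeries))
      rw [MvPolynomial.coe_C, shift_C, miwaHom_apply, MvPowerSeries.subst_C,
        MvPowerSeries.optionEquivLeft_C, rescale_C]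
    · intro k
      change miwaHom ε (MvPolynomial.X k : MvPolynomial ℕ ℂ) =
        PowerSeries.rescale _ (shift ((MvPolynomial.X k : MvPolynomial ℕ ℂ) : TimeSeries))
      rw [MvPolynomial.coe_X, shift_X, miwaHom_apply,
        MvPowerSeries.subst_X (hasSubst_miwaArg ε), miwaArg, map_add, map_mul, map_pow,
        MvPowerSeries.optionEquivLeft_X_some, MvPowerSeries.optionEquivLeft_X_none,
        MvPowerSeries.optionEquivLeft_C]
      have h2 : (MvPowerSeries.C ε : TimeSeries) ^ (2 * k + 1) = MvPowerSeries.C ε := by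
        rw [pow_succ, pow_mul, ← map_pow, hε, map_one, one_pow, one_mul]
      rw [map_add (PowerSeries.rescale _), map_mul (PowerSeries.rescale _),
        map_pow (PowerSeries.rescale _), rescale_C, rescale_C, PowerSeries.rescale_X, mul_pow,
        ← map_pow PowerSeries.C, h2, map_mul MvPowerSeries.C, map_mul PowerSeries.C, map_natCast]
      ring
  exact RingHom.congr_fun h p

theorem coeff_miwaHom {ε : ℂ} (hε : ε ^ 2 = 1) (f : TimeSeries) (m : ℕ) :
    PowerSeries.coeff m (miwaHom ε f) = MvPowerSeries.C (ε ^ m) * taylor f m := by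
  ext d
  let l : TimeSeries →+ ℂ :=
    { toFun := fun f => MvPowerSeries.coeff d (PowerSeries.coeff m (miwaHom ε f))
      map_zero' := by rw [map_zero, map_zero, map_zero]
      map_add' := fun f g => by rw [map_add, map_add, map_add] }
  let l' : TimeSeries →+ ℂ :=
    { toFun := fun f => MvPowerSeries.coeff d (MvPowerSeries.C (ε ^ m) * taylor f m)
      map_zero' := by
        rw [← coeff_shift]
        change MvPowerSeries.coeff d (_ * PowerSeries.coeff m (shiftHom 0)) = 0
        rw [map_zero, map_zero, mul_zero, map_zero]
      map_add' := fun f g => by rw [taylor_add, mul_add, map_add] }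
  refine Finitary.ext (l := l) (l' := l') ?_ ?_ (fun p => ?_) f
  · obtain ⟨S, hS⟩ := finitary_coeff_subst (hasSubst_miwaArg ε) (d.optionElim m)
    refine ⟨S, fun f hf => ?_⟩
    change MvPowerSeries.coeff d (PowerSeries.coeff m (miwaHom ε f)) = 0
    rw [miwaHom_apply, MvPowerSeries.coeff_coeff_optionEquivLeft]
    exact hS f hf
  · obtain ⟨S, hS⟩ := finitary_coeff_taylor m d
    refine ⟨S, fun f hf => ?_⟩
    change MvPowerSeries.coeff d (MvPowerSeries.C (ε ^ m) * taylor f m) = 0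
    have h : MvPowerSeries.coeff d (taylor f m) = 0 := hS f hf
    rw [MvPowerSeries.coeff_C_mul, h, mul_zero]
  · change MvPowerSeries.coeff d (PowerSeries.coeff m (miwaHom ε p)) =
      MvPowerSeries.coeff d (MvPowerSeries.C (ε ^ m) * taylor p m)
    rw [miwaHom_coe hε, PowerSeries.coeff_rescale, coeff_shift, map_pow]

theorem cf_miwaShift_natCast {ε : ℂ} (hε : ε ^ 2 = 1) (τ : TimeSeries) (m : ℕ) :
    cf m (miwaShift ε τ) = MvPowerSeries.C (ε ^ m) * taylor τ m := by
  rw [← coeff_miwaHom hε]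
  ext d
  rw [miwaHom_apply, MvPowerSeries.coeff_coeff_optionEquivLeft, coeff_cf]
  exact (HahnSeries.ofPowerSeries_apply_coeff _ m).trans (PowerSeries.coeff_mk _ _)

theorem cf_miwaShift_of_neg (ε : ℂ) (τ : TimeSeries) {n : ℤ} (hn : n < 0) :
    cf n (miwaShift ε τ) = 0 := by
  ext d
  rw [coeff_cf]
  have h : ∀ p : PowerSeries ℂ, (HahnSeries.ofPowerSeries ℤ ℂ p).coeff n = 0 := by
    intro p
    rw [PowerSeries.coeff_coe, if_pos hn]
  exact h _

/-! ### The bilinear identity -/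

theorem coeff_rename_inl_mul_rename_inr {A : Type} [CommRing A] (f g : MvPowerSeries ℕ A)
    (d₁ d₂ : ℕ →₀ ℕ) :
    MvPowerSeries.coeff (d₁.embDomain (Function.Embedding.inl : ℕ ↪ ℕ ⊕ ℕ) +
        d₂.embDomain (Function.Embedding.inr : ℕ ↪ ℕ ⊕ ℕ))
      (MvPowerSeries.rename (Function.Embedding.inl : ℕ ↪ ℕ ⊕ ℕ) f *
        MvPowerSeries.rename (Function.Embedding.inr : ℕ ↪ ℕ ⊕ ℕ) g) =
      MvPowerSeries.coeff d₁ f * MvPowerSeries.coeff d₂ g := by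
  classical
  rw [MvPowerSeries.coeff_mul, Finset.sum_eq_single
    (d₁.embDomain (Function.Embedding.inl : ℕ ↪ ℕ ⊕ ℕ),
      d₂.embDomain (Function.Embedding.inr : ℕ ↪ ℕ ⊕ ℕ))]
  · rw [MvPowerSeries.coeff_embDomain_rename, MvPowerSeries.coeff_embDomain_rename]
  · rintro ⟨x, y⟩ hxy hne
    have hxy' : x + y = _ := Finset.HasAntidiagonal.mem_antidiagonal.mp hxy
    by_contra h
    have hx : x ∈ Set.range (Finsupp.mapDomain (Function.Embedding.inl : ℕ ↪ ℕ ⊕ ℕ)) := by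
      by_contra hx
      apply h
      rw [MvPowerSeries.coeff_rename_eq_zero _ _ hx, zero_mul]
    have hy : y ∈ Set.range (Finsupp.mapDomain (Function.Embedding.inr : ℕ ↪ ℕ ⊕ ℕ)) := by
      by_contra hy
      apply h
      rw [MvPowerSeries.coeff_rename_eq_zero _ _ hy, mul_zero]
    obtain ⟨x', rfl⟩ := hx
    obtain ⟨y', rfl⟩ := hy
    rw [← Finsupp.embDomain_eq_mapDomain, ← Finsupp.embDomain_eq_mapDomain] at hxy' hne
    apply hne
    have e1 : ∀ (w : ℕ →₀ ℕ) (j : ℕ),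
        w.embDomain (Function.Embedding.inl : ℕ ↪ ℕ ⊕ ℕ) (Sum.inr j) = 0 := fun w j =>
      Finsupp.embDomain_of_notMem_range _ _ _ (by simp)
    have e2 : ∀ (w : ℕ →₀ ℕ) (j : ℕ),
        w.embDomain (Function.Embedding.inr : ℕ ↪ ℕ ⊕ ℕ) (Sum.inl j) = 0 := fun w j =>
      Finsupp.embDomain_of_notMem_range _ _ _ (by simp)
    have e3 : ∀ (w : ℕ →₀ ℕ) (j : ℕ),
        w.embDomain (Function.Embedding.inl : ℕ ↪ ℕ ⊕ ℕ) (Sum.inl j) = w j := fun w j =>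
      Finsupp.embDomain_apply_self _ _ j
    have e4 : ∀ (w : ℕ →₀ ℕ) (j : ℕ),
        w.embDomain (Function.Embedding.inr : ℕ ↪ ℕ ⊕ ℕ) (Sum.inr j) = w j := fun w j =>
      Finsupp.embDomain_apply_self _ _ j
    have hx' : x' = d₁ := by
      ext j
      have := DFunLike.congr_fun hxy' (Sum.inl j)
      simpa [Finsupp.add_apply, e2, e3] using this
    have hy' : y' = d₂ := by
      ext j
      have := DFunLike.congr_fun hxy' (Sum.inr j)
      simpa [Finsupp.add_apply, e1, e4] using this
    rw [hx', hy']
  · intro h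
    refine absurd ?_ h
    rw [Finset.HasAntidiagonal.mem_antidiagonal]

theorem rename_linearSeries_inl_add_inr {R : Type} [CommRing R] (a b : ℕ → R) :
    MvPowerSeries.rename (Function.Embedding.inl : ℕ ↪ ℕ ⊕ ℕ) (linearSeries a) +
      MvPowerSeries.rename (Function.Embedding.inr : ℕ ↪ ℕ ⊕ ℕ) (linearSeries b) =
      linearSeries (Sum.elim a b) := by
  have hrange : ∀ (ι : ℕ ↪ ℕ ⊕ ℕ) (s : ℕ ⊕ ℕ), s ∉ Set.range ι → ∀ f : MvPowerSeries ℕ R,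
      MvPowerSeries.coeff (Finsupp.single s 1) (MvPowerSeries.rename ι f) = 0 := by
    intro ι s hs f
    apply MvPowerSeries.coeff_rename_eq_zero
    rintro ⟨x, hx⟩
    rw [← Finsupp.embDomain_eq_mapDomain] at hx
    have := DFunLike.congr_fun hx s
    rw [Finsupp.embDomain_of_notMem_range _ _ _ hs, Finsupp.single_eq_same] at this
    exact zero_ne_one this
  have hself : ∀ (ι : ℕ ↪ ℕ ⊕ ℕ) (j : ℕ) (c : ℕ → R),
      MvPowerSeries.coeff (Finsupp.single (ι j) 1) (MvPowerSeries.rename ι (linearSeries c)) =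
        c j := by
    intro ι j c
    rw [← Finsupp.embDomain_single, MvPowerSeries.coeff_embDomain_rename,
      coeff_single_linearSeries]
  have hother : ∀ (ι : ℕ ↪ ℕ ⊕ ℕ) (c : ℕ → R) (d : ℕ ⊕ ℕ →₀ ℕ),
      (∀ s, d ≠ Finsupp.single s 1) →
      MvPowerSeries.coeff d (MvPowerSeries.rename ι (linearSeries c)) = 0 := by
    intro ι c d hd
    by_cases h : d ∈ Set.range (Finsupp.mapDomain ι)
    · obtain ⟨x, rfl⟩ := h
      rw [← Finsupp.embDomain_eq_mapDomain] at hd ⊢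
      rw [MvPowerSeries.coeff_embDomain_rename, coeff_linearSeries_of_ne]
      rintro j rfl
      exact hd (ι j) (Finsupp.embDomain_single _ _ _)
    · exact MvPowerSeries.coeff_rename_eq_zero _ _ h
  ext d
  rw [map_add]
  by_cases hd : ∃ s, d = Finsupp.single s 1
  · obtain ⟨s, rfl⟩ := hd
    rw [coeff_single_linearSeries]
    rcases s with j | j
    · rw [hrange Function.Embedding.inr _ (by simp), add_zero]
      exact hself Function.Embedding.inl j a
    · rw [hrange Function.Embedding.inl _ (by simp), zero_add]
      exact hself Function.Embedding.inr j b
  · have hd' := not_exists.mp hd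
    rw [hother _ _ _ hd', hother _ _ _ hd', coeff_linearSeries_of_ne _ _ hd', add_zero]

theorem expSeries_phaseDiff : expSeries phaseDiff =
    MvPowerSeries.rename (Function.Embedding.inl : ℕ ↪ ℕ ⊕ ℕ) (expSeries phase) *
      MvPowerSeries.rename (Function.Embedding.inr : ℕ ↪ ℕ ⊕ ℕ) (expSeries (-phase)) := by
  have hn : -phase = linearSeries fun j => -phaseCoeff j := by
    refine MvPowerSeries.pderiv.ext (fun i => ?_) ?_
    · rw [map_neg, pderiv_phase, pderiv_linearSeries, map_neg]
    · rw [constantCoeff_neg_phase, constantCoeff_linearSeries]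
  have hc : ∀ (ι : ℕ ↪ ℕ ⊕ ℕ) (f : WaveRing), MvPowerSeries.constantCoeff f = 0 →
      MvPowerSeries.constantCoeff (MvPowerSeries.rename ι f) = 0 := by
    intro ι f hf
    rw [MvPowerSeries.constantCoeff_rename, hf]
  have h1 : phaseDiff = MvPowerSeries.rename (Function.Embedding.inl : ℕ ↪ ℕ ⊕ ℕ) phase +
      MvPowerSeries.rename (Function.Embedding.inr : ℕ ↪ ℕ ⊕ ℕ) (-phase) := by
    rw [hn, phase, rename_linearSeries_inl_add_inr]
    rfl
  have h2 : ∀ (ι : ℕ ↪ ℕ ⊕ ℕ) (f : WaveRing), MvPowerSeries.constantCoeff f = 0 →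
      expSeries (MvPowerSeries.rename ι f) = MvPowerSeries.rename ι (expSeries f) := by
    intro ι f hf
    exact (algHom_subst ((MvPowerSeries.rename ι :
      WaveRing →ₐ[AtInfinity] MvPowerSeries (ℕ ⊕ ℕ) AtInfinity).restrictScalars ℂ)
      (PowerSeries.exp ℂ) hf (hc ι f hf)).symm
  rw [h1, expSeries_add (hc _ _ constantCoeff_phase) (hc _ _ constantCoeff_neg_phase),
    h2 _ _ constantCoeff_phase, h2 _ _ constantCoeff_neg_phase]

/-- The series whose product with `g`, with independent times in the two factors, has no odd
powers of `z` with negative exponent, so that its residues against all `z ^ (2 p) dz` vanish. -/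
def residueFree (g : WaveRing) : AddSubgroup WaveRing where
  carrier := {f | ∀ (d₁ d₂ : ℕ →₀ ℕ) (p : ℕ),
    (MvPowerSeries.coeff d₁ f * MvPowerSeries.coeff d₂ g).coeff (2 * p + 1) = 0}
  zero_mem' := fun d₁ d₂ p => by rw [map_zero, zero_mul]; rfl
  add_mem' := fun {a b} ha hb d₁ d₂ p => by
    rw [map_add, add_mul, HahnSeries.coeff_add, ha, hb, add_zero]
  neg_mem' := fun {a} ha d₁ d₂ p => by
    have e : MvPowerSeries.coeff d₁ (-a) * MvPowerSeries.coeff d₂ g +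
        MvPowerSeries.coeff d₁ a * MvPowerSeries.coeff d₂ g = 0 := by
      rw [← add_mul, ← map_add, neg_add_cancel, map_zero, zero_mul]
    have h := congrArg (fun f : AtInfinity => f.coeff (2 * p + 1)) e
    rwa [HahnSeries.coeff_add, ha, add_zero] at h

theorem residueFree_symm {f g : WaveRing} (h : f ∈ residueFree g) : g ∈ residueFree f :=
  fun d₁ d₂ p => by rw [mul_comm]; exact h d₂ d₁ p

theorem pderiv_mem_residueFree {f g : WaveRing} (k : ℕ) (h : f ∈ residueFree g) :
    MvPowerSeries.pderiv AtInfinity k f ∈ residueFree g := by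
  intro d₁ d₂ p
  have h1 : MvPowerSeries.coeff d₁ (MvPowerSeries.pderiv AtInfinity k f) =
      (d₁ k + 1) • MvPowerSeries.coeff (d₁ + Finsupp.single k 1) f := by
    rw [MvPowerSeries.coeff_pderiv, nsmul_eq_mul, mul_comm]
    push_cast
    rfl
  rw [h1, smul_mul_assoc, HahnSeries.coeff_nsmul, Pi.smul_apply, h, smul_zero]

theorem toWave_mul_mem_residueFree {f g : WaveRing} (t : TimeSeries) (h : f ∈ residueFree g) :
    toWave t * f ∈ residueFree g := by
  classical
  intro d₁ d₂ p
  rw [MvPowerSeries.coeff_mul, Finset.sum_mul, HahnSeries.coeff_sum]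
  refine Finset.sum_eq_zero fun q _ => ?_
  rw [coeff_toWave, mul_assoc, HahnSeries.C_mul_eq_smul, HahnSeries.coeff_smul, h, smul_zero]

theorem zW_sq_mul_mem_residueFree {f g : WaveRing} (h : f ∈ residueFree g) :
    zW ^ 2 * f ∈ residueFree g := by
  intro d₁ d₂ p
  rw [zW, ← map_pow, MvPowerSeries.coeff_C_mul, mul_assoc, coeff_z_pow_mul]
  have := h d₁ d₂ (p + 1)
  push_cast at this ⊢
  rw [← this]
  ring_nf

theorem dx_mem_residueFree {f g : WaveRing} (h : f ∈ residueFree g) : dx f ∈ residueFree g :=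
  pderiv_mem_residueFree 0 h

theorem taylor_mem_residueFree {f g : WaveRing} (h : f ∈ residueFree g) (m : ℕ) :
    taylor f m ∈ residueFree g := by
  induction m using Nat.strong_induction_on with
  | _ m ih =>
    cases m with
    | zero => rwa [taylor_zero]
    | succ m =>
      have h1 : (MvPowerSeries.C (algebraMap ℂ AtInfinity ((m : ℂ) + 1)⁻¹) : WaveRing) =
          toWave (MvPowerSeries.C ((m : ℂ) + 1)⁻¹) := by
        rw [algebraMap_atInfinity, toWave, MvPowerSeries.map_C]
      rw [taylor_succ', h1]
      refine toWave_mul_mem_residueFree _ (sum_mem fun k _ => nsmul_mem ?_ _)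
      exact pderiv_mem_residueFree k (ih _ (by omega))

theorem cf_mul_eq_zero_of_mem_residueFree {f g : WaveRing} (h : f ∈ residueFree g) (p : ℕ) :
    cf (2 * p + 1) (f * g) = 0 := by
  classical
  ext d
  rw [coeff_cf, MvPowerSeries.coeff_mul, HahnSeries.coeff_sum]
  exact Finset.sum_eq_zero fun q _ => h q.1 q.2 p

/-- The Hirota bilinear identities, in terms of the wave functions multiplied by `τ`. -/
theorem IsTauFunction.mem_residueFree {τ : TimeSeries} (hτ : IsTauFunction τ) :
    miwaShift (-1) τ * expSeries phase ∈ residueFree (miwaShift 1 τ * expSeries (-phase)) := by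
  intro d₁ d₂ p
  have h := hτ p (d₁.embDomain (Function.Embedding.inl : ℕ ↪ ℕ ⊕ ℕ) +
    d₂.embDomain (Function.Embedding.inr : ℕ ↪ ℕ ⊕ ℕ))
  rw [expSeries_phaseDiff] at h
  have e : MvPowerSeries.rename (Function.Embedding.inl : ℕ ↪ ℕ ⊕ ℕ) (miwaShift (-1) τ) *
      MvPowerSeries.rename (Function.Embedding.inr : ℕ ↪ ℕ ⊕ ℕ) (miwaShift 1 τ) *
      (MvPowerSeries.rename (Function.Embedding.inl : ℕ ↪ ℕ ⊕ ℕ) (expSeries phase) *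
        MvPowerSeries.rename (Function.Embedding.inr : ℕ ↪ ℕ ⊕ ℕ) (expSeries (-phase))) *
      MvPowerSeries.C (z ^ (2 * p)) =
      MvPowerSeries.C (z ^ (2 * p)) *
      (MvPowerSeries.rename (Function.Embedding.inl : ℕ ↪ ℕ ⊕ ℕ)
        (miwaShift (-1) τ * expSeries phase) *
      MvPowerSeries.rename (Function.Embedding.inr : ℕ ↪ ℕ ⊕ ℕ)
        (miwaShift 1 τ * expSeries (-phase))) := by
    rw [map_mul, map_mul]
    ring
  rw [e, MvPowerSeries.coeff_C_mul, coeff_rename_inl_mul_rename_inr, ResVanishes,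
    coeff_z_pow_mul, neg_eq_zero] at h
  rw [← h]
  congr 1
  push_cast
  ring

/-! ### Series without positive powers of the spectral variable -/

/-- The map underlying `collect`. -/
def collectFun (p : PowerSeries TimeSeries) : MvPowerSeries ℕ (PowerSeries ℂ) := fun d =>
  PowerSeries.mk fun m => MvPowerSeries.coeff d (PowerSeries.coeff m p)

theorem coeff_coeff_collectFun (p : PowerSeries TimeSeries) (d : ℕ →₀ ℕ) (m : ℕ) :
    PowerSeries.coeff m (MvPowerSeries.coeff d (collectFun p)) =
      MvPowerSeries.coeff d (PowerSeries.coeff m p) := by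
  have h : MvPowerSeries.coeff d (collectFun p) =
    PowerSeries.mk fun m => MvPowerSeries.coeff d (PowerSeries.coeff m p) := rfl
  rw [h, PowerSeries.coeff_mk]

/-- A power series in `v` whose coefficients are series in the times, as a series in the times
whose coefficients are power series in `v`. -/
def collect : PowerSeries TimeSeries →+* MvPowerSeries ℕ (PowerSeries ℂ) where
  toFun := collectFun
  map_zero' := by
    ext d m
    rw [coeff_coeff_collectFun, map_zero, map_zero, map_zero, map_zero]
  map_add' p q := by
    ext d m
    simp only [coeff_coeff_collectFun, map_add]
  map_one' := by
    classical
    ext d m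
    rw [MvPowerSeries.coeff_one, coeff_coeff_collectFun, PowerSeries.coeff_one]
    by_cases hm : m = 0 <;> by_cases hd : d = 0 <;>
      simp [hm, hd, MvPowerSeries.coeff_one, PowerSeries.coeff_one]
  map_mul' p q := by
    classical
    ext d m
    rw [MvPowerSeries.coeff_mul, map_sum]
    simp only [PowerSeries.coeff_mul, MvPowerSeries.coeff_mul, coeff_coeff_collectFun, map_sum]
    exact Finset.sum_comm

theorem coeff_coeff_collect (p : PowerSeries TimeSeries) (d : ℕ →₀ ℕ) (m : ℕ) :
    PowerSeries.coeff m (MvPowerSeries.coeff d (collect p)) =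
      MvPowerSeries.coeff d (PowerSeries.coeff m p) := coeff_coeff_collectFun p d m

/-- A power series in `z⁻¹` whose coefficients are series in the times, as an element of
`WaveRing`. -/
def ofPower : PowerSeries TimeSeries →+* WaveRing :=
  (MvPowerSeries.map (HahnSeries.ofPowerSeries ℤ ℂ)).comp collect

theorem coeff_ofPower (p : PowerSeries TimeSeries) (d : ℕ →₀ ℕ) :
    MvPowerSeries.coeff d (ofPower p) = HahnSeries.ofPowerSeries ℤ ℂ
      (PowerSeries.mk fun m => MvPowerSeries.coeff d (PowerSeries.coeff m p)) := rfl

theorem cf_natCast_ofPower (n : ℕ) (p : PowerSeries TimeSeries) :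
    cf n (ofPower p) = PowerSeries.coeff n p := by
  ext d
  rw [coeff_cf, coeff_ofPower, HahnSeries.ofPowerSeries_apply_coeff, PowerSeries.coeff_mk]

theorem coeff_ofPowerSeries_of_neg (p : PowerSeries ℂ) {n : ℤ} (hn : n < 0) :
    (HahnSeries.ofPowerSeries ℤ ℂ p).coeff n = 0 := by
  have h := PowerSeries.coeff_coe p n
  rwa [if_pos hn] at h

theorem cf_ofPower_of_neg {n : ℤ} (hn : n < 0) (p : PowerSeries TimeSeries) :
    cf n (ofPower p) = 0 := by
  ext d
  rw [coeff_cf, coeff_ofPower, coeff_ofPowerSeries_of_neg _ hn, map_zero]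

theorem cf_zero_ofPower (p : PowerSeries TimeSeries) :
    cf 0 (ofPower p) = PowerSeries.constantCoeff p := by
  have := cf_natCast_ofPower 0 p
  rwa [Nat.cast_zero, PowerSeries.coeff_zero_eq_constantCoeff_apply] at this

theorem ofPower_mk_cf {f : WaveRing} (hf : ∀ n < 0, cf n f = 0) :
    ofPower (PowerSeries.mk fun n => cf n f) = f := by
  refine cf_ext fun n => ?_
  rcases lt_or_ge n 0 with hn | hn
  · rw [cf_ofPower_of_neg hn, hf n hn]
  · lift n to ℕ using hn
    rw [cf_natCast_ofPower, PowerSeries.coeff_mk]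

theorem ofPower_C (t : TimeSeries) : ofPower (PowerSeries.C t) = toWave t := by
  refine cf_ext fun n => ?_
  rw [cf_toWave]
  rcases lt_or_ge n 0 with hn | hn
  · rw [cf_ofPower_of_neg hn, if_neg hn.ne]
  · lift n to ℕ using hn
    rw [cf_natCast_ofPower, PowerSeries.coeff_C]
    simp

theorem zW_mul_ofPower_X : zW * ofPower PowerSeries.X = 1 := by
  refine cf_ext fun n => ?_
  rw [cf_zW_mul, cf_one]
  rcases lt_or_ge (n + 1) 0 with hn | hn
  · rw [cf_ofPower_of_neg hn, if_neg (by omega)]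
  · obtain ⟨m, hm⟩ := Int.eq_ofNat_of_zero_le hn
    rw [hm, cf_natCast_ofPower, PowerSeries.coeff_X]
    split_ifs <;> first | rfl | omega

theorem pderiv_ofPower (k : ℕ) (p : PowerSeries TimeSeries) :
    MvPowerSeries.pderiv AtInfinity k (ofPower p) = ofPower
      (PowerSeries.mk fun n => MvPowerSeries.pderiv ℂ k (PowerSeries.coeff n p)) := by
  refine cf_ext fun n => ?_
  rw [cf_pderiv]
  rcases lt_or_ge n 0 with hn | hn
  · rw [cf_ofPower_of_neg hn, cf_ofPower_of_neg hn, map_zero]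
  · lift n to ℕ using hn
    rw [cf_natCast_ofPower, cf_natCast_ofPower, PowerSeries.coeff_mk]

theorem dzW_ofPower (p : PowerSeries TimeSeries) :
    zW ^ 2 * dzW (ofPower p) = -ofPower (PowerSeries.derivative _ p) := by
  refine cf_ext fun n => ?_
  rw [cf_zW_pow_mul, cf_dzW, map_neg (cf n)]
  rcases lt_or_ge n 0 with hn | hn
  · rw [cf_ofPower_of_neg hn]
    by_cases h1 : n = -1
    · subst h1; simp
    · rw [cf_ofPower_of_neg (by push_cast; omega), mul_zero, neg_zero]
  · lift n to ℕ using hn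
    have e : (n : ℤ) + (2 : ℕ) - 1 = ((n + 1 : ℕ) : ℤ) := by push_cast; ring
    rw [e, cf_natCast_ofPower, cf_natCast_ofPower, PowerSeries.coeff_derivative]
    have e2 : (-(((((n : ℤ) + (2 : ℕ) : ℤ)) : ℂ) - 1)) = -((n : ℂ) + 1) := by push_cast; ring
    rw [e2, map_neg, map_add, map_one, map_natCast]
    ring

/-- Series without positive powers of `z`. -/
def bounded : Subring WaveRing where
  carrier := {f | ∀ n < 0, cf n f = 0}
  zero_mem' n _ := map_zero _
  one_mem' n hn := by rw [cf_one, if_neg hn.ne]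
  add_mem' ha hb n hn := by rw [map_add, ha n hn, hb n hn, add_zero]
  neg_mem' ha n hn := by rw [map_neg, ha n hn, neg_zero]
  mul_mem' {a b} ha hb n hn := by
    rw [← ofPower_mk_cf ha, ← ofPower_mk_cf hb, ← map_mul, cf_ofPower_of_neg hn]

theorem ofPower_mem_bounded (p : PowerSeries TimeSeries) : ofPower p ∈ bounded :=
  fun _ hn => cf_ofPower_of_neg hn p

theorem toWave_mem_bounded (t : TimeSeries) : toWave t ∈ bounded := by
  rw [← ofPower_C]; exact ofPower_mem_bounded _

theorem pderiv_mem_bounded {f : WaveRing} (k : ℕ) (hf : f ∈ bounded) :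
    MvPowerSeries.pderiv AtInfinity k f ∈ bounded := fun n hn => by
  rw [cf_pderiv, hf n hn, map_zero]

theorem dx_mem_bounded {f : WaveRing} (hf : f ∈ bounded) : dx f ∈ bounded :=
  pderiv_mem_bounded 0 hf

theorem reflectW_mem_bounded {f : WaveRing} (hf : f ∈ bounded) : reflectW f ∈ bounded :=
  fun n hn => by rw [cf_reflectW, hf n hn, mul_zero]

theorem cf_zero_mul {f g : WaveRing} (hf : f ∈ bounded) (hg : g ∈ bounded) :
    cf 0 (f * g) = cf 0 f * cf 0 g := by
  rw [← ofPower_mk_cf hf, ← ofPower_mk_cf hg, ← map_mul, cf_zero_ofPower, cf_zero_ofPower,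
    cf_zero_ofPower, map_mul]

theorem zW_mul_mem_bounded {f : WaveRing} (hf : f ∈ bounded) (h0 : cf 0 f = 0) :
    zW * f ∈ bounded := fun n hn => by
  rw [cf_zW_mul]
  by_cases h : n = -1
  · rw [h]; exact h0
  · exact hf _ (by omega)

instance : IsAddTorsionFree TimeSeries := isAddTorsionFree_of_algebra

theorem cf_even_eq_zero_of_odd {f : WaveRing} (hf : reflectW f = -f) (k : ℤ) :
    cf (2 * k) f = 0 := by
  have h := congrArg (cf (2 * k)) hf
  rw [cf_reflectW, zpow_mul, map_neg] at h
  norm_num at h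
  exact self_eq_neg.mp h

theorem cf_odd_eq_zero_of_even {f : WaveRing} (hf : reflectW f = f) (k : ℤ) :
    cf (2 * k + 1) f = 0 := by
  have h := congrArg (cf (2 * k + 1)) hf
  rw [cf_reflectW, zpow_add₀ (by norm_num), zpow_mul] at h
  norm_num at h
  exact self_eq_neg.mp h.symm

/-- An odd function of `z` vanishes if it has no positive powers of `z` and no odd negative
powers. -/
theorem eq_zero_of_odd {f : WaveRing} (hf : reflectW f = -f) (hb : f ∈ bounded)
    (hr : ∀ p : ℕ, cf (2 * p + 1) f = 0) : f = 0 := by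
  refine cf_ext fun n => ?_
  rw [map_zero]
  rcases lt_or_ge n 0 with hn | hn
  · exact hb n hn
  · lift n to ℕ using hn
    obtain ⟨k, hk | hk⟩ := Nat.even_or_odd' n
    · have := cf_even_eq_zero_of_odd hf k
      rw [hk]; push_cast; exact this
    · rw [hk]; push_cast; exact hr k

/-! ### The wave functions -/

/-- The factor of the wave function in front of the exponential. -/
def amplitude (ε : ℂ) (τ : TimeSeries) : WaveRing := miwaShift ε τ * toWave τ⁻¹

theorem psi_eq (τ : TimeSeries) : psi τ = amplitude (-1) τ * expSeries phase := rfl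

theorem psiStar_eq (τ : TimeSeries) : psiStar τ = amplitude 1 τ * expSeries (-phase) := rfl

theorem miwaShift_eq_ofPower {ε : ℂ} (hε : ε ^ 2 = 1) (τ : TimeSeries) :
    miwaShift ε τ = ofPower (PowerSeries.rescale (MvPowerSeries.C ε) (shift τ)) := by
  refine cf_ext fun n => ?_
  rcases lt_or_ge n 0 with hn | hn
  · rw [cf_ofPower_of_neg hn, cf_miwaShift_of_neg _ _ hn]
  · lift n to ℕ using hn
    rw [cf_natCast_ofPower, cf_miwaShift_natCast hε, PowerSeries.coeff_rescale, map_pow,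
      coeff_shift]

theorem miwaShift_mem_bounded (ε : ℂ) (τ : TimeSeries) : miwaShift ε τ ∈ bounded :=
  fun _ hn => cf_miwaShift_of_neg ε τ hn

theorem amplitude_mem_bounded (ε : ℂ) (τ : TimeSeries) : amplitude ε τ ∈ bounded :=
  mul_mem (miwaShift_mem_bounded _ _) (toWave_mem_bounded _)

theorem cf_natCast_amplitude {ε : ℂ} (hε : ε ^ 2 = 1) (τ : TimeSeries) (m : ℕ) :
    cf m (amplitude ε τ) = MvPowerSeries.C (ε ^ m) * (τ⁻¹ * taylor τ m) := by
  rw [amplitude, mul_comm, cf_toWave_mul, cf_miwaShift_natCast hε]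
  ring

theorem cf_zero_amplitude {ε : ℂ} (hε : ε ^ 2 = 1) {τ : TimeSeries}
    (hτ : MvPowerSeries.constantCoeff τ ≠ 0) : cf 0 (amplitude ε τ) = 1 := by
  have h := cf_natCast_amplitude hε τ 0
  rwa [Nat.cast_zero, taylor_zero, pow_zero, map_one, one_mul,
    MvPowerSeries.inv_mul_cancel _ hτ] at h

theorem taylor_one (τ : TimeSeries) : taylor τ 1 = MvPowerSeries.pderiv ℂ 0 τ := by
  have h := taylor_succ τ 0
  simpa [taylor_zero] using h

theorem cf_one_amplitude {ε : ℂ} (hε : ε ^ 2 = 1) {τ : TimeSeries}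
    (hτ : MvPowerSeries.constantCoeff τ ≠ 0) :
    cf 1 (amplitude ε τ) = MvPowerSeries.C ε * MvPowerSeries.pderiv ℂ 0 (logSeries τ) := by
  have h := cf_natCast_amplitude hε τ 1
  rw [Nat.cast_one, taylor_one, pow_one] at h
  rw [h, pderiv_logSeries hτ]

theorem reflectW_miwaShift {ε : ℂ} (hε : ε ^ 2 = 1) (τ : TimeSeries) :
    reflectW (miwaShift ε τ) = miwaShift (-ε) τ := by
  refine cf_ext fun n => ?_
  rw [cf_reflectW]
  rcases lt_or_ge n 0 with hn | hn
  · rw [cf_miwaShift_of_neg _ _ hn, cf_miwaShift_of_neg _ _ hn, mul_zero]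
  · lift n to ℕ using hn
    rw [cf_miwaShift_natCast hε, cf_miwaShift_natCast (by rwa [neg_sq]), ← mul_assoc, ← map_mul,
      zpow_natCast, ← mul_pow, neg_one_mul]

theorem reflectW_amplitude (τ : TimeSeries) :
    reflectW (amplitude (-1) τ) = amplitude 1 τ := by
  rw [amplitude, map_mul, reflectW_miwaShift (by norm_num), reflectW_toWave, neg_neg, amplitude]

theorem reflectW_psi (τ : TimeSeries) : reflectW (psi τ) = psiStar τ := by
  rw [psi_eq, map_mul, reflectW_amplitude, reflectW_exp_phase, psiStar_eq]

theorem reflectW_psiStar (τ : TimeSeries) : reflectW (psiStar τ) = psi τ := by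
  rw [← reflectW_psi, reflectW_reflectW]

theorem psi_mem_residueFree {τ : TimeSeries} (hτ : IsTauFunction τ) :
    psi τ ∈ residueFree (psiStar τ) := by
  have h1 : psi τ = toWave τ⁻¹ * (miwaShift (-1) τ * expSeries phase) := by rw [psi]; ring
  have h2 : psiStar τ = toWave τ⁻¹ * (miwaShift 1 τ * expSeries (-phase)) := by rw [psiStar]; ring
  rw [h1, h2]
  exact toWave_mul_mem_residueFree _ (residueFree_symm
    (toWave_mul_mem_residueFree _ (residueFree_symm hτ.mem_residueFree)))

theorem resolvent_eq_amplitude (τ : TimeSeries) :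
    resolvent τ = amplitude (-1) τ * amplitude 1 τ := by
  rw [resolvent, psi_eq, psiStar_eq]
  linear_combination (amplitude (-1) τ * amplitude 1 τ) * exp_phase_mul_exp_neg_phase

theorem resolvent_mem_bounded (τ : TimeSeries) : resolvent τ ∈ bounded := by
  rw [resolvent_eq_amplitude]
  exact mul_mem (amplitude_mem_bounded _ _) (amplitude_mem_bounded _ _)

theorem cf_zero_resolvent {τ : TimeSeries} (hτ : MvPowerSeries.constantCoeff τ ≠ 0) :
    cf 0 (resolvent τ) = 1 := by
  rw [resolvent_eq_amplitude, cf_zero_mul (amplitude_mem_bounded _ _) (amplitude_mem_bounded _ _),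
    cf_zero_amplitude (by norm_num) hτ, cf_zero_amplitude (by norm_num) hτ, mul_one]

theorem reflectW_resolvent (τ : TimeSeries) : reflectW (resolvent τ) = resolvent τ := by
  rw [resolvent, map_mul, reflectW_psi, reflectW_psiStar, mul_comm]

theorem dx_exp_phase : dx (expSeries phase) = zW * expSeries phase := by
  rw [dx, pderiv_exp_phase, phaseCoeff_zero, zW]

theorem dx_exp_neg_phase : dx (expSeries (-phase)) = -(zW * expSeries (-phase)) := by
  rw [dx, pderiv_exp_neg_phase, phaseCoeff_zero, zW]

theorem dx_psi_eq (τ : TimeSeries) :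
    dx (psi τ) = (dx (amplitude (-1) τ) + zW * amplitude (-1) τ) * expSeries phase := by
  rw [psi_eq, dx_mul, dx_exp_phase]; ring

theorem dx_psiStar_eq (τ : TimeSeries) :
    dx (psiStar τ) = (dx (amplitude 1 τ) - zW * amplitude 1 τ) * expSeries (-phase) := by
  rw [psiStar_eq, dx_mul, dx_exp_neg_phase]; ring

/-- The Wronskian of the wave functions is `2 z`: the difference is odd in `z`, has no positive
powers of `z`, and no odd negative ones by the bilinear identity. -/
theorem wronskian {τ : TimeSeries} (hτ₀ : MvPowerSeries.constantCoeff τ ≠ 0)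
    (hτ : IsTauFunction τ) :
    psiStar τ * dx (psi τ) - psi τ * dx (psiStar τ) = 2 * zW := by
  have hform : psiStar τ * dx (psi τ) - psi τ * dx (psiStar τ) - 2 * zW =
      amplitude 1 τ * dx (amplitude (-1) τ) - amplitude (-1) τ * dx (amplitude 1 τ) +
        2 * (zW * (resolvent τ - 1)) := by
    rw [dx_psi_eq, dx_psiStar_eq, resolvent_eq_amplitude, psi_eq, psiStar_eq]
    linear_combination (amplitude 1 τ * (dx (amplitude (-1) τ) + zW * amplitude (-1) τ) -
      amplitude (-1) τ * (dx (amplitude 1 τ) - zW * amplitude 1 τ)) * exp_phase_mul_exp_neg_phase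
  rw [← sub_eq_zero]
  refine eq_zero_of_odd ?_ ?_ fun p => ?_
  · simp only [map_sub, map_mul, reflectW_psi, reflectW_psiStar, reflectW_dx, reflectW_zW,
      map_ofNat]
    ring
  · rw [hform]
    have hA := amplitude_mem_bounded (-1) τ
    have hB := amplitude_mem_bounded 1 τ
    refine add_mem (sub_mem (mul_mem hB (dx_mem_bounded hA)) (mul_mem hA (dx_mem_bounded hB)))
      (mul_mem (ofNat_mem bounded 2) (zW_mul_mem_bounded
        (sub_mem (resolvent_mem_bounded τ) (one_mem _)) ?_))
    rw [map_sub, cf_zero_resolvent hτ₀, cf_one, if_pos rfl, sub_self]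
  · have h := psi_mem_residueFree hτ
    rw [map_sub, map_sub, mul_comm (psiStar τ),
      cf_mul_eq_zero_of_mem_residueFree (dx_mem_residueFree h),
      cf_mul_eq_zero_of_mem_residueFree (residueFree_symm (dx_mem_residueFree (residueFree_symm h))),
      mul_comm 2 zW, cf_zW_mul, sub_zero, zero_sub, neg_eq_zero]
    have e2 : (2 : WaveRing) = toWave 2 := (map_ofNat toWave 2).symm
    rw [e2, cf_toWave, if_neg (by omega)]

theorem mul_left_cancel_two_zW {f g : WaveRing} (h : 2 * zW * f = 2 * zW * g) : f = g :=
  isUnit_two_zW.mul_left_cancel h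

/-- A function vanishes if it satisfies the two symmetric bilinear relations against the wave
functions: the Wronskian is invertible. -/
theorem eq_zero_of_symm {τ : TimeSeries} (hτ₀ : MvPowerSeries.constantCoeff τ ≠ 0)
    (hτ : IsTauFunction τ) {v v' : WaveRing} (h : v * psiStar τ = v' * psi τ)
    (hx : v * dx (psiStar τ) = v' * dx (psi τ)) : v = 0 := by
  refine mul_left_cancel_two_zW ?_
  rw [mul_zero, ← wronskian hτ₀ hτ]
  linear_combination dx (psi τ) * h - psi τ * hx

theorem dx_dx_psi_eq (τ : TimeSeries) :
    dx (dx (psi τ)) = (dx (dx (amplitude (-1) τ)) + 2 * (zW * dx (amplitude (-1) τ)) +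
      zW ^ 2 * amplitude (-1) τ) * expSeries phase := by
  rw [dx_psi_eq, dx_mul, dx_exp_phase, dx_add, dx_mul, dx_zW]; ring

theorem cf_two_mul (n : ℤ) (f : WaveRing) : cf n (2 * f) = 2 * cf n f := by
  rw [two_mul, map_add, two_mul]

/-- The Schrödinger equation.  The defect `Y` of `ψ` and its reflection satisfy the two bilinear
relations of `eq_zero_of_symm`: the first is the derivative of the Wronskian, the second holds
because `Y = O(1 / z) e ^ ϑ` also satisfies the bilinear identity. -/
theorem dx_dx_psi {τ : TimeSeries} (hτ₀ : MvPowerSeries.constantCoeff τ ≠ 0)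
    (hτ : IsTauFunction τ) :
    dx (dx (psi τ)) = (zW ^ 2 - 2 * toWave (potential τ)) * psi τ := by
  set A := amplitude (-1) τ with hA
  set y := dx (dx A) + 2 * (zW * dx A) + 2 * (toWave (potential τ) * A) with hy
  have hAb : A ∈ bounded := amplitude_mem_bounded _ _
  have hA0 : cf 0 (dx A) = 0 := by
    rw [cf_dx, hA, cf_zero_amplitude (by norm_num) hτ₀, ← map_one MvPowerSeries.C,
      MvPowerSeries.pderiv_C]
  have hzA : zW * dx A ∈ bounded := zW_mul_mem_bounded (dx_mem_bounded hAb) hA0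
  have h2 : (2 : WaveRing) ∈ bounded := ofNat_mem bounded 2
  have hyb : y ∈ bounded :=
    add_mem (add_mem (dx_mem_bounded (dx_mem_bounded hAb)) (mul_mem h2 hzA))
      (mul_mem h2 (mul_mem (toWave_mem_bounded _) hAb))
  have hy0 : cf 0 y = 0 := by
    rw [hy, map_add, map_add, cf_dx, hA0, cf_two_mul, cf_two_mul, cf_zW_mul, zero_add, cf_dx,
      cf_toWave_mul, hA, cf_one_amplitude (by norm_num) hτ₀, cf_zero_amplitude (by norm_num) hτ₀,
      map_zero, potential, map_neg, map_one, neg_one_mul, map_neg]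
    ring
  rw [← sub_eq_zero]
  set Y := dx (dx (psi τ)) - (zW ^ 2 - 2 * toWave (potential τ)) * psi τ with hY
  have hYy : Y = y * expSeries phase := by
    rw [hY, dx_dx_psi_eq, psi_eq, hy]; ring
  have hres : Y ∈ residueFree (psiStar τ) := by
    have h := psi_mem_residueFree hτ
    have e : Y = dx (dx (psi τ)) - zW ^ 2 * psi τ +
        (toWave (potential τ) * psi τ + toWave (potential τ) * psi τ) := by rw [hY]; ring
    rw [e]
    exact add_mem (sub_mem (dx_mem_residueFree (dx_mem_residueFree h))
      (zW_sq_mul_mem_residueFree h)) (add_mem (toWave_mul_mem_residueFree _ h)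
        (toWave_mul_mem_residueFree _ h))
  have hYs : reflectW Y = dx (dx (psiStar τ)) - (zW ^ 2 - 2 * toWave (potential τ)) * psiStar τ := by
    simp only [hY, map_sub, map_mul, map_pow, reflectW_dx, reflectW_psi, reflectW_zW,
      reflectW_toWave, map_ofNat]
    ring
  refine eq_zero_of_symm hτ₀ hτ (v' := reflectW Y) ?_ ?_
  · have h := congrArg dx (wronskian hτ₀ hτ)
    rw [dx_sub, dx_mul, dx_mul, dx_mul, dx_zW] at h
    have h2 : dx 2 = 0 := by
      have : (2 : WaveRing) = toWave 2 := (map_ofNat toWave 2).symm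
      rw [this, dx, pderiv_toWave]
      have : (2 : TimeSeries) = MvPowerSeries.C 2 := (map_ofNat MvPowerSeries.C 2).symm
      rw [this, MvPowerSeries.pderiv_C, map_zero]
    rw [h2] at h
    rw [hYs, hY]
    linear_combination h
  · rw [← sub_eq_zero]
    refine eq_zero_of_odd ?_ ?_ fun p => ?_
    · simp only [map_sub, map_mul, reflectW_dx, reflectW_psi, reflectW_psiStar, reflectW_reflectW]
      ring
    · have hB : amplitude 1 τ ∈ bounded := amplitude_mem_bounded _ _
      have key : Y * dx (psiStar τ) ∈ bounded := by
        have : Y * dx (psiStar τ) = y * dx (amplitude 1 τ) - zW * (y * amplitude 1 τ) := by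
          rw [hYy, dx_psiStar_eq]
          linear_combination (y * (dx (amplitude 1 τ) - zW * amplitude 1 τ)) *
            exp_phase_mul_exp_neg_phase
        rw [this]
        refine sub_mem (mul_mem hyb (dx_mem_bounded hB)) (zW_mul_mem_bounded (mul_mem hyb hB) ?_)
        rw [cf_zero_mul hyb hB, hy0, zero_mul]
      refine sub_mem key ?_
      have : reflectW Y * dx (psi τ) = reflectW (Y * dx (psiStar τ)) := by
        rw [map_mul, reflectW_dx, reflectW_psiStar]
      rw [this]
      exact reflectW_mem_bounded key
    · have h := cf_mul_eq_zero_of_mem_residueFree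
        (residueFree_symm (dx_mem_residueFree (residueFree_symm hres))) p
      have : reflectW Y * dx (psi τ) = reflectW (Y * dx (psiStar τ)) := by
        rw [map_mul, reflectW_dx, reflectW_psiStar]
      rw [map_sub, this, cf_reflectW, h, mul_zero, sub_zero]

/-! ### The resolvent and the matrix resolvent -/

theorem two_mul_left_cancel {f g : WaveRing} (h : 2 * f = 2 * g) : f = g :=
  mul_left_cancel_two_zW (by linear_combination zW * h)

theorem dx_two_mul (f : WaveRing) : dx (2 * f) = 2 * dx f := by
  rw [two_mul, dx_add, two_mul]

theorem dx_dx_psiStar {τ : TimeSeries} (hτ₀ : MvPowerSeries.constantCoeff τ ≠ 0)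
    (hτ : IsTauFunction τ) :
    dx (dx (psiStar τ)) = (zW ^ 2 - 2 * toWave (potential τ)) * psiStar τ := by
  have h := congrArg reflectW (dx_dx_psi hτ₀ hτ)
  simp only [map_sub, map_mul, map_pow, reflectW_dx, reflectW_psi, reflectW_zW,
    reflectW_toWave, map_ofNat] at h
  rw [h]; ring

theorem dx_resolvent (τ : TimeSeries) :
    dx (resolvent τ) = dx (psi τ) * psiStar τ + psi τ * dx (psiStar τ) := dx_mul _ _

/-- The product `ψₓ ψ*ₓ`, the lower left entry of `Θ`. -/
def resolventX (τ : TimeSeries) : WaveRing := dx (psi τ) * dx (psiStar τ)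

theorem dx_dx_resolvent {τ : TimeSeries} (hτ₀ : MvPowerSeries.constantCoeff τ ≠ 0)
    (hτ : IsTauFunction τ) :
    dx (dx (resolvent τ)) =
      2 * (zW ^ 2 - 2 * toWave (potential τ)) * resolvent τ + 2 * resolventX τ := by
  rw [dx_resolvent, dx_add, dx_mul, dx_mul, dx_dx_psi hτ₀ hτ, dx_dx_psiStar hτ₀ hτ, resolvent,
    resolventX]
  ring

theorem halfW_mul_two : halfW * 2 = 1 := by
  have : (2 : WaveRing) = MvPowerSeries.C (HahnSeries.C (2 : ℂ)) := by
    rw [map_ofNat HahnSeries.C, map_ofNat]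
  rw [this, halfW, ← map_mul, ← map_mul]
  norm_num

theorem det_Psi {τ : TimeSeries} (hτ₀ : MvPowerSeries.constantCoeff τ ≠ 0)
    (hτ : IsTauFunction τ) : (Psi τ).det = 2 * zW := by
  rw [Psi, Matrix.det_fin_two_of, ← wronskian hτ₀ hτ]; ring

/-- The conjugate of `σ₃` by a Wronskian matrix, over an arbitrary commutative ring. -/
theorem smul_mul_sigma_mul_inv_eq {R : Type} [CommRing R] {p q p' q' w c : R} (hc : c * 2 = 1)
    (h : q * p' - p * q' = 2 * w) (hu : IsUnit (!![p, q; -p', -q'] : Matrix _ _ R).det) :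
    w • (!![p, q; -p', -q'] * !![1, 0; 0, -1] * (!![p, q; -p', -q'])⁻¹) =
      c • !![-(p' * q + p * q'), -2 * (p * q); 2 * (p' * q'), p' * q + p * q'] := by
  have key : w • (!![p, q; -p', -q'] * !![1, 0; 0, -1]) =
      c • !![-(p' * q + p * q'), -2 * (p * q); 2 * (p' * q'), p' * q + p * q'] *
        !![p, q; -p', -q'] := by
    ext i j
    fin_cases i <;> fin_cases j <;> simp [Matrix.mul_apply, Fin.sum_univ_two]
    · linear_combination -w * p * hc - c * p * h
    · linear_combination w * q * hc + c * q * h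
    · linear_combination w * p' * hc + c * p' * h
    · linear_combination -w * q' * hc - c * q' * h
  rw [← smul_mul_assoc, key, Matrix.mul_assoc, Matrix.mul_nonsing_inv _ hu, Matrix.mul_one]

theorem Theta_eq {τ : TimeSeries} (hτ₀ : MvPowerSeries.constantCoeff τ ≠ 0)
    (hτ : IsTauFunction τ) :
    Theta τ = halfW • !![-dx (resolvent τ), -2 * resolvent τ;
      2 * resolventX τ, dx (resolvent τ)] := by
  have hu : IsUnit (Psi τ).det := by rw [det_Psi hτ₀ hτ]; exact isUnit_two_zW
  rw [dx_resolvent, resolvent, resolventX]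
  exact smul_mul_sigma_mul_inv_eq halfW_mul_two (wronskian hτ₀ hτ) hu

/-! ### The flows of the hierarchy -/

/-- The derivation `(2 k + 1)!! ∂/∂t k`. -/
def flow {A : Type} [CommRing A] (k : ℕ) : MvPowerSeries ℕ A →+ MvPowerSeries ℕ A :=
  Nat.doubleFactorial (2 * k + 1) • (MvPowerSeries.pderiv A k : MvPowerSeries ℕ A →+ MvPowerSeries ℕ A)

section Flow

variable {A B : Type} [CommRing A] [CommRing B]

theorem flow_apply (k : ℕ) (f : MvPowerSeries ℕ A) :
    flow k f = Nat.doubleFactorial (2 * k + 1) • MvPowerSeries.pderiv A k f := rfl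

theorem flow_zero_apply (f : MvPowerSeries ℕ A) : flow 0 f = MvPowerSeries.pderiv A 0 f := by
  rw [flow_apply]; simp

theorem flow_mul (k : ℕ) (f g : MvPowerSeries ℕ A) :
    flow k (f * g) = flow k f * g + f * flow k g := by
  rw [flow_apply, flow_apply, flow_apply, pderiv_mul, smul_add, smul_mul_assoc, mul_smul_comm]

theorem flow_pderiv (k j : ℕ) (f : MvPowerSeries ℕ A) :
    flow k (MvPowerSeries.pderiv A j f) = MvPowerSeries.pderiv A j (flow k f) := by
  rw [flow_apply, flow_apply, pderiv_comm, map_nsmul]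

theorem flow_C (k : ℕ) (a : A) : flow k (MvPowerSeries.C a : MvPowerSeries ℕ A) = 0 := by
  rw [flow_apply, MvPowerSeries.pderiv_C, smul_zero]

theorem flow_C_mul (k : ℕ) (a : A) (f : MvPowerSeries ℕ A) :
    flow k (MvPowerSeries.C a * f) = MvPowerSeries.C a * flow k f := by
  rw [flow_mul, flow_C, zero_mul, zero_add]

theorem coeffMap_flow (l : A →+ B) (k : ℕ) (f : MvPowerSeries ℕ A) :
    coeffMap l (flow k f) = flow k (coeffMap l f) := by
  rw [flow_apply, flow_apply, map_nsmul, coeffMap_pderiv]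

theorem map_flow (φ : A →+* B) (k : ℕ) (f : MvPowerSeries ℕ A) :
    MvPowerSeries.map φ (flow k f) = flow k (MvPowerSeries.map φ f) := by
  rw [flow_apply, flow_apply, map_nsmul, map_pderiv]

end Flow

theorem flow_dx (k : ℕ) (f : WaveRing) : flow k (dx f) = dx (flow k f) := flow_pderiv _ _ _

theorem reflectW_flow (k : ℕ) (f : WaveRing) : reflectW (flow k f) = flow k (reflectW f) :=
  map_flow _ _ _

theorem dzW_flow (k : ℕ) (f : WaveRing) : dzW (flow k f) = flow k (dzW f) :=
  coeffMap_flow _ _ _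

theorem flow_two_mul {A : Type} [CommRing A] (k : ℕ) (f : MvPowerSeries ℕ A) :
    flow k (2 * f) = 2 * flow k f := by
  rw [two_mul, map_add, two_mul]

theorem flow_zW (k : ℕ) : flow k zW = 0 := flow_C _ _

theorem flow_mem_bounded {f : WaveRing} (k : ℕ) (hf : f ∈ bounded) : flow k f ∈ bounded :=
  nsmul_mem (pderiv_mem_bounded k hf) _

theorem flow_mem_residueFree {f g : WaveRing} (k : ℕ) (h : f ∈ residueFree g) :
    flow k f ∈ residueFree g :=
  nsmul_mem (pderiv_mem_residueFree k h) _

theorem nsmul_phaseCoeff (k : ℕ) :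
    (Nat.doubleFactorial (2 * k + 1) : AtInfinity) * phaseCoeff k = z ^ (2 * k + 1) := by
  have h : (Nat.doubleFactorial (2 * k + 1) : ℂ) ≠ 0 :=
    Nat.cast_ne_zero.mpr (Nat.doubleFactorial_pos _).ne'
  rw [phaseCoeff, smul_atInfinity, ← mul_assoc, ← map_natCast HahnSeries.C, ← map_mul,
    mul_inv_cancel₀ h, map_one, one_mul]

theorem flow_exp_phase (k : ℕ) :
    flow k (expSeries phase) = zW ^ (2 * k + 1) * expSeries phase := by
  rw [flow_apply, pderiv_exp_phase, nsmul_eq_mul, ← mul_assoc, ← map_natCast MvPowerSeries.C,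
    ← map_mul, nsmul_phaseCoeff, map_pow, zW]

theorem neg_zW_sq : (-zW) ^ 2 = zW ^ 2 := by ring

theorem neg_zW_pow_odd (k : ℕ) : (-zW) ^ (2 * k + 1) = -zW ^ (2 * k + 1) := by
  rw [pow_succ, pow_mul, neg_zW_sq]; ring

theorem flow_exp_neg_phase (k : ℕ) :
    flow k (expSeries (-phase)) = -(zW ^ (2 * k + 1) * expSeries (-phase)) := by
  rw [← reflectW_exp_phase, ← reflectW_flow, flow_exp_phase, map_mul, map_pow, reflectW_zW,
    neg_zW_pow_odd]
  ring

/-- The coefficient of `z ^ (-2 m)` in the resolvent. -/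
def resolventCoeff (τ : TimeSeries) (m : ℕ) : TimeSeries := cf (2 * m) (resolvent τ)

/-- The polynomial part `∑ r_m z ^ (2 k - 2 m)`, `m ≤ k`, of `z ^ (2 k)` times the resolvent. -/
def polyPart (τ : TimeSeries) : ℕ → WaveRing
  | 0 => toWave (resolventCoeff τ 0)
  | k + 1 => zW ^ 2 * polyPart τ k + toWave (resolventCoeff τ (k + 1))

theorem cf_polyPart (τ : TimeSeries) (k : ℕ) :
    ∀ n : ℤ, cf n (polyPart τ k) = if n ≤ 0 then cf (n + 2 * k) (resolvent τ) else 0 := by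
  induction k with
  | zero =>
    intro n
    rw [polyPart, cf_toWave, resolventCoeff]
    split_ifs with h1 h2 h2
    · subst h1; simp
    · omega
    · rw [resolvent_mem_bounded]; push_cast; omega
    · rfl
  | succ k ih =>
    intro n
    rw [polyPart, map_add, cf_zW_pow_mul, ih, cf_toWave, resolventCoeff]
    push_cast
    by_cases h0 : n = 0
    · subst h0; simp
    · rw [if_neg h0, add_zero]
      by_cases h1 : n = -1
      · subst h1
        rw [if_neg (by norm_num), if_pos (by norm_num)]
        have := cf_odd_eq_zero_of_even (reflectW_resolvent τ) k
        rw [← this]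
        congr 1
        ring_nf
      · by_cases h2 : n ≤ 0
        · rw [if_pos (by omega), if_pos h2]
          congr 1
          ring_nf
        · rw [if_neg (by omega), if_neg h2]

theorem reflectW_polyPart (τ : TimeSeries) (k : ℕ) : reflectW (polyPart τ k) = polyPart τ k := by
  induction k with
  | zero => rw [polyPart, reflectW_toWave]
  | succ k ih => rw [polyPart, map_add, map_mul, map_pow, reflectW_zW, ih, reflectW_toWave, neg_zW_sq]

/-- The analogue of the Wronskian for the `k`-th flow.  Both sides are odd in `z`, their
difference has no positive powers of `z`, and no odd negative ones by the bilinear identity. -/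
theorem wronskian_flow {τ : TimeSeries} (hτ : IsTauFunction τ) (k : ℕ) :
    psiStar τ * flow k (psi τ) - psi τ * flow k (psiStar τ) = 2 * (zW * polyPart τ k) := by
  have hform : psiStar τ * flow k (psi τ) - psi τ * flow k (psiStar τ) - 2 * (zW * polyPart τ k) =
      amplitude 1 τ * flow k (amplitude (-1) τ) - amplitude (-1) τ * flow k (amplitude 1 τ) +
        2 * (zW * (zW ^ (2 * k) * resolvent τ - polyPart τ k)) := by
    rw [psi_eq, psiStar_eq, flow_mul, flow_mul, flow_exp_phase, flow_exp_neg_phase,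
      resolvent_eq_amplitude]
    linear_combination (amplitude 1 τ * (flow k (amplitude (-1) τ) +
      zW ^ (2 * k + 1) * amplitude (-1) τ) -
      amplitude (-1) τ * (flow k (amplitude 1 τ) - zW ^ (2 * k + 1) * amplitude 1 τ)) *
        exp_phase_mul_exp_neg_phase
  rw [← sub_eq_zero]
  refine eq_zero_of_odd ?_ ?_ fun p => ?_
  · simp only [map_sub, map_mul, reflectW_psi, reflectW_psiStar, reflectW_flow, reflectW_zW,
      map_ofNat, reflectW_polyPart]
    ring
  · rw [hform]
    have hA := amplitude_mem_bounded (-1) τ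
    have hB := amplitude_mem_bounded 1 τ
    refine add_mem (sub_mem (mul_mem hB (flow_mem_bounded k hA))
      (mul_mem hA (flow_mem_bounded k hB)))
      (mul_mem (ofNat_mem bounded 2) (zW_mul_mem_bounded (fun n hn => ?_) ?_))
    · rw [map_sub, cf_polyPart, if_pos hn.le, cf_zW_pow_mul]
      push_cast
      exact sub_self _
    · rw [map_sub, cf_polyPart, if_pos le_rfl, cf_zW_pow_mul]
      push_cast
      exact sub_self _
  · have h := psi_mem_residueFree hτ
    rw [map_sub, map_sub, mul_comm (psiStar τ),
      cf_mul_eq_zero_of_mem_residueFree (flow_mem_residueFree k h),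
      cf_mul_eq_zero_of_mem_residueFree
        (residueFree_symm (flow_mem_residueFree k (residueFree_symm h))),
      cf_two_mul, cf_zW_mul, cf_polyPart, if_neg (by omega)]
    ring

/-- The evolution of the wave function.  The defects of `ψ` and `ψ*` satisfy the relations of
`eq_zero_of_symm` by the two Wronskian formulas. -/
theorem two_mul_flow_psi {τ : TimeSeries} (hτ₀ : MvPowerSeries.constantCoeff τ ≠ 0)
    (hτ : IsTauFunction τ) (k : ℕ) :
    2 * flow k (psi τ) = 2 * polyPart τ k * dx (psi τ) - dx (polyPart τ k) * psi τ := by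
  set b := polyPart τ k with hb
  set V := 2 * flow k (psi τ) - (2 * b * dx (psi τ) - dx b * psi τ) with hV
  set V' := 2 * flow k (psiStar τ) - (2 * b * dx (psiStar τ) - dx b * psiStar τ) with hV'
  have h1 : V * psiStar τ = V' * psi τ := by
    rw [hV, hV']
    linear_combination 2 * wronskian_flow hτ k - 2 * b * wronskian hτ₀ hτ
  have h2 := congrArg dx h1
  rw [dx_mul, dx_mul] at h2
  have h3 := congrArg (flow k) (wronskian hτ₀ hτ)
  rw [map_sub, flow_mul, flow_mul, flow_two_mul, flow_zW, flow_dx, flow_dx] at h3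
  have e1 : dx V = 2 * dx (flow k (psi τ)) - (2 * dx b * dx (psi τ) +
      2 * b * ((zW ^ 2 - 2 * toWave (potential τ)) * psi τ) -
      dx (dx b) * psi τ - dx b * dx (psi τ)) := by
    rw [hV, dx_sub, dx_sub, dx_mul _ (dx (psi τ)), dx_two_mul, dx_two_mul, dx_mul (dx b),
      dx_dx_psi hτ₀ hτ]
    ring
  have e2 : dx V' = 2 * dx (flow k (psiStar τ)) - (2 * dx b * dx (psiStar τ) +
      2 * b * ((zW ^ 2 - 2 * toWave (potential τ)) * psiStar τ) -
      dx (dx b) * psiStar τ - dx b * dx (psiStar τ)) := by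
    rw [hV', dx_sub, dx_sub, dx_mul _ (dx (psiStar τ)), dx_two_mul, dx_two_mul, dx_mul (dx b),
      dx_dx_psiStar hτ₀ hτ]
    ring
  refine sub_eq_zero.mp (eq_zero_of_symm hτ₀ hτ (v := V) (v' := V') h1 (two_mul_left_cancel ?_))
  have h4 : psiStar τ * dx V - psi τ * dx V' = V * dx (psiStar τ) - V' * dx (psi τ) := by
    rw [e1, e2, hV, hV']
    linear_combination 2 * h3
  linear_combination h2 - h4

/-- The Lax equation of the resolvent. -/
theorem flow_resolvent {τ : TimeSeries} (hτ₀ : MvPowerSeries.constantCoeff τ ≠ 0)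
    (hτ : IsTauFunction τ) (k : ℕ) :
    flow k (resolvent τ) = polyPart τ k * dx (resolvent τ) - dx (polyPart τ k) * resolvent τ := by
  have h := two_mul_flow_psi hτ₀ hτ k
  have h' := congrArg reflectW h
  simp only [map_sub, map_mul, reflectW_dx, reflectW_psi, reflectW_flow, map_ofNat,
    reflectW_polyPart] at h'
  refine two_mul_left_cancel ?_
  rw [dx_resolvent, resolvent, flow_mul]
  linear_combination psiStar τ * h + psi τ * h'

/-! ### Restriction of double power series to the diagonal -/

theorem leibniz_powerSeries {R : Type} [CommRing R] (y w : PowerSeries R) :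
    PowerSeries.derivative R (y * w) =
      PowerSeries.derivative R y * w + y * PowerSeries.derivative R w := by
  rw [Derivation.leibniz, smul_eq_mul, smul_eq_mul]; ring

theorem map_derivative {R S : Type} [CommRing R] [CommRing S] (φ : R →+* S) (y : PowerSeries R) :
    PowerSeries.map φ (PowerSeries.derivative R y) =
      PowerSeries.derivative S (PowerSeries.map φ y) := by
  ext1 i
  rw [PowerSeries.coeff_derivative, PowerSeries.coeff_map, PowerSeries.coeff_map,
    PowerSeries.coeff_derivative, map_mul, map_add, map_natCast, map_one]

section Diagonal

variable {R : Type} [CommRing R]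

/-- The restriction `F(v, v)` of a power series `F(v, w)`. -/
def diagonal : PowerSeries (PowerSeries R) →+* PowerSeries R where
  toFun F := PowerSeries.mk fun n => ∑ p ∈ Finset.HasAntidiagonal.antidiagonal n,
    PowerSeries.coeff p.2 (PowerSeries.coeff p.1 F)
  map_zero' := by ext n; simp
  map_add' F G := by
    ext n
    simp only [PowerSeries.coeff_mk, map_add, Finset.sum_add_distrib]
  map_one' := by
    classical
    ext n
    rw [PowerSeries.coeff_mk, Finset.sum_eq_single (0, n)]
    · simp
    · rintro ⟨i, l⟩ _ hne
      rw [PowerSeries.coeff_one]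
      split_ifs with hi
      · have hi : i = 0 := hi
        subst hi
        rw [PowerSeries.coeff_one, if_neg]
        rintro rfl
        simp_all
      · exact map_zero _
    · intro h
      simp at h
  map_mul' F G := by
    ext n
    simp only [PowerSeries.coeff_mk, PowerSeries.coeff_mul, map_sum, Finset.sum_mul_sum]
    simp only [Finset.sum_sigma']
    refine Finset.sum_nbij'
      (fun x => ⟨⟨x.2.1.1 + x.2.2.1, x.2.1.2 + x.2.2.2⟩,
        ⟨x.2.1.1, x.2.2.1⟩, ⟨x.2.1.2, x.2.2.2⟩⟩)
      (fun x => ⟨⟨x.2.1.1 + x.2.2.1, x.2.1.2 + x.2.2.2⟩,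
        ⟨x.2.1.1, x.2.2.1⟩, ⟨x.2.1.2, x.2.2.2⟩⟩) ?_ ?_ ?_ ?_ ?_
    all_goals
      rintro ⟨⟨a, b⟩, ⟨c, d⟩, ⟨e, f⟩⟩ h
      simp only [Finset.mem_sigma, Finset.HasAntidiagonal.mem_antidiagonal] at h ⊢
    · exact ⟨by omega, trivial, trivial⟩
    · exact ⟨by omega, trivial, trivial⟩
    · obtain ⟨h1, rfl, rfl⟩ := h; rfl
    · obtain ⟨h1, rfl, rfl⟩ := h; rfl

theorem coeff_diagonal (F : PowerSeries (PowerSeries R)) (n : ℕ) :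
    PowerSeries.coeff n (diagonal F) = ∑ p ∈ Finset.HasAntidiagonal.antidiagonal n,
      PowerSeries.coeff p.2 (PowerSeries.coeff p.1 F) := by
  change PowerSeries.coeff n (PowerSeries.mk fun n =>
    ∑ p ∈ Finset.HasAntidiagonal.antidiagonal n,
      PowerSeries.coeff p.2 (PowerSeries.coeff p.1 F)) = _
  rw [PowerSeries.coeff_mk]

theorem diagonal_C (G : PowerSeries R) : diagonal (PowerSeries.C G) = G := by
  ext1 n
  rw [coeff_diagonal, Finset.sum_eq_single (0, n)]
  · simp
  · rintro ⟨i, l⟩ hm hne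
    have : i ≠ 0 := by
      rintro rfl
      simp at hm
      exact hne (by rw [hm])
    rw [PowerSeries.coeff_C, if_neg this, map_zero]
  · intro h
    simp at h

/-- The derivative with respect to the inner variable. -/
def innerDeriv : PowerSeries (PowerSeries R) →+ PowerSeries (PowerSeries R) :=
  coeffMap (σ := Unit) (PowerSeries.derivative R : PowerSeries R →+ PowerSeries R)

theorem coeff_innerDeriv (F : PowerSeries (PowerSeries R)) (i : ℕ) :
    PowerSeries.coeff i (innerDeriv F) = PowerSeries.derivative R (PowerSeries.coeff i F) := rfl

theorem innerDeriv_mul (F G : PowerSeries (PowerSeries R)) :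
    innerDeriv (F * G) = innerDeriv F * G + F * innerDeriv G :=
  coeffMap_mul (σ := Unit) (PowerSeries.derivative R : PowerSeries R →+ PowerSeries R)
    (fun a b => by
      change PowerSeries.derivative R (a * b) = PowerSeries.derivative R a * b +
        a * PowerSeries.derivative R b
      exact leibniz_powerSeries a b) F G

theorem coeff_diagonal_innerDeriv (F : PowerSeries (PowerSeries R)) (n : ℕ) :
    PowerSeries.coeff n (diagonal (innerDeriv F)) =
      ∑ p ∈ Finset.HasAntidiagonal.antidiagonal n,
        ((p.2 : R) + 1) * PowerSeries.coeff (p.2 + 1) (PowerSeries.coeff p.1 F) := by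
  rw [coeff_diagonal]
  refine Finset.sum_congr rfl fun p _ => ?_
  rw [coeff_innerDeriv, PowerSeries.coeff_derivative, mul_comm]

/-- The chain rule on the diagonal. -/
theorem derivative_diagonal (F : PowerSeries (PowerSeries R)) :
    PowerSeries.derivative R (diagonal F) =
      diagonal (PowerSeries.derivative _ F) + diagonal (innerDeriv F) := by
  ext n
  rw [PowerSeries.coeff_derivative, map_add, coeff_diagonal_innerDeriv, coeff_diagonal,
    coeff_diagonal, Finset.sum_mul]
  have h1 : ∀ p ∈ Finset.HasAntidiagonal.antidiagonal (n + 1),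
      PowerSeries.coeff p.2 (PowerSeries.coeff p.1 F) * ((n : R) + 1) =
      (p.1 : R) * PowerSeries.coeff p.2 (PowerSeries.coeff p.1 F) +
      (p.2 : R) * PowerSeries.coeff p.2 (PowerSeries.coeff p.1 F) := by
    intro p hp
    have h := congrArg (fun m : ℕ => (m : R)) (Finset.HasAntidiagonal.mem_antidiagonal.mp hp)
    push_cast at h
    rw [← h]; ring
  rw [Finset.sum_congr rfl h1, Finset.sum_add_distrib, Finset.Nat.sum_antidiagonal_succ,
    Finset.Nat.sum_antidiagonal_succ']
  simp only [Nat.cast_zero, zero_mul, zero_add, Nat.cast_add, Nat.cast_one]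
  congr 1
  refine Finset.sum_congr rfl fun p _ => ?_
  rw [PowerSeries.coeff_derivative]
  have e : ((p.1 : PowerSeries R) + 1) = PowerSeries.C ((p.1 : R) + 1) := by
    rw [map_add, map_natCast, map_one]
  rw [e, mul_comm (PowerSeries.coeff (p.1 + 1) F), PowerSeries.coeff_C_mul]

end Diagonal

/-- The shift by `ε [w]` in an inner variable `w`. -/
def innerShift (ε : ℂ) : TimeSeries →+* PowerSeries TimeSeries :=
  (PowerSeries.rescale (MvPowerSeries.C ε)).comp shiftHom

theorem coeff_innerShift (ε : ℂ) (f : TimeSeries) (l : ℕ) :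
    PowerSeries.coeff l (innerShift ε f) = MvPowerSeries.C (ε ^ l) * taylor f l := by
  change PowerSeries.coeff l (PowerSeries.rescale _ (shift f)) = _
  rw [PowerSeries.coeff_rescale, coeff_shift, map_pow]

theorem flow_coeff_innerShift (ε : ℂ) (f : TimeSeries) (k l : ℕ) :
    PowerSeries.coeff l (innerShift ε (flow k f)) =
      flow k (PowerSeries.coeff l (innerShift ε f)) := by
  rw [coeff_innerShift, coeff_innerShift, flow_C_mul, flow_apply, flow_apply, taylor_pderiv,
    nsmul_eq_mul, nsmul_eq_mul, ← coeff_shift, ← coeff_shift, shift_mul,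
    ← map_natCast MvPowerSeries.C, shift_C, PowerSeries.coeff_C_mul]

theorem miwaShift_eq_innerShift {ε : ℂ} (hε : ε ^ 2 = 1) (τ : TimeSeries) :
    miwaShift ε τ = ofPower (innerShift ε τ) := miwaShift_eq_ofPower hε τ

/-- The series `τ(t + ε [v] - ε [w])`, with outer variable `v` and inner variable `w`. -/
def doubleShift (ε : ℂ) : TimeSeries →+* PowerSeries (PowerSeries TimeSeries) :=
  (PowerSeries.map (innerShift (-ε))).comp (innerShift ε)

theorem coeff_doubleShift (ε : ℂ) (f : TimeSeries) (i : ℕ) :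
    PowerSeries.coeff i (doubleShift ε f) =
      innerShift (-ε) (PowerSeries.coeff i (innerShift ε f)) := rfl

theorem diagonal_doubleShift_coe {ε : ℂ} (hε : ε ^ 2 = 1) (p : MvPolynomial ℕ ℂ) :
    diagonal (doubleShift ε p) = PowerSeries.C (p : TimeSeries) := by
  have h : (diagonal.comp (doubleShift ε)).comp (MvPolynomial.coeToMvPowerSeries.ringHom (R := ℂ)) =
      PowerSeries.C.comp (MvPolynomial.coeToMvPowerSeries.ringHom (R := ℂ)) := by
    have hi : ∀ (δ : ℂ) (c : ℂ), innerShift δ (MvPowerSeries.C c) =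
        PowerSeries.C (MvPowerSeries.C c) := by
      intro δ c
      change PowerSeries.rescale _ (shift _) = _
      rw [shift_C, rescale_C]
    have hX : diagonal (PowerSeries.X : PowerSeries (PowerSeries TimeSeries)) = PowerSeries.X := by
      ext1 n
      rw [coeff_diagonal]
      cases n with
      | zero => simp
      | succ n =>
        rw [Finset.Nat.sum_antidiagonal_succ]
        cases n with
        | zero => simp
        | succ n =>
          rw [Finset.Nat.sum_antidiagonal_succ]
          rw [Finset.sum_eq_zero]
          · simp [PowerSeries.coeff_X]
          · rintro ⟨i, l⟩ hm
            simp [PowerSeries.coeff_X]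
    have hsX : ∀ (δ : ℂ), δ ^ 2 = 1 → ∀ k : ℕ, innerShift δ (MvPowerSeries.X k) =
        PowerSeries.C (MvPowerSeries.X k) +
          PowerSeries.C (MvPowerSeries.C (δ * (Nat.doubleFactorial (2 * k - 1) : ℂ))) *
            PowerSeries.X ^ (2 * k + 1) := by
      intro δ hδ k
      change PowerSeries.rescale _ (shift _) = _
      have h2 : (MvPowerSeries.C δ : TimeSeries) ^ (2 * k + 1) = MvPowerSeries.C δ := by
        rw [pow_succ, pow_mul, ← map_pow, hδ, map_one, one_pow, one_mul]
      rw [shift_X, map_add (PowerSeries.rescale _), map_mul (PowerSeries.rescale _),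
        map_pow (PowerSeries.rescale _), rescale_C, rescale_C, PowerSeries.rescale_X, mul_pow,
        ← map_pow PowerSeries.C, h2, map_mul MvPowerSeries.C, map_mul PowerSeries.C, map_natCast MvPowerSeries.C,
        map_natCast PowerSeries.C]
      ring
    apply MvPolynomial.ringHom_ext
    · intro c
      change diagonal (doubleShift ε (MvPolynomial.C c : MvPolynomial ℕ ℂ)) =
        PowerSeries.C ((MvPolynomial.C c : MvPolynomial ℕ ℂ) : TimeSeries)
      rw [MvPolynomial.coe_C, doubleShift, RingHom.comp_apply, hi, PowerSeries.map_C, hi, diagonal_C]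
    · intro k
      change diagonal (doubleShift ε (MvPolynomial.X k : MvPolynomial ℕ ℂ)) =
        PowerSeries.C ((MvPolynomial.X k : MvPolynomial ℕ ℂ) : TimeSeries)
      rw [MvPolynomial.coe_X, doubleShift, RingHom.comp_apply, hsX ε hε, map_add, map_mul, map_pow,
        PowerSeries.map_C, PowerSeries.map_C, PowerSeries.map_X, hi, map_add, map_mul, map_pow,
        diagonal_C, diagonal_C, hX, hsX (-ε) (by rwa [neg_sq])]
      have : (MvPowerSeries.C (-ε * (Nat.doubleFactorial (2 * k - 1) : ℂ)) : TimeSeries) =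
          -MvPowerSeries.C (ε * (Nat.doubleFactorial (2 * k - 1) : ℂ)) := by
        rw [neg_mul, map_neg]
      rw [this, map_neg PowerSeries.C]
      ring
  exact RingHom.congr_fun h p

/-- The shifts by `[v]` and `-[v]` cancel. -/
theorem diagonal_doubleShift {ε : ℂ} (hε : ε ^ 2 = 1) (f : TimeSeries) :
    diagonal (doubleShift ε f) = PowerSeries.C f := by
  classical
  ext n d
  let l : TimeSeries →+ ℂ :=
    { toFun := fun f => MvPowerSeries.coeff d (PowerSeries.coeff n (diagonal (doubleShift ε f)))
      map_zero' := by rw [map_zero, map_zero, map_zero, map_zero]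
      map_add' := fun f g => by rw [map_add, map_add, map_add, map_add] }
  let l' : TimeSeries →+ ℂ :=
    { toFun := fun f => MvPowerSeries.coeff d (PowerSeries.coeff n (PowerSeries.C f))
      map_zero' := by rw [map_zero, map_zero, map_zero]
      map_add' := fun f g => by rw [map_add, map_add, map_add] }
  refine Finitary.ext (l := l) (l' := l') ?_ ?_ (fun p => ?_) f
  · choose S hS using fun l : ℕ => finitary_coeff_taylor l d
    choose S' hS' using fun i : ℕ => finitary_coeff_taylor i
    refine ⟨(Finset.range (n + 1)).biUnion fun i =>
      (Finset.range (n + 1)).biUnion fun l => (S l).biUnion (S' i), fun f hf => ?_⟩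
    change MvPowerSeries.coeff d (PowerSeries.coeff n (diagonal (doubleShift ε f))) = 0
    rw [coeff_diagonal, map_sum]
    refine Finset.sum_eq_zero fun p hp => ?_
    have hp' := Finset.HasAntidiagonal.mem_antidiagonal.mp hp
    rw [coeff_doubleShift, coeff_innerShift, coeff_innerShift, taylor_C_mul,
      MvPowerSeries.coeff_C_mul, MvPowerSeries.coeff_C_mul]
    have h : MvPowerSeries.coeff d (taylor (taylor f p.1) p.2) = 0 := by
      refine hS p.2 _ fun d' hd' => hS' p.1 d' _ fun d'' hd'' => hf d'' ?_
      refine Finset.mem_biUnion.mpr ⟨p.1, Finset.mem_range.mpr (by omega), ?_⟩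
      refine Finset.mem_biUnion.mpr ⟨p.2, Finset.mem_range.mpr (by omega), ?_⟩
      exact Finset.mem_biUnion.mpr ⟨d', hd', hd''⟩
    rw [h, mul_zero, mul_zero]
  · refine ⟨{d}, fun f hf => ?_⟩
    change MvPowerSeries.coeff d (PowerSeries.coeff n (PowerSeries.C f)) = 0
    rw [PowerSeries.coeff_C]
    split_ifs
    · exact hf d (Finset.mem_singleton_self d)
    · exact map_zero _
  · change MvPowerSeries.coeff d (PowerSeries.coeff n (diagonal (doubleShift ε p))) =
      MvPowerSeries.coeff d (PowerSeries.coeff n (PowerSeries.C (p : TimeSeries)))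
    rw [diagonal_doubleShift_coe hε]

theorem coeff_nablaV {A : Type} [CommRing A] (y : PowerSeries (MvPowerSeries ℕ A)) (n : ℕ) :
    PowerSeries.coeff n (nablaV y) =
      ∑ k ∈ Finset.range (n / 2 + 1), flow k (PowerSeries.coeff (n - 2 * k) y) :=
  PowerSeries.coeff_mk _ _

theorem diagonal_map_nablaV (ε : ℂ) (y : PowerSeries TimeSeries) :
    diagonal (PowerSeries.map (innerShift ε) (nablaV y)) =
      nablaV (diagonal (PowerSeries.map (innerShift ε) y)) := by
  ext1 n
  rw [coeff_nablaV, coeff_diagonal]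
  simp only [coeff_diagonal, PowerSeries.coeff_map, coeff_nablaV, map_sum, flow_coeff_innerShift]
  rw [Finset.sum_sigma', Finset.sum_sigma']
  refine Finset.sum_nbij' (fun x => ⟨x.2, x.1.1 - 2 * x.2, x.1.2⟩)
    (fun x => ⟨⟨x.2.1 + 2 * x.1, x.2.2⟩, x.1⟩) ?_ ?_ ?_ ?_ ?_
  · rintro ⟨⟨a, b⟩, k⟩ h
    simp only [Finset.mem_sigma, Finset.mem_range,
      Finset.HasAntidiagonal.mem_antidiagonal] at h ⊢
    omega
  · rintro ⟨k, ⟨a, b⟩⟩ h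
    simp only [Finset.mem_sigma, Finset.mem_range,
      Finset.HasAntidiagonal.mem_antidiagonal] at h ⊢
    omega
  · rintro ⟨⟨a, b⟩, k⟩ h
    simp only [Finset.mem_sigma, Finset.mem_range,
      Finset.HasAntidiagonal.mem_antidiagonal] at h ⊢
    have : a - 2 * k + 2 * k = a := by omega
    simp only [this]
  · rintro ⟨k, ⟨a, b⟩⟩ h
    have : a + 2 * k - 2 * k = a := by omega
    simp only [this]
  · rintro ⟨⟨a, b⟩, k⟩ h
    rfl

theorem derivative_innerShift {ε : ℂ} (hε : ε ^ 2 = 1) (f : TimeSeries) :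
    PowerSeries.derivative _ (innerShift ε f) =
      PowerSeries.C (MvPowerSeries.C ε) * nablaV (innerShift ε f) := by
  ext1 n
  rw [PowerSeries.coeff_C_mul, PowerSeries.coeff_derivative, coeff_nablaV, coeff_innerShift,
    mul_assoc, mul_comm (taylor f (n + 1)), taylor_succ, Finset.mul_sum, Finset.mul_sum]
  refine Finset.sum_congr rfl fun k hk => ?_
  have hk' : 2 * k ≤ n := by
    have := Finset.mem_range.mp hk
    omega
  have e : ε ^ (n + 1) = ε * ε ^ (n - 2 * k) := by
    rw [pow_succ, mul_comm]
    nth_rewrite 1 [← Nat.sub_add_cancel hk']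
    rw [pow_add, pow_mul, hε, one_pow, mul_one]
  rw [coeff_innerShift, flow_C_mul, e, map_mul, mul_assoc, flow_apply]

theorem diagonal_derivative_doubleShift {ε : ℂ} (hε : ε ^ 2 = 1) (f : TimeSeries) :
    diagonal (PowerSeries.derivative _ (doubleShift ε f)) =
      PowerSeries.C (MvPowerSeries.C ε) * nablaV (PowerSeries.C f) := by
  have h1 : PowerSeries.derivative _ (doubleShift ε f) =
      PowerSeries.map (innerShift (-ε)) (PowerSeries.derivative _ (innerShift ε f)) := by
    rw [map_derivative]
    rfl
  have hi : innerShift (-ε) (MvPowerSeries.C ε) = PowerSeries.C (MvPowerSeries.C ε) := by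
    change PowerSeries.rescale _ (shift _) = _
    rw [shift_C, rescale_C]
  rw [h1, derivative_innerShift hε, map_mul, map_mul, PowerSeries.map_C, hi, diagonal_C,
    diagonal_map_nablaV, ← diagonal_doubleShift hε f]
  rfl

theorem diagonal_innerDeriv_doubleShift {ε : ℂ} (hε : ε ^ 2 = 1) (f : TimeSeries) :
    diagonal (innerDeriv (doubleShift ε f)) =
      -(PowerSeries.C (MvPowerSeries.C ε) * nablaV (PowerSeries.C f)) := by
  have h := derivative_diagonal (doubleShift ε f)
  rw [diagonal_doubleShift hε, PowerSeries.derivative_C, diagonal_derivative_doubleShift hε] at h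
  linear_combination -h

/-! ### The differential Fay identity -/

theorem flow_taylor {A : Type} [CommRing A] [Algebra ℂ A] (f : MvPowerSeries ℕ A) (k m : ℕ) :
    flow k (taylor f m) = taylor (flow k f) m := by
  have h : Nat.doubleFactorial (2 * k + 1) • MvPowerSeries.pderiv A k f =
      MvPowerSeries.C ((Nat.doubleFactorial (2 * k + 1) : ℕ) : A) * MvPowerSeries.pderiv A k f := by
    rw [map_natCast, nsmul_eq_mul]
  rw [flow_apply, flow_apply, h, taylor_C_mul, taylor_pderiv, map_natCast, nsmul_eq_mul]

theorem toWave_C (c : ℂ) : toWave (MvPowerSeries.C c) = MvPowerSeries.C (HahnSeries.C c) := by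
  rw [toWave, MvPowerSeries.map_C]

/-- The shift by `ε [v]` of a function of the times and of `z`, in an auxiliary variable `v`. -/
def outerShift (ε : ℂ) : WaveRing →+* PowerSeries WaveRing :=
  (PowerSeries.rescale (toWave (MvPowerSeries.C ε))).comp shiftHom

theorem coeff_outerShift (ε : ℂ) (f : WaveRing) (n : ℕ) :
    PowerSeries.coeff n (outerShift ε f) = toWave (MvPowerSeries.C (ε ^ n)) * taylor f n := by
  change PowerSeries.coeff n (PowerSeries.rescale _ (shift f)) = _
  rw [PowerSeries.coeff_rescale, coeff_shift, map_pow, map_pow]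

theorem ofPower_innerShift_taylor (ε : ℂ) (f : TimeSeries) (i : ℕ) :
    ofPower (innerShift ε (taylor f i)) = taylor (ofPower (innerShift ε f)) i := by
  have h := map_taylor (((ofPower.comp (innerShift ε) : TimeSeries →+* WaveRing)) :
    TimeSeries →+ WaveRing) (fun k f => ?_) f i
  · exact h
  · change ofPower (innerShift ε (MvPowerSeries.pderiv ℂ k f)) =
      MvPowerSeries.pderiv AtInfinity k (ofPower (innerShift ε f))
    rw [pderiv_ofPower]
    congr 1
    ext1 l
    rw [PowerSeries.coeff_mk, coeff_innerShift, coeff_innerShift, pderiv_C_mul, taylor_pderiv]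

theorem map_ofPower_doubleShift {ε : ℂ} (hε : ε ^ 2 = 1) (τ : TimeSeries) :
    PowerSeries.map ofPower (doubleShift ε τ) = outerShift ε (miwaShift (-ε) τ) := by
  ext1 i
  have hi : innerShift (-ε) (MvPowerSeries.C (ε ^ i)) = PowerSeries.C (MvPowerSeries.C (ε ^ i)) := by
    change PowerSeries.rescale _ (shift _) = _
    rw [shift_C, rescale_C]
  rw [PowerSeries.coeff_map, coeff_doubleShift, coeff_innerShift, map_mul, map_mul, hi, ofPower_C,
    ofPower_innerShift_taylor, coeff_outerShift, miwaShift_eq_innerShift (by rwa [neg_sq])]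

/-- The bilinear identity survives shifts of the times by `±[v]` and derivatives in `v`. -/
theorem cf_one_coeff_derivative_mul_eq_zero {f g : WaveRing} (h : f ∈ residueFree g) (n : ℕ) :
    cf 1 (PowerSeries.coeff n (PowerSeries.derivative _ (outerShift 1 f) * outerShift (-1) g)) =
      0 := by
  rw [PowerSeries.coeff_mul, map_sum]
  refine Finset.sum_eq_zero fun p _ => ?_
  rw [PowerSeries.coeff_derivative, coeff_outerShift, coeff_outerShift]
  have hg : toWave (MvPowerSeries.C ((-1) ^ p.2)) * taylor g p.2 ∈ residueFree f :=
    toWave_mul_mem_residueFree _ (taylor_mem_residueFree (residueFree_symm h) _)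
  have hf := toWave_mul_mem_residueFree ((p.1 : TimeSeries) + 1) (toWave_mul_mem_residueFree
    (MvPowerSeries.C (1 ^ (p.1 + 1))) (taylor_mem_residueFree (residueFree_symm hg) (p.1 + 1)))
  have h1 := cf_mul_eq_zero_of_mem_residueFree hf 0
  rw [Nat.cast_zero, mul_zero, zero_add, map_add, map_natCast, map_one] at h1
  rw [mul_comm _ ((p.1 : WaveRing) + 1)]
  exact h1

section ExponentialShift

theorem coeff_sub_C_mul_X_sq_mul {R : Type} [CommRing R] (c : R) (y : PowerSeries R) (n : ℕ) :
    PowerSeries.coeff (n + 2) ((1 - PowerSeries.C c * PowerSeries.X ^ 2) * y) =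
      PowerSeries.coeff (n + 2) y - c * PowerSeries.coeff n y := by
  rw [sub_mul, one_mul, map_sub, mul_assoc, PowerSeries.coeff_C_mul, PowerSeries.coeff_X_pow_mul]

theorem coeff_sub_C_mul_X_sq_mul_of_lt {R : Type} [CommRing R] (c : R) (y : PowerSeries R) {n : ℕ}
    (hn : n < 2) :
    PowerSeries.coeff n ((1 - PowerSeries.C c * PowerSeries.X ^ 2) * y) =
      PowerSeries.coeff n y := by
  rw [sub_mul, one_mul, map_sub, mul_assoc, PowerSeries.coeff_C_mul, PowerSeries.coeff_X_pow_mul',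
    if_neg (by omega), mul_zero, sub_zero]

/-- The shift of the exponential factor is `√((1 + v z) / (1 - v z))` times the factor; this is
its differential equation. -/
theorem derivative_outerShift_exp {ε : ℂ} (hε : ε ^ 2 = 1) {f : WaveRing}
    (hf : ∀ k, flow k f = toWave (MvPowerSeries.C ε) * zW ^ (2 * k + 1) * f) :
    (1 - PowerSeries.C (zW ^ 2) * PowerSeries.X ^ 2) *
        PowerSeries.derivative _ (outerShift ε f) =
      PowerSeries.C zW * outerShift ε f := by
  set c : ℕ → WaveRing := fun n => PowerSeries.coeff n (outerShift ε f) with hc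
  have hrec : ∀ n, PowerSeries.coeff n (PowerSeries.derivative _ (outerShift ε f)) =
      ∑ k ∈ Finset.range (n / 2 + 1), zW ^ (2 * k + 1) * c (n - 2 * k) := by
    intro n
    rw [PowerSeries.coeff_derivative, coeff_outerShift, mul_assoc, mul_comm (taylor f (n + 1)),
      taylor_succ, Finset.mul_sum]
    refine Finset.sum_congr rfl fun k hk => ?_
    have hk' : 2 * k ≤ n := by
      have := Finset.mem_range.mp hk
      omega
    have e : ε ^ (n + 1) * ε = ε ^ (n - 2 * k) := by
      rw [← pow_succ, show n + 1 + 1 = (n - 2 * k) + 2 * (k + 1) by omega, pow_add, pow_mul, hε,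
        one_pow, mul_one]
    have e1 : toWave (MvPowerSeries.C ε) * zW ^ (2 * k + 1) =
        MvPowerSeries.C (HahnSeries.C ε * z ^ (2 * k + 1)) := by
      rw [toWave_C, zW, map_mul, map_pow]
    rw [← flow_apply, flow_taylor, hf, e1, taylor_C_mul, ← e1, hc]
    simp only [coeff_outerShift]
    rw [← e, map_mul, map_mul]
    ring
  ext1 n
  rw [PowerSeries.coeff_C_mul]
  match n with
  | 0 => rw [coeff_sub_C_mul_X_sq_mul_of_lt _ _ (by norm_num), hrec]; simp [c]
  | 1 => rw [coeff_sub_C_mul_X_sq_mul_of_lt _ _ (by norm_num), hrec]; simp [c]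
  | n + 2 =>
    rw [coeff_sub_C_mul_X_sq_mul, hrec, hrec, show (n + 2) / 2 + 1 = (n / 2 + 1) + 1 by omega,
      Finset.sum_range_succ', Finset.mul_sum]
    have e : ∀ k ∈ Finset.range (n / 2 + 1),
        zW ^ (2 * (k + 1) + 1) * c (n + 2 - 2 * (k + 1)) =
        zW ^ 2 * (zW ^ (2 * k + 1) * c (n - 2 * k)) := by
      intro k _
      rw [show n + 2 - 2 * (k + 1) = n - 2 * k by omega]
      ring
    rw [Finset.sum_congr rfl e]
    simp [c]

theorem isUnit_sub_C_mul_X_sq {R : Type} [CommRing R] (c : R) :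
    IsUnit (1 - PowerSeries.C c * PowerSeries.X ^ 2 : PowerSeries R) := by
  rw [PowerSeries.isUnit_iff_constantCoeff]
  simp

theorem natCast_add_one_cancel {a b : WaveRing} (m : ℕ)
    (h : a * ((m : WaveRing) + 1) = b * ((m : WaveRing) + 1)) : a = b :=
  natCast_add_one_mul_cancel m (by rw [mul_comm, h, mul_comm])

/-- The series `(1 + c v) / (1 - c v)`, from its differential equation. -/
theorem coeff_eq_of_derivative {c : WaveRing} {L : PowerSeries WaveRing}
    (h0 : PowerSeries.coeff 0 L = 1)
    (h : (1 - PowerSeries.C (c ^ 2) * PowerSeries.X ^ 2) * PowerSeries.derivative _ L =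
      2 * (PowerSeries.C c * L)) (n : ℕ) :
    PowerSeries.coeff (n + 1) L = 2 * c ^ (n + 1) := by
  have h2 : ∀ n, PowerSeries.coeff n (2 * (PowerSeries.C c * L)) =
      2 * (c * PowerSeries.coeff n L) := fun n => by
    rw [two_mul, map_add, PowerSeries.coeff_C_mul, two_mul]
  have h1 : PowerSeries.coeff 1 L = 2 * c := by
    have := congrArg (PowerSeries.coeff 0) h
    rw [coeff_sub_C_mul_X_sq_mul_of_lt _ _ (by norm_num), h2, h0, PowerSeries.coeff_derivative] at this
    simpa using this
  have key : ∀ n, PowerSeries.coeff (n + 1) L = 2 * c ^ (n + 1) ∧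
      PowerSeries.coeff (n + 2) L = 2 * c ^ (n + 2) := by
    intro n
    induction n with
    | zero =>
      refine ⟨by simpa using h1, natCast_add_one_cancel 1 ?_⟩
      have := congrArg (PowerSeries.coeff 1) h
      rw [coeff_sub_C_mul_X_sq_mul_of_lt _ _ (by norm_num), h2, h1,
        PowerSeries.coeff_derivative] at this
      have h' : PowerSeries.coeff (0 + 2) L = PowerSeries.coeff (1 + 1) L := rfl
      rw [h', this]
      push_cast
      ring
    | succ n ih =>
      refine ⟨ih.2, natCast_add_one_cancel (n + 2) ?_⟩
      have := congrArg (PowerSeries.coeff (n + 2)) h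
      rw [coeff_sub_C_mul_X_sq_mul, h2, ih.2, PowerSeries.coeff_derivative,
        PowerSeries.coeff_derivative, ih.1] at this
      have h' : PowerSeries.coeff (n + 1 + 2) L = PowerSeries.coeff (n + 2 + 1) L := rfl
      rw [h']
      push_cast at this ⊢
      linear_combination this
  exact (key n).1

end ExponentialShift

theorem cf_natCast_mul (n : ℤ) (m : ℕ) (f : WaveRing) :
    cf n ((m : WaveRing) * f) = (m : TimeSeries) * cf n f := by
  rw [← nsmul_eq_mul, map_nsmul, nsmul_eq_mul]

/-- The bilinear identity with arguments shifted by `[v]` and differentiated in `v`, as a relation between the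
coefficients of `h = ∂_v F₁ F₂` and `f = F₁ F₂`, where `F₁ = τ(t + [v] - [w])` and
`F₂ = τ(t - [v] + [w])`. -/
theorem IsTauFunction.sum_coeff_doubleShift {τ : TimeSeries} (hτ : IsTauFunction τ) (n : ℕ) :
    ∑ p ∈ Finset.HasAntidiagonal.antidiagonal n,
      ((if p.2 = 0 then 1 else 2) * PowerSeries.coeff (p.2 + 1) (PowerSeries.coeff p.1
          (PowerSeries.derivative _ (doubleShift 1 τ) * doubleShift (-1) τ)) +
        ((p.2 : TimeSeries) + 1) * PowerSeries.coeff (p.2 + 2) (PowerSeries.coeff p.1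
          (doubleShift 1 τ * doubleShift (-1) τ))) = 0 := by
  set e := expSeries phase with he
  set e' := expSeries (-phase) with he'
  set E := outerShift 1 e with hE
  set E' := outerShift (-1) e' with hE'
  have hEd := derivative_outerShift_exp (ε := 1) (by norm_num) (f := e) fun k => by
    rw [he, flow_exp_phase, map_one, map_one, one_mul]
  have hEd' := derivative_outerShift_exp (ε := -1) (by norm_num) (f := e') fun k => by
    rw [he', flow_exp_neg_phase, map_neg, map_neg, map_one, map_one]
    ring
  rw [← hE] at hEd
  rw [← hE'] at hEd'
  have hL : (1 - PowerSeries.C (zW ^ 2) * PowerSeries.X ^ 2) * PowerSeries.derivative _ (E * E') =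
      2 * (PowerSeries.C zW * (E * E')) := by
    rw [leibniz_powerSeries]
    linear_combination E' * hEd + E * hEd'
  have hL0 : PowerSeries.coeff 0 (E * E') = 1 := by
    rw [PowerSeries.coeff_zero_eq_constantCoeff_apply, map_mul,
      ← PowerSeries.coeff_zero_eq_constantCoeff_apply,
      ← PowerSeries.coeff_zero_eq_constantCoeff_apply, hE, hE', coeff_outerShift,
      coeff_outerShift, taylor_zero, taylor_zero, pow_zero, pow_zero, map_one, map_one, one_mul,
      one_mul, exp_phase_mul_exp_neg_phase]
  have hLn := coeff_eq_of_derivative hL0 hL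
  -- Both factors obey the same differential equation, so each contributes half of the derivative.
  have hhalf : 2 * (PowerSeries.derivative _ E * E') = PowerSeries.derivative _ (E * E') := by
    refine (isUnit_sub_C_mul_X_sq (zW ^ 2)).mul_left_cancel ?_
    rw [hL]
    linear_combination 2 * E' * hEd
  set F₁ := doubleShift 1 τ with hF₁
  set F₂ := doubleShift (-1) τ with hF₂
  have hx₁ : outerShift 1 (miwaShift (-1) τ) = PowerSeries.map ofPower F₁ := by
    rw [hF₁, map_ofPower_doubleShift (by norm_num)]
  have hx₂ : outerShift (-1) (miwaShift 1 τ) = PowerSeries.map ofPower F₂ := by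
    rw [hF₂, map_ofPower_doubleShift (by norm_num), neg_neg]
  have hd₁ : PowerSeries.derivative _ (PowerSeries.map ofPower F₁) =
      PowerSeries.map ofPower (PowerSeries.derivative _ F₁) := (map_derivative _ _).symm
  have hY : 2 * (PowerSeries.derivative _ (outerShift 1 (miwaShift (-1) τ * e)) *
      outerShift (-1) (miwaShift 1 τ * e')) =
      2 * (PowerSeries.map ofPower (PowerSeries.derivative _ F₁ * F₂) * (E * E')) +
        PowerSeries.map ofPower (F₁ * F₂) * PowerSeries.derivative _ (E * E') := by
    rw [map_mul (outerShift 1), map_mul (outerShift (-1)), hx₁, hx₂, ← hE, ← hE', leibniz_powerSeries, hd₁,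
      map_mul, map_mul]
    linear_combination PowerSeries.map ofPower F₁ * PowerSeries.map ofPower F₂ * hhalf
  have hres := cf_one_coeff_derivative_mul_eq_zero hτ.mem_residueFree n
  rw [← he, ← he'] at hres
  have hY' := congrArg (fun y => cf 1 (PowerSeries.coeff n y)) hY
  simp only [two_mul, map_add, hres] at hY'
  rw [PowerSeries.coeff_mul, PowerSeries.coeff_mul, map_sum, map_sum, ← Finset.sum_add_distrib,
    ← Finset.sum_add_distrib, add_zero] at hY'
  have h2 : (0 : TimeSeries) = 2 * ∑ p ∈ Finset.HasAntidiagonal.antidiagonal n,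
      ((if p.2 = 0 then 1 else 2) * PowerSeries.coeff (p.2 + 1) (PowerSeries.coeff p.1
          (PowerSeries.derivative _ F₁ * F₂)) +
        ((p.2 : TimeSeries) + 1) * PowerSeries.coeff (p.2 + 2) (PowerSeries.coeff p.1
          (F₁ * F₂))) := by
    rw [hY', Finset.mul_sum]
    refine Finset.sum_congr rfl fun p _ => ?_
    obtain ⟨i, j⟩ := p
    have hcf : ∀ (q : PowerSeries TimeSeries) (m k : ℕ),
        cf 1 (ofPower q * ((m : WaveRing) * zW ^ k)) =
          (m : TimeSeries) * PowerSeries.coeff (k + 1) q := by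
      intro q m k
      rw [show ofPower q * ((m : WaveRing) * zW ^ k) = (m : WaveRing) * (zW ^ k * ofPower q) by ring,
        cf_natCast_mul, cf_zW_pow_mul, show (1 : ℤ) + k = ((k + 1 : ℕ) : ℤ) by push_cast; ring,
        cf_natCast_ofPower]
    have hLj : PowerSeries.coeff j (E * E') =
        ((if j = 0 then 1 else 2 : ℕ) : WaveRing) * zW ^ j := by
      cases j with
      | zero => rw [hL0]; simp
      | succ j => rw [hLn]; simp
    have hLd : PowerSeries.coeff j (PowerSeries.derivative _ (E * E')) =
        ((2 * (j + 1) : ℕ) : WaveRing) * zW ^ (j + 1) := by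
      rw [PowerSeries.coeff_derivative, hLn]
      push_cast
      ring
    rw [PowerSeries.coeff_map, PowerSeries.coeff_map, hLj, hLd, hcf, hcf]
    push_cast
    ring
  exact (two_nsmul_eq_zero.mp (by rw [two_nsmul, ← two_mul]; exact h2.symm))

theorem innerDeriv_derivative {R : Type} [CommRing R] (F : PowerSeries (PowerSeries R)) :
    innerDeriv (PowerSeries.derivative _ F) = PowerSeries.derivative _ (innerDeriv F) := by
  ext1 i
  rw [coeff_innerDeriv, PowerSeries.coeff_derivative, PowerSeries.coeff_derivative,
    coeff_innerDeriv]
  have e : ((i : PowerSeries R) + 1) = PowerSeries.C ((i : R) + 1) := by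
    rw [map_add, map_natCast, map_one]
  rw [e, leibniz_powerSeries, PowerSeries.derivative_C, mul_zero, add_zero]

/-- The restriction to vanishing inner variable. -/
def innerEval {R : Type} [CommRing R] : PowerSeries (PowerSeries R) →+* PowerSeries R :=
  PowerSeries.map PowerSeries.constantCoeff

theorem coeff_innerEval {R : Type} [CommRing R] (F : PowerSeries (PowerSeries R)) (i : ℕ) :
    PowerSeries.coeff i (innerEval F) = PowerSeries.coeff 0 (PowerSeries.coeff i F) := by
  rw [innerEval, PowerSeries.coeff_map, PowerSeries.coeff_zero_eq_constantCoeff_apply]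

theorem coeff_innerEval_innerDeriv {R : Type} [CommRing R] (F : PowerSeries (PowerSeries R))
    (i : ℕ) :
    PowerSeries.coeff i (innerEval (innerDeriv F)) = PowerSeries.coeff 1 (PowerSeries.coeff i F) := by
  rw [coeff_innerEval, coeff_innerDeriv, PowerSeries.coeff_derivative]
  simp

theorem innerEval_doubleShift (ε : ℂ) (f : TimeSeries) :
    innerEval (doubleShift ε f) = innerShift ε f := by
  ext1 i
  rw [coeff_innerEval, coeff_doubleShift, coeff_innerShift, pow_zero, map_one, one_mul,
    taylor_zero]

theorem innerEval_innerDeriv_doubleShift (ε : ℂ) (f : TimeSeries) :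
    innerEval (innerDeriv (doubleShift ε f)) =
      -(PowerSeries.C (MvPowerSeries.C ε) * innerShift ε (MvPowerSeries.pderiv ℂ 0 f)) := by
  ext1 i
  rw [coeff_innerEval_innerDeriv, coeff_doubleShift, coeff_innerShift, map_neg,
    PowerSeries.coeff_C_mul, taylor_one, pow_one, map_neg, neg_mul, ← flow_zero_apply,
    ← flow_zero_apply, flow_coeff_innerShift]

/-- The bilinear identity, summed over the powers of the auxiliary variable. -/
theorem IsTauFunction.fay_powerSeries {τ : TimeSeries} (hτ : IsTauFunction τ) :
    2 * (PowerSeries.X * (nablaV (PowerSeries.C τ) * PowerSeries.C τ -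
      PowerSeries.derivative _ (innerShift 1 τ) * innerShift (-1) τ)) -
    PowerSeries.X ^ 2 * (PowerSeries.derivative _ (innerShift 1 τ) *
        innerShift (-1) (MvPowerSeries.pderiv ℂ 0 τ) -
      PowerSeries.derivative _ (innerShift 1 (MvPowerSeries.pderiv ℂ 0 τ)) * innerShift (-1) τ) -
    PowerSeries.C τ * PowerSeries.C τ + innerShift 1 τ * innerShift (-1) τ = 0 := by
  set F₁ := doubleShift 1 τ with hF₁
  set F₂ := doubleShift (-1) τ with hF₂
  have h1 : (1 : ℂ) ^ 2 = 1 := by norm_num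
  have h2 : (-1 : ℂ) ^ 2 = 1 := by norm_num
  have hdh : diagonal (PowerSeries.derivative _ F₁ * F₂) =
      nablaV (PowerSeries.C τ) * PowerSeries.C τ := by
    rw [map_mul, hF₁, hF₂, diagonal_derivative_doubleShift h1, diagonal_doubleShift h2, map_one,
      map_one, one_mul]
  have hdf : diagonal (F₁ * F₂) = PowerSeries.C τ * PowerSeries.C τ := by
    rw [map_mul, hF₁, hF₂, diagonal_doubleShift h1, diagonal_doubleShift h2]
  have hdz : diagonal (innerDeriv (F₁ * F₂)) = 0 := by
    rw [innerDeriv_mul, map_add, map_mul, map_mul, hF₁, hF₂, diagonal_doubleShift h1,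
      diagonal_doubleShift h2, diagonal_innerDeriv_doubleShift h1,
      diagonal_innerDeriv_doubleShift h2, map_neg MvPowerSeries.C, map_neg PowerSeries.C, map_one,
      map_one]
    ring
  have he1 : innerEval (PowerSeries.derivative _ F₁ * F₂) =
      PowerSeries.derivative _ (innerShift 1 τ) * innerShift (-1) τ := by
    rw [map_mul, innerEval, map_derivative]
    change PowerSeries.derivative _ (innerEval F₁) * innerEval F₂ = _
    rw [hF₁, hF₂, innerEval_doubleShift, innerEval_doubleShift]
  have he2 : innerEval (innerDeriv (PowerSeries.derivative _ F₁ * F₂)) =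
      PowerSeries.derivative _ (innerShift 1 τ) * innerShift (-1) (MvPowerSeries.pderiv ℂ 0 τ) -
      PowerSeries.derivative _ (innerShift 1 (MvPowerSeries.pderiv ℂ 0 τ)) * innerShift (-1) τ := by
    rw [innerDeriv_mul, map_add, map_mul, map_mul, innerDeriv_derivative]
    have e : ∀ F, innerEval (PowerSeries.derivative (PowerSeries TimeSeries) F) =
        PowerSeries.derivative _ (innerEval F) := fun F => map_derivative _ _
    rw [e, e, hF₁, hF₂, innerEval_doubleShift, innerEval_doubleShift,
      innerEval_innerDeriv_doubleShift, innerEval_innerDeriv_doubleShift,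
      map_neg MvPowerSeries.C, map_neg PowerSeries.C, map_one, map_one, one_mul, map_neg]
    ring
  have he3 : innerEval (F₁ * F₂) = innerShift 1 τ * innerShift (-1) τ := by
    rw [map_mul, hF₁, hF₂, innerEval_doubleShift, innerEval_doubleShift]
  have hc2 : ∀ (m : ℕ) (y : PowerSeries TimeSeries),
      PowerSeries.coeff m (2 * y) = 2 * PowerSeries.coeff m y := by
    intro m y
    rw [two_mul, map_add, two_mul]
  have hs0 : ∀ ε : ℂ, PowerSeries.constantCoeff (innerShift ε τ) = τ := fun ε => by
    rw [← PowerSeries.coeff_zero_eq_constantCoeff_apply, coeff_innerShift, taylor_zero, pow_zero,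
      map_one, one_mul]
  rw [← he1, ← he2, ← he3, ← hdh, ← hdf]
  ext1 n
  rw [map_zero, map_add, map_sub, map_sub, hc2]
  -- The bilinear identity concerns the coefficients from the second on; the first two agree
  -- by inspection.
  match n with
  | 0 =>
    rw [hdf, he3]
    simp [hs0]
  | 1 =>
    have hX : ∀ y : PowerSeries TimeSeries,
        PowerSeries.coeff 1 (PowerSeries.X * y) = PowerSeries.constantCoeff y := fun y => by
      have := PowerSeries.coeff_succ_X_mul 0 y
      rwa [PowerSeries.coeff_zero_eq_constantCoeff_apply] at this
    have hn : PowerSeries.constantCoeff (nablaV (PowerSeries.C τ)) = MvPowerSeries.pderiv ℂ 0 τ := by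
      rw [← PowerSeries.coeff_zero_eq_constantCoeff_apply, coeff_nablaV]
      simp [flow_zero_apply]
    have hi1 : ∀ ε : ℂ, PowerSeries.coeff 1 (innerShift ε τ) =
        MvPowerSeries.C ε * MvPowerSeries.pderiv ℂ 0 τ := fun ε => by
      rw [coeff_innerShift, pow_one, taylor_one]
    have hd : PowerSeries.constantCoeff (PowerSeries.derivative _ (innerShift 1 τ)) =
        MvPowerSeries.pderiv ℂ 0 τ := by
      rw [← PowerSeries.coeff_zero_eq_constantCoeff_apply, PowerSeries.coeff_derivative, zero_add,
        hi1]
      simp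
    rw [hdf, he3, hdh, he1, PowerSeries.coeff_X_pow_mul', if_neg (by norm_num), hX, map_sub,
      map_mul, map_mul, hn, hd, hs0, PowerSeries.constantCoeff_C, PowerSeries.coeff_one_mul,
      PowerSeries.coeff_one_mul, hi1, hi1, hs0, hs0, map_neg MvPowerSeries.C, map_one]
    simp
  | n + 2 =>
    have hs := hτ.sum_coeff_doubleShift n
    rw [← hF₁, ← hF₂, Finset.sum_add_distrib] at hs
    have hs1 : ∑ p ∈ Finset.HasAntidiagonal.antidiagonal n,
        (if p.2 = 0 then 1 else 2) * PowerSeries.coeff (p.2 + 1) (PowerSeries.coeff p.1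
          (PowerSeries.derivative _ F₁ * F₂)) =
        2 * (PowerSeries.coeff (n + 1) (diagonal (PowerSeries.derivative _ F₁ * F₂)) -
          PowerSeries.coeff (n + 1) (innerEval (PowerSeries.derivative _ F₁ * F₂))) -
        PowerSeries.coeff n (innerEval (innerDeriv (PowerSeries.derivative _ F₁ * F₂))) := by
      rw [coeff_diagonal, Finset.Nat.sum_antidiagonal_succ', coeff_innerEval,
        coeff_innerEval_innerDeriv]
      have hsplit : ∀ p ∈ Finset.HasAntidiagonal.antidiagonal n,
          (if p.2 = 0 then (1 : TimeSeries) else 2) *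
            PowerSeries.coeff (p.2 + 1) (PowerSeries.coeff p.1
              (PowerSeries.derivative _ F₁ * F₂)) =
          2 * PowerSeries.coeff (p.2 + 1) (PowerSeries.coeff p.1
              (PowerSeries.derivative _ F₁ * F₂)) -
          (if p = (n, 0) then PowerSeries.coeff 1 (PowerSeries.coeff n
              (PowerSeries.derivative _ F₁ * F₂)) else 0) := by
        rintro ⟨i, j⟩ hp
        have hp' := Finset.HasAntidiagonal.mem_antidiagonal.mp hp
        simp only at hp'
        by_cases hj : j = 0
        · subst hj
          have hi : i = n := by omega
          subst hi
          simp only [if_true]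
          ring
        · have hne : ¬ ((i, j) = (n, 0)) := fun h => hj (Prod.mk.inj h).2
          simp only [if_neg hj, if_neg hne]
          ring
      rw [Finset.sum_congr rfl hsplit, Finset.sum_sub_distrib, ← Finset.mul_sum,
        Finset.sum_ite_eq' _ (n, 0), if_pos (by simp)]
      ring
    have hs2 : ∑ p ∈ Finset.HasAntidiagonal.antidiagonal n,
        ((p.2 : TimeSeries) + 1) * PowerSeries.coeff (p.2 + 2) (PowerSeries.coeff p.1
          (F₁ * F₂)) =
        PowerSeries.coeff (n + 1) (diagonal (innerDeriv (F₁ * F₂))) -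
        PowerSeries.coeff (n + 2) (diagonal (F₁ * F₂)) +
        PowerSeries.coeff (n + 2) (innerEval (F₁ * F₂)) := by
      rw [coeff_diagonal_innerDeriv, coeff_diagonal, coeff_innerEval,
        Finset.Nat.sum_antidiagonal_succ', Finset.Nat.sum_antidiagonal_succ',
        Finset.Nat.sum_antidiagonal_succ']
      have e : ∀ p ∈ Finset.HasAntidiagonal.antidiagonal n,
          ((p.2 : TimeSeries) + 1) * PowerSeries.coeff (p.2 + 2) (PowerSeries.coeff p.1
            (F₁ * F₂)) =
          (((p.2 + 1 : ℕ) : TimeSeries) + 1) * PowerSeries.coeff (p.2 + 1 + 1)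
            (PowerSeries.coeff p.1 (F₁ * F₂)) -
          PowerSeries.coeff (p.2 + 1 + 1) (PowerSeries.coeff p.1 (F₁ * F₂)) := by
        rintro ⟨i, j⟩ _
        push_cast
        ring
      rw [Finset.sum_congr rfl e, Finset.sum_sub_distrib]
      simp only [Nat.cast_zero]
      ring
    rw [hs1, hs2, hdz, map_zero] at hs
    rw [PowerSeries.coeff_X_pow_mul, PowerSeries.coeff_succ_X_mul, map_sub]
    linear_combination hs

/-- The generating series `∑ (2 k + 1)!! z ^ (-2 k - 2) ∂ log τ / ∂t_k`. -/
def nablaLog (τ : TimeSeries) : WaveRing :=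
  ofPower (PowerSeries.X ^ 2 * nablaV (PowerSeries.C (logSeries τ)))

theorem flow_eq_mul_flow_logSeries {τ : TimeSeries} (hτ : MvPowerSeries.constantCoeff τ ≠ 0)
    (k : ℕ) : flow k τ = τ * flow k (logSeries τ) := by
  rw [flow_apply, flow_apply, pderiv_logSeries hτ, mul_smul_comm, ← mul_assoc,
    MvPowerSeries.mul_inv_cancel _ hτ, one_mul]

theorem nablaV_C_eq {τ : TimeSeries} (hτ : MvPowerSeries.constantCoeff τ ≠ 0) :
    nablaV (PowerSeries.C τ) = PowerSeries.C τ * nablaV (PowerSeries.C (logSeries τ)) := by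
  ext1 n
  rw [PowerSeries.coeff_C_mul, coeff_nablaV, coeff_nablaV, Finset.mul_sum]
  refine Finset.sum_congr rfl fun k _ => ?_
  rw [PowerSeries.coeff_C, PowerSeries.coeff_C]
  split_ifs
  · exact flow_eq_mul_flow_logSeries hτ k
  · rw [map_zero, mul_zero]

theorem dx_miwaShift {ε : ℂ} (hε : ε ^ 2 = 1) (τ : TimeSeries) :
    dx (miwaShift ε τ) = ofPower (innerShift ε (MvPowerSeries.pderiv ℂ 0 τ)) := by
  rw [miwaShift_eq_innerShift hε, dx, pderiv_ofPower]
  congr 1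
  ext1 l
  rw [PowerSeries.coeff_mk, ← flow_zero_apply, ← flow_coeff_innerShift, flow_zero_apply]

/-- The differential Fay identity. -/
theorem IsTauFunction.fay {τ : TimeSeries} (hτ₀ : MvPowerSeries.constantCoeff τ ≠ 0)
    (hτ : IsTauFunction τ) :
    dzW (miwaShift 1 τ) * dx (miwaShift (-1) τ) - dzW (dx (miwaShift 1 τ)) * miwaShift (-1) τ +
      2 * zW * (toWave τ ^ 2 * nablaLog τ + dzW (miwaShift 1 τ) * miwaShift (-1) τ) +
      miwaShift 1 τ * miwaShift (-1) τ = toWave τ ^ 2 := by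
  have h1 : (1 : ℂ) ^ 2 = 1 := by norm_num
  have h2 : (-1 : ℂ) ^ 2 = 1 := by norm_num
  have h := congrArg ofPower hτ.fay_powerSeries
  rw [nablaV_C_eq hτ₀] at h
  simp only [map_add, map_sub, map_mul, map_pow, map_ofNat, map_zero, ofPower_C] at h
  have d1 : ofPower (PowerSeries.derivative _ (innerShift 1 τ)) =
      -(zW ^ 2 * dzW (miwaShift 1 τ)) := by
    rw [miwaShift_eq_innerShift h1, dzW_ofPower, neg_neg]
  have d2 : ofPower (PowerSeries.derivative _ (innerShift 1 (MvPowerSeries.pderiv ℂ 0 τ))) =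
      -(zW ^ 2 * dzW (dx (miwaShift 1 τ))) := by
    rw [dx_miwaShift h1, dzW_ofPower, neg_neg]
  rw [d1, d2, ← miwaShift_eq_innerShift h1, ← miwaShift_eq_innerShift h2, ← dx_miwaShift h2] at h
  have hX := zW_mul_ofPower_X
  rw [nablaLog, map_mul, map_pow]
  set X := ofPower PowerSeries.X
  set T := toWave τ
  set N := ofPower (nablaV (PowerSeries.C (logSeries τ)))
  set A := miwaShift (-1) τ
  set B := miwaShift 1 τ
  linear_combination h + (2 * T ^ 2 * X * N - 2 * zW * dzW B * A -
    (zW * X + 1) * (dzW B * dx A - dzW (dx B) * A)) * hX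

/-- The differential Fay identity, in terms of the wave functions. -/
theorem IsTauFunction.fay_psi {τ : TimeSeries} (hτ₀ : MvPowerSeries.constantCoeff τ ≠ 0)
    (hτ : IsTauFunction τ) :
    dzW (psiStar τ) * dx (psi τ) - dzW (dx (psiStar τ)) * psi τ =
      1 - 2 * zW * nablaLog τ - 2 * zW * dzW phase := by
  have hF := hτ.fay hτ₀
  have hW := wronskian hτ₀ hτ
  have hTs : toWave τ * toWave τ⁻¹ = 1 := by
    rw [← map_mul, MvPowerSeries.mul_inv_cancel _ hτ₀, map_one]
  have hds : dzW (dx (toWave τ⁻¹)) = 0 := by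
    rw [dx, pderiv_toWave, dzW_toWave]
  have hee := exp_phase_mul_exp_neg_phase
  rw [dx_psi_eq, dx_psiStar_eq] at hW ⊢
  rw [psi_eq, psiStar_eq] at hW ⊢
  rw [dzW_mul, dzW_mul, dzW_exp_neg_phase, map_sub, dzW_mul zW, dzW_zW, amplitude, amplitude,
    dx_mul, dx_mul, dzW_mul (miwaShift 1 τ), dzW_toWave, map_add, dzW_mul (dx _), dzW_toWave,
    dzW_mul (miwaShift 1 τ) (dx _), hds]
  rw [amplitude, amplitude, dx_mul, dx_mul] at hW
  set T := toWave τ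
  set s := toWave τ⁻¹
  set A := miwaShift (-1) τ
  set B := miwaShift 1 τ
  set e := expSeries phase
  set e' := expSeries (-phase)
  set θ := dzW phase
  linear_combination (-θ) * hW + s ^ 2 * hF + (1 - 2 * zW * nablaLog τ) * (T * s + 1) * hTs
    + (dzW B * s * (dx A * s + A * dx s + zW * (A * s)) - A * s *
      (dzW (dx B) * s + dzW B * dx s - (B * s + zW * (dzW B * s)))) * hee

/-! ### The flows of the one-point function -/

/-- The polynomials `β_k` with `∂_z (polyPart k) = 2 z β_k`. -/
def polyPartDeriv (τ : TimeSeries) : ℕ → WaveRing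
  | 0 => 0
  | k + 1 => zW ^ 2 * polyPartDeriv τ k + polyPart τ k

theorem dzW_polyPart (τ : TimeSeries) (k : ℕ) :
    dzW (polyPart τ k) = 2 * (zW * polyPartDeriv τ k) := by
  induction k with
  | zero => rw [polyPart, polyPartDeriv, dzW_toWave]; ring
  | succ k ih =>
    rw [polyPart, polyPartDeriv, map_add, dzW_toWave, dzW_mul, ih, pow_two, dzW_mul, dzW_zW]
    ring

theorem dzW_two_mul (f : WaveRing) : dzW (2 * f) = 2 * dzW f := by
  rw [two_mul, map_add, two_mul]

theorem two_mul_flow_dx_psi {τ : TimeSeries} (hτ₀ : MvPowerSeries.constantCoeff τ ≠ 0)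
    (hτ : IsTauFunction τ) (k : ℕ) :
    2 * flow k (dx (psi τ)) = dx (polyPart τ k) * dx (psi τ) +
      (2 * (zW ^ 2 - 2 * toWave (potential τ)) * polyPart τ k - dx (dx (polyPart τ k))) * psi τ := by
  have h := congrArg dx (two_mul_flow_psi hτ₀ hτ k)
  rw [dx_two_mul, dx_sub, dx_mul _ (dx (psi τ)), dx_two_mul, dx_mul (dx _), dx_dx_psi hτ₀ hτ] at h
  rw [flow_dx]
  linear_combination h

theorem two_mul_flow_psiStar {τ : TimeSeries} (hτ₀ : MvPowerSeries.constantCoeff τ ≠ 0)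
    (hτ : IsTauFunction τ) (k : ℕ) :
    2 * flow k (psiStar τ) =
      2 * polyPart τ k * dx (psiStar τ) - dx (polyPart τ k) * psiStar τ := by
  have h := congrArg reflectW (two_mul_flow_psi hτ₀ hτ k)
  simpa only [map_sub, map_mul, reflectW_dx, reflectW_psi, reflectW_flow, map_ofNat,
    reflectW_polyPart] using h

theorem two_mul_flow_dx_psiStar {τ : TimeSeries} (hτ₀ : MvPowerSeries.constantCoeff τ ≠ 0)
    (hτ : IsTauFunction τ) (k : ℕ) :
    2 * flow k (dx (psiStar τ)) = dx (polyPart τ k) * dx (psiStar τ) +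
      (2 * (zW ^ 2 - 2 * toWave (potential τ)) * polyPart τ k - dx (dx (polyPart τ k))) *
        psiStar τ := by
  have h := congrArg reflectW (two_mul_flow_dx_psi hτ₀ hτ k)
  simpa only [map_sub, map_add, map_mul, map_pow, reflectW_dx, reflectW_psi, reflectW_flow,
    map_ofNat, reflectW_polyPart, reflectW_toWave, reflectW_zW, neg_zW_sq] using h

theorem flow_phase (k : ℕ) : flow k phase = zW ^ (2 * k + 1) := by
  rw [flow_apply, pderiv_phase, nsmul_eq_mul, ← map_natCast MvPowerSeries.C, ← map_mul,
    nsmul_phaseCoeff, map_pow, zW]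

theorem dzW_zW_pow (k : ℕ) : dzW (zW ^ (k + 1)) = ((k + 1 : ℕ) : WaveRing) * zW ^ k := by
  induction k with
  | zero => simp [dzW_zW]
  | succ k ih =>
    rw [pow_succ, dzW_mul, ih, dzW_zW]
    push_cast
    ring

/-- The flows of the one-point function, in terms of the resolvent. -/
theorem two_mul_flow_nablaLog {τ : TimeSeries} (hτ₀ : MvPowerSeries.constantCoeff τ ≠ 0)
    (hτ : IsTauFunction τ) (k : ℕ) :
    2 * flow k (nablaLog τ) =
      (2 * (zW ^ 2 - 2 * toWave (potential τ)) * polyPartDeriv τ k + 2 * polyPart τ k -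
        dx (dx (polyPartDeriv τ k))) * resolvent τ +
      dx (polyPartDeriv τ k) * dx (resolvent τ) - 2 * polyPartDeriv τ k * resolventX τ -
      2 * ((2 * k + 1 : ℕ) : WaveRing) * zW ^ (2 * k) := by
  have hF := congrArg (flow k) (hτ.fay_psi hτ₀)
  have hz : ∀ f : WaveRing, flow k (2 * zW * f) = 2 * zW * flow k f := by
    intro f
    rw [mul_assoc, flow_two_mul, flow_mul, flow_zW, zero_mul, zero_add, mul_assoc]
  rw [map_sub, flow_mul, flow_mul, map_sub, map_sub, hz, hz, ← dzW_flow, ← dzW_flow, ← dzW_flow,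
    flow_phase, dzW_zW_pow, ← map_one MvPowerSeries.C, flow_C] at hF
  have h1 := two_mul_flow_psi hτ₀ hτ k
  have h2 := two_mul_flow_dx_psi hτ₀ hτ k
  have h3 := congrArg dzW (two_mul_flow_psiStar hτ₀ hτ k)
  have h4 := congrArg dzW (two_mul_flow_dx_psiStar hτ₀ hτ k)
  set b := polyPart τ k with hb
  set β := polyPartDeriv τ k with hβ
  have hbz : dzW b = 2 * (zW * β) := dzW_polyPart τ k
  have hbxz : dzW (dx b) = 2 * (zW * dx β) := by
    rw [dzW_dx, hbz, dx_two_mul, dx_mul, dx_zW, zero_mul, zero_add]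
  have hbxxz : dzW (dx (dx b)) = 2 * (zW * dx (dx β)) := by
    rw [dzW_dx, hbxz, dx_two_mul, dx_mul, dx_zW, zero_mul, zero_add]
  have hu : dzW (2 * (zW ^ 2 - 2 * toWave (potential τ))) = 4 * zW := by
    rw [dzW_two_mul, map_sub, dzW_two_mul, dzW_toWave, pow_two, dzW_mul, dzW_zW]
    ring
  rw [dzW_two_mul, map_sub, dzW_mul, dzW_two_mul, dzW_mul, hbz, hbxz] at h3
  rw [dzW_two_mul, map_add, dzW_mul, dzW_mul, hbxz, map_sub, dzW_mul, hu, hbz, hbxxz] at h4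
  refine mul_left_cancel_two_zW ?_
  rw [dx_resolvent, resolvent, resolventX]
  linear_combination 2 * hF - dx (psi τ) * h3 - dzW (psiStar τ) * h2 + psi τ * h4 +
    dzW (dx (psiStar τ)) * h1

theorem resolventCoeff_zero {τ : TimeSeries} (hτ₀ : MvPowerSeries.constantCoeff τ ≠ 0) :
    resolventCoeff τ 0 = 1 := by
  have := cf_zero_resolvent hτ₀
  simpa [resolventCoeff] using this

theorem polyPart_zero {τ : TimeSeries} (hτ₀ : MvPowerSeries.constantCoeff τ ≠ 0) :
    polyPart τ 0 = 1 := by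
  rw [polyPart, resolventCoeff_zero hτ₀, map_one]

theorem dx_one : dx 1 = 0 := by
  rw [dx, ← map_one MvPowerSeries.C, MvPowerSeries.pderiv_C]

theorem dx_zero : dx 0 = 0 := map_zero _

theorem flow_zero_nablaLog {τ : TimeSeries} (hτ₀ : MvPowerSeries.constantCoeff τ ≠ 0)
    (hτ : IsTauFunction τ) : flow 0 (nablaLog τ) = resolvent τ - 1 := by
  have h := two_mul_flow_nablaLog hτ₀ hτ 0
  rw [polyPart_zero hτ₀, polyPartDeriv, dx_zero, dx_zero] at h
  refine two_mul_left_cancel ?_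
  rw [h]
  simp
  ring

theorem two_mul_flow_one_nablaLog {τ : TimeSeries} (hτ₀ : MvPowerSeries.constantCoeff τ ≠ 0)
    (hτ : IsTauFunction τ) : 2 * flow 1 (nablaLog τ) =
      (4 * zW ^ 2 - 4 * toWave (potential τ) + 2 * toWave (resolventCoeff τ 1)) * resolvent τ -
        2 * resolventX τ - 6 * zW ^ 2 := by
  have h := two_mul_flow_nablaLog hτ₀ hτ 1
  rw [polyPart, polyPartDeriv, polyPart_zero hτ₀, polyPartDeriv, mul_zero, zero_add, dx_one,
    dx_zero] at h
  rw [h]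
  push_cast
  ring

/-- A recursion without polynomial parts: with `β_k = polyPartDeriv τ k`, the combination
`β_{k+2} - 2 z ^ 2 β_{k+1} + z ^ 4 β_k` is a single coefficient of the resolvent. -/
theorem two_mul_flow_nablaLog_rec {τ : TimeSeries} (hτ₀ : MvPowerSeries.constantCoeff τ ≠ 0)
    (hτ : IsTauFunction τ) (k : ℕ) :
    2 * (flow (k + 2) (nablaLog τ) - 2 * zW ^ 2 * flow (k + 1) (nablaLog τ) +
      zW ^ 4 * flow k (nablaLog τ)) =
    (2 * toWave (resolventCoeff τ (k + 2)) -
      4 * toWave (potential τ) * toWave (resolventCoeff τ (k + 1)) -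
      dx (dx (toWave (resolventCoeff τ (k + 1))))) * resolvent τ +
    dx (toWave (resolventCoeff τ (k + 1))) * dx (resolvent τ) -
    2 * toWave (resolventCoeff τ (k + 1)) * resolventX τ := by
  have h0 := two_mul_flow_nablaLog hτ₀ hτ k
  have h1 := two_mul_flow_nablaLog hτ₀ hτ (k + 1)
  have h2 := two_mul_flow_nablaLog hτ₀ hτ (k + 2)
  simp only [polyPart, polyPartDeriv, dx_add, dx_zW_sq_mul] at h1 h2
  push_cast at h0 h1 h2
  linear_combination h2 - 2 * zW ^ 2 * h1 + zW ^ 4 * h0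

/-! ### Several spectral variables -/

/-- Formal power series in the times whose coefficients are power series in the variables
`z_i⁻¹`. -/
abbrev MultiRing (n : ℕ) : Type := MvPowerSeries ℕ (MvPowerSeries (Fin n) ℂ)

section SpectralSum

variable {n : ℕ} (i : Fin n)

/-- The map underlying `coeffSum`. -/
def coeffSumFun (e : ℕ → MvPowerSeries (Fin n) ℂ) : MvPowerSeries (Fin n) ℂ := fun ε =>
  ∑ k ∈ Finset.range (ε i + 1), MvPowerSeries.coeff ε (MvPowerSeries.X i ^ (2 * k) * e k)

theorem coeff_coeffSumFun (e : ℕ → MvPowerSeries (Fin n) ℂ) (ε : Fin n →₀ ℕ) :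
    MvPowerSeries.coeff ε (coeffSumFun i e) = ∑ k ∈ Finset.range (ε i + 1),
      MvPowerSeries.coeff ε (MvPowerSeries.X i ^ (2 * k) * e k) := rfl

/-- The sum `∑ k, z_i ^ (-2 k) e_k` of a sequence of power series in the `z_j⁻¹`. -/
def coeffSum : (ℕ → MvPowerSeries (Fin n) ℂ) →+ MvPowerSeries (Fin n) ℂ where
  toFun := coeffSumFun i
  map_zero' := by
    ext ε
    rw [coeff_coeffSumFun, map_zero]
    refine Finset.sum_eq_zero fun k _ => ?_
    rw [Pi.zero_apply, mul_zero, map_zero]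
  map_add' e e' := by
    ext ε
    rw [map_add, coeff_coeffSumFun, coeff_coeffSumFun, coeff_coeffSumFun,
      ← Finset.sum_add_distrib]
    refine Finset.sum_congr rfl fun k _ => ?_
    rw [Pi.add_apply, mul_add, map_add]

theorem coeff_X_pow_mul_eq_zero {ε : Fin n →₀ ℕ} {m : ℕ} (h : ε i < m)
    (a : MvPowerSeries (Fin n) ℂ) :
    MvPowerSeries.coeff ε (MvPowerSeries.X i ^ m * a) = 0 :=
  MvPowerSeries.X_pow_dvd_iff.mp (Dvd.intro a rfl) ε h

theorem coeff_coeffSum {ε : Fin n →₀ ℕ} {M : ℕ} (h : ε i < M)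
    (e : ℕ → MvPowerSeries (Fin n) ℂ) :
    MvPowerSeries.coeff ε (coeffSum i e) =
      ∑ k ∈ Finset.range M, MvPowerSeries.coeff ε (MvPowerSeries.X i ^ (2 * k) * e k) := by
  refine (coeff_coeffSumFun i e ε).trans (Finset.sum_subset (fun k hk => ?_) fun k _ hk => ?_)
  · have := Finset.mem_range.mp hk
    exact Finset.mem_range.mpr (by omega)
  · refine coeff_X_pow_mul_eq_zero i ?_ _
    have : ¬ k < ε i + 1 := fun h => hk (Finset.mem_range.mpr h)
    omega

theorem coeffSum_mul (e : ℕ → MvPowerSeries (Fin n) ℂ) (a : MvPowerSeries (Fin n) ℂ) :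
    coeffSum i (fun k => e k * a) = coeffSum i e * a := by
  classical
  ext ε
  rw [coeff_coeffSum i (Nat.lt_succ_self _), MvPowerSeries.coeff_mul]
  have h : ∀ p ∈ Finset.HasAntidiagonal.antidiagonal ε,
      MvPowerSeries.coeff p.1 (coeffSum i e) * MvPowerSeries.coeff p.2 a =
      ∑ k ∈ Finset.range (ε i).succ,
        MvPowerSeries.coeff p.1 (MvPowerSeries.X i ^ (2 * k) * e k) *
          MvPowerSeries.coeff p.2 a := by
    intro p hp
    have hp' := DFunLike.congr_fun (Finset.HasAntidiagonal.mem_antidiagonal.mp hp) i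
    rw [Finsupp.add_apply] at hp'
    rw [coeff_coeffSum i (M := (ε i).succ) (by omega), Finset.sum_mul]
  rw [Finset.sum_congr rfl h, Finset.sum_comm]
  refine Finset.sum_congr rfl fun k _ => ?_
  rw [← mul_assoc, MvPowerSeries.coeff_mul]

theorem coeffSum_rec (e : ℕ → MvPowerSeries (Fin n) ℂ) :
    coeffSum i e = e 0 + MvPowerSeries.X i ^ 2 * coeffSum i fun k => e (k + 1) := by
  ext ε
  rw [mul_comm, ← coeffSum_mul, map_add, coeff_coeffSum i (M := ε i + 1 + 1) (by omega),
    coeff_coeffSum i (M := ε i + 1) (by omega), Finset.sum_range_succ', add_comm]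
  congr 1
  · simp
  · refine Finset.sum_congr rfl fun k _ => ?_
    congr 1
    ring

/-- The sum `∑ k, z_i ^ (-2 k) e_k` of a sequence of series in the times. -/
def spectralSum : (ℕ → MultiRing n) →+ MultiRing n where
  toFun e := fun d => coeffSum i fun k => MvPowerSeries.coeff d (e k)
  map_zero' := by
    funext d
    change coeffSum i (fun k => MvPowerSeries.coeff d 0) = 0
    simp only [map_zero]
    exact map_zero (coeffSum i)
  map_add' e e' := by
    funext d
    change coeffSum i (fun k => MvPowerSeries.coeff d (e k + e' k)) =
      coeffSum i (fun k => MvPowerSeries.coeff d (e k)) +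
        coeffSum i (fun k => MvPowerSeries.coeff d (e' k))
    rw [← map_add (coeffSum i)]
    congr 1

theorem coeff_spectralSum (e : ℕ → MultiRing n) (d : ℕ →₀ ℕ) :
    MvPowerSeries.coeff d (spectralSum i e) =
      coeffSum i fun k => MvPowerSeries.coeff d (e k) := rfl

theorem spectralSum_mul (e : ℕ → MultiRing n) (f : MultiRing n) :
    spectralSum i (fun k => e k * f) = spectralSum i e * f := by
  classical
  ext1 d
  rw [coeff_spectralSum, MvPowerSeries.coeff_mul]
  simp only [MvPowerSeries.coeff_mul, coeff_spectralSum, ← coeffSum_mul]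
  rw [← map_sum]
  congr 1
  funext k
  rw [Finset.sum_apply]

theorem spectralSum_mul_left (e : ℕ → MultiRing n) (f : MultiRing n) :
    spectralSum i (fun k => f * e k) = f * spectralSum i e := by
  rw [mul_comm f, ← spectralSum_mul]
  congr 1
  funext k
  exact mul_comm _ _

/-- The variable `z_i⁻¹`. -/
def invZ : MultiRing n := MvPowerSeries.C (MvPowerSeries.X i)

theorem spectralSum_rec (e : ℕ → MultiRing n) :
    spectralSum i e = e 0 + invZ i ^ 2 * spectralSum i fun k => e (k + 1) := by
  ext1 d
  rw [map_add, invZ, ← map_pow, MvPowerSeries.coeff_C_mul, coeff_spectralSum, coeff_spectralSum,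
    coeffSum_rec]

theorem spectralSum_pderiv (j : ℕ) (e : ℕ → MultiRing n) :
    spectralSum i (fun k => MvPowerSeries.pderiv _ j (e k)) =
      MvPowerSeries.pderiv _ j (spectralSum i e) := by
  ext1 d
  rw [coeff_spectralSum, MvPowerSeries.coeff_pderiv, coeff_spectralSum, ← coeffSum_mul]
  congr 1

theorem eq_zero_of_forall_invZ_pow_dvd {f : MultiRing n} (h : ∀ m, invZ i ^ m ∣ f) : f = 0 := by
  ext d ε
  obtain ⟨q, hq⟩ := h (ε i + 1)
  rw [hq, invZ, ← map_pow, MvPowerSeries.coeff_C_mul,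
    coeff_X_pow_mul_eq_zero i (Nat.lt_succ_self _), map_zero, map_zero]

/-- The recursion of `spectralSum_rec` determines the sum. -/
theorem eq_spectralSum_of_rec {α : Type} {Φ : (ℕ → α) → MultiRing n} {c : α → MultiRing n}
    (h : ∀ s, Φ s = c (s 0) + invZ i ^ 2 * Φ fun k => s (k + 1)) (s : ℕ → α) :
    Φ s = spectralSum i fun k => c (s k) := by
  have key : ∀ (m : ℕ) (s : ℕ → α), invZ i ^ m ∣ Φ s - spectralSum i fun k => c (s k) := by
    intro m
    induction m with
    | zero => intro s; rw [pow_zero]; exact one_dvd _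
    | succ m ih =>
      intro s
      obtain ⟨q, hq⟩ := ih fun k => s (k + 1)
      rw [h, spectralSum_rec]
      refine ⟨invZ i * q, ?_⟩
      linear_combination invZ i ^ 2 * hq
  exact sub_eq_zero.mp (eq_zero_of_forall_invZ_pow_dvd i fun m => key m s)

/-- The loop operator `∇_i = ∑ k, (2 k + 1)!! z_i ^ (-2 k - 2) ∂/∂t_k`. -/
def nabla : MultiRing n →+ MultiRing n where
  toFun f := invZ i ^ 2 * spectralSum i fun k => flow k f
  map_zero' := by
    have : (fun k => flow k (0 : MultiRing n)) = 0 := by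
      funext k
      rw [map_zero, Pi.zero_apply]
    rw [this, map_zero, mul_zero]
  map_add' f g := by
    have : (fun k => flow k (f + g)) = (fun k => flow k f) + fun k => flow k g := by
      funext k
      rw [map_add, Pi.add_apply]
    rw [this, map_add, mul_add]

theorem nabla_apply (f : MultiRing n) :
    nabla i f = invZ i ^ 2 * spectralSum i fun k => flow k f := rfl

theorem nabla_mul (f g : MultiRing n) : nabla i (f * g) = nabla i f * g + f * nabla i g := by
  have : (fun k => flow k (f * g)) = (fun k => flow k f * g) + fun k => f * flow k g := by
    funext k
    rw [flow_mul, Pi.add_apply]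
  rw [nabla_apply, this, map_add, spectralSum_mul, spectralSum_mul_left, nabla_apply, nabla_apply]
  ring

theorem nabla_C (a : MvPowerSeries (Fin n) ℂ) : nabla i (MvPowerSeries.C a) = 0 := by
  have : (fun k => flow k (MvPowerSeries.C a : MultiRing n)) = 0 := by
    funext k
    rw [flow_C, Pi.zero_apply]
  rw [nabla_apply, this, map_zero, mul_zero]

theorem nabla_C_mul (a : MvPowerSeries (Fin n) ℂ) (f : MultiRing n) :
    nabla i (MvPowerSeries.C a * f) = MvPowerSeries.C a * nabla i f := by
  rw [nabla_mul, nabla_C, zero_mul, zero_add]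

theorem nabla_pderiv (j : ℕ) (f : MultiRing n) :
    nabla i (MvPowerSeries.pderiv _ j f) = MvPowerSeries.pderiv _ j (nabla i f) := by
  rw [nabla_apply, nabla_apply, invZ, ← map_pow, pderiv_C_mul, ← spectralSum_pderiv]
  congr 2
  funext k
  exact flow_pderiv _ _ _

end SpectralSum

/-- A series in the times, regarded as not depending on the spectral variables. -/
def embed {n : ℕ} : TimeSeries →+* MultiRing n := MvPowerSeries.map MvPowerSeries.C

/-- The substitution `v ↦ z_i⁻¹`. -/
def evalAt {n : ℕ} (i : Fin n) : PowerSeries TimeSeries →+* MultiRing n :=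
  (MvPowerSeries.map (PowerSeries.toMvPowerSeries (R := ℂ) i).toRingHom).comp collect

theorem evalAt_C {n : ℕ} (i : Fin n) (t : TimeSeries) : evalAt i (PowerSeries.C t) = embed t := by
  ext1 d
  have h : MvPowerSeries.coeff d (collect (PowerSeries.C t)) =
      PowerSeries.C (MvPowerSeries.coeff d t) := by
    ext m
    rw [coeff_coeff_collect, PowerSeries.coeff_C, PowerSeries.coeff_C]
    split_ifs
    · rfl
    · exact map_zero _
  rw [evalAt, RingHom.comp_apply, MvPowerSeries.coeff_map, h, embed, MvPowerSeries.coeff_map]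
  change PowerSeries.toMvPowerSeries i (PowerSeries.C _) = _
  rw [PowerSeries.toMvPowerSeries_C]

theorem evalAt_X {n : ℕ} (i : Fin n) : evalAt i PowerSeries.X = invZ i := by
  classical
  have h : collect PowerSeries.X = MvPowerSeries.C PowerSeries.X := by
    ext d m
    rw [coeff_coeff_collect, PowerSeries.coeff_X, MvPowerSeries.coeff_C]
    by_cases hm : m = 1 <;> by_cases hd : d = 0 <;>
      simp [hm, hd, MvPowerSeries.coeff_one, PowerSeries.coeff_X]
  rw [evalAt, RingHom.comp_apply, h, MvPowerSeries.map_C, invZ]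
  congr 1
  change PowerSeries.toMvPowerSeries i PowerSeries.X = _
  rw [PowerSeries.toMvPowerSeries_X]

/-- The even power series `∑ k, s_k v ^ (2 k)`. -/
def evenSeries (s : ℕ → TimeSeries) : PowerSeries TimeSeries :=
  PowerSeries.mk fun m => if m = 2 * (m / 2) then s (m / 2) else 0

theorem coeff_evenSeries (s : ℕ → TimeSeries) (m : ℕ) :
    PowerSeries.coeff m (evenSeries s) = if m = 2 * (m / 2) then s (m / 2) else 0 :=
  PowerSeries.coeff_mk _ _

theorem evenSeries_rec (s : ℕ → TimeSeries) :
    evenSeries s = PowerSeries.C (s 0) + PowerSeries.X ^ 2 * evenSeries fun k => s (k + 1) := by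
  ext1 m
  rw [map_add, PowerSeries.coeff_X_pow_mul', PowerSeries.coeff_C, coeff_evenSeries]
  match m with
  | 0 => simp
  | 1 => simp
  | m + 2 =>
    have e1 : (m + 2) / 2 = m / 2 + 1 := by omega
    rw [if_pos (show 2 ≤ m + 2 by omega), if_neg (show ¬ m + 2 = 0 by omega), zero_add,
      Nat.add_sub_cancel, coeff_evenSeries, e1]
    simp only [mul_add, mul_one, Nat.add_right_cancel_iff]

theorem evalAt_evenSeries {n : ℕ} (i : Fin n) (s : ℕ → TimeSeries) :
    evalAt i (evenSeries s) = spectralSum i fun k => embed (s k) := by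
  refine eq_spectralSum_of_rec i (Φ := fun s => evalAt i (evenSeries s)) (c := embed)
    (fun s => ?_) s
  rw [evenSeries_rec, map_add, map_mul, map_pow, evalAt_C, evalAt_X]

theorem embed_flow {n : ℕ} (k : ℕ) (t : TimeSeries) :
    (embed (flow k t) : MultiRing n) = flow k (embed t) := map_flow _ _ _

theorem embed_pderiv {n : ℕ} (k : ℕ) (t : TimeSeries) :
    (embed (MvPowerSeries.pderiv ℂ k t) : MultiRing n) =
      MvPowerSeries.pderiv _ k (embed t) := map_pderiv _ _ _

theorem nabla_embed {n : ℕ} (i : Fin n) (t : TimeSeries) :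
    nabla i (embed t) = evalAt i (PowerSeries.X ^ 2 * nablaV (PowerSeries.C t)) := by
  have h : nablaV (PowerSeries.C t) = evenSeries fun k => flow k t := by
    ext1 m
    rw [coeff_nablaV_C, coeff_evenSeries]
    rfl
  rw [h, map_mul, map_pow, evalAt_X, evalAt_evenSeries, nabla_apply]
  simp only [embed_flow]

/-! ### The field of fractions in the spectral variables -/

/-- Formal power series in the times with coefficients in the field of fractions. -/
abbrev FractionSeries (n : ℕ) : Type := MvPowerSeries ℕ (SpectralField n)

/-- The inclusion of the series with integral coefficients. -/
def toFraction {n : ℕ} : MultiRing n →+* FractionSeries n :=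
  MvPowerSeries.map (algebraMap (MvPowerSeries (Fin n) ℂ) (SpectralField n))

theorem toFraction_injective {n : ℕ} : Function.Injective (toFraction (n := n)) := by
  intro f g h
  ext1 d
  have := congrArg (MvPowerSeries.coeff d) h
  rw [toFraction, MvPowerSeries.coeff_map, MvPowerSeries.coeff_map] at this
  exact IsFractionRing.injective (MvPowerSeries (Fin n) ℂ) (SpectralField n) this

/-- The substitution `z ↦ z_i`. -/
def specializeW {n : ℕ} (i : Fin n) : WaveRing →+* FractionSeries n :=
  MvPowerSeries.map (specialize i)

theorem specializeW_flow {n : ℕ} (i : Fin n) (k : ℕ) (f : WaveRing) :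
    specializeW i (flow k f) = flow k (specializeW i f) :=
  map_flow _ _ _

theorem toFraction_flow {n : ℕ} (k : ℕ) (f : MultiRing n) :
    toFraction (flow k f) = flow k (toFraction f) :=
  map_flow _ _ _

theorem specialize_ofPowerSeries {n : ℕ} (i : Fin n) (p : PowerSeries ℂ) :
    specialize i (HahnSeries.ofPowerSeries ℤ ℂ p) =
      algebraMap (MvPowerSeries (Fin n) ℂ) (SpectralField n) (p.toMvPowerSeries i) := by
  have h : HahnSeries.ofPowerSeries ℤ ℂ p = algebraMap (PowerSeries ℂ) AtInfinity p := rfl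
  rw [h, specialize, IsFractionRing.lift_algebraMap]
  rfl

theorem specializeW_ofPower {n : ℕ} (i : Fin n) (p : PowerSeries TimeSeries) :
    specializeW i (ofPower p) = toFraction (evalAt i p) := by
  ext1 d
  rw [specializeW, ofPower, RingHom.comp_apply, MvPowerSeries.coeff_map, MvPowerSeries.coeff_map,
    toFraction, evalAt, RingHom.comp_apply, MvPowerSeries.coeff_map, MvPowerSeries.coeff_map,
    specialize_ofPowerSeries]
  rfl

theorem specializeW_toWave {n : ℕ} (i : Fin n) (t : TimeSeries) :
    specializeW i (toWave t) = toFraction (embed t) := by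
  rw [← ofPower_C, specializeW_ofPower, evalAt_C]

theorem specializeW_zW {n : ℕ} (i : Fin n) : specializeW i zW = MvPowerSeries.C (zAt i) := by
  rw [specializeW, zW, MvPowerSeries.map_C, specialize_z]

theorem toFraction_invZ {n : ℕ} (i : Fin n) :
    toFraction (invZ i) = MvPowerSeries.C (zAt i)⁻¹ := by
  rw [toFraction, invZ, MvPowerSeries.map_C, zAt, inv_inv]

theorem zAt_ne_zero {n : ℕ} (i : Fin n) : zAt i ≠ 0 := by
  rw [zAt]
  refine inv_ne_zero fun h => ?_
  have h' : (MvPowerSeries.X i : MvPowerSeries (Fin n) ℂ) = 0 :=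
    IsFractionRing.injective (MvPowerSeries (Fin n) ℂ) (SpectralField n) (h.trans (map_zero _).symm)
  have := congrArg (MvPowerSeries.coeff (Finsupp.single i 1)) h'
  rw [MvPowerSeries.coeff_X, if_pos rfl, map_zero] at this
  exact one_ne_zero this

theorem zAt_sq_injective {n : ℕ} : Function.Injective fun i : Fin n => zAt i ^ 2 := by
  intro i j h
  by_contra hij
  have h2 : (zAt i ^ 2)⁻¹ = (zAt j ^ 2)⁻¹ := congrArg _ h
  rw [zAt, zAt, inv_pow, inv_pow, inv_inv, inv_inv, ← map_pow, ← map_pow] at h2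
  have h' := IsFractionRing.injective (MvPowerSeries (Fin n) ℂ) (SpectralField n) h2
  have := congrArg (MvPowerSeries.coeff (Finsupp.single i 2)) h'
  classical
  rw [MvPowerSeries.coeff_X_pow, MvPowerSeries.coeff_X_pow, if_pos rfl, if_neg] at this
  · exact one_ne_zero this
  · intro he
    have := DFunLike.congr_fun he i
    rw [Finsupp.single_eq_same, Finsupp.single_eq_of_ne hij] at this
    omega

/-! ### The loop operators on the resolvents -/

section LoopEquations

variable {n : ℕ} (τ : TimeSeries)

/-- The resolvent in the variable `z_i`. -/
def resolventAt (i : Fin n) : MultiRing n := spectralSum i fun k => embed (resolventCoeff τ k)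

/-- The derivative with respect to `x = t₀`. -/
def dX {A : Type} [CommRing A] (f : MvPowerSeries ℕ A) : MvPowerSeries ℕ A :=
  MvPowerSeries.pderiv A 0 f

/-- The resolvent is even in `z`. -/
theorem resolvent_eq_ofPower : resolvent τ = ofPower (evenSeries (resolventCoeff τ)) := by
  refine cf_ext fun m => ?_
  rcases lt_or_ge m 0 with hm | hm
  · rw [cf_ofPower_of_neg hm, resolvent_mem_bounded τ m hm]
  · lift m to ℕ using hm
    rw [cf_natCast_ofPower, coeff_evenSeries]
    split_ifs with h
    · have hm : (m : ℤ) = 2 * ((m / 2 : ℕ) : ℤ) := by omega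
      rw [resolventCoeff, ← hm]
    · obtain ⟨k, hk⟩ : ∃ k : ℤ, (m : ℤ) = 2 * k + 1 := ⟨(m / 2 : ℕ), by omega⟩
      rw [hk]
      exact cf_odd_eq_zero_of_even (reflectW_resolvent τ) k

theorem specializeW_resolvent (i : Fin n) :
    specializeW i (resolvent τ) = toFraction (resolventAt τ i) := by
  rw [resolvent_eq_ofPower, specializeW_ofPower, evalAt_evenSeries, resolventAt]

/-- The one-point function in the variable `z_i`. -/
def onePoint (i : Fin n) : MultiRing n := nabla i (embed (logSeries τ))

theorem specializeW_nablaLog (i : Fin n) :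
    specializeW i (nablaLog τ) = toFraction (onePoint τ i) := by
  rw [nablaLog, specializeW_ofPower, onePoint, nabla_embed]

theorem specializeW_dx (i : Fin n) (f : WaveRing) : specializeW i (dx f) = dX (specializeW i f) :=
  map_pderiv _ _ _

theorem toFraction_dX (f : MultiRing n) : toFraction (dX f) = dX (toFraction f) :=
  map_pderiv _ _ _

theorem C_zAt_mul_toFraction_invZ (i : Fin n) :
    MvPowerSeries.C (zAt i) * toFraction (invZ i) = 1 := by
  rw [toFraction_invZ, ← map_mul, mul_inv_cancel₀ (zAt_ne_zero i), map_one]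

theorem resolventAt_rec {τ : TimeSeries} (hτ₀ : MvPowerSeries.constantCoeff τ ≠ 0) (i : Fin n) :
    resolventAt τ i = 1 +
      invZ i ^ 2 * spectralSum i fun k => embed (resolventCoeff τ (k + 1)) := by
  rw [resolventAt, spectralSum_rec, resolventCoeff_zero hτ₀, map_one]

theorem spectralSum_dX (i : Fin n) (e : ℕ → MultiRing n) :
    spectralSum i (fun k => dX (e k)) = dX (spectralSum i e) := spectralSum_pderiv i 0 e

theorem dX_mul {A : Type} [CommRing A] (f g : MvPowerSeries ℕ A) :
    dX (f * g) = dX f * g + f * dX g := pderiv_mul _ _ _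

theorem dX_add {A : Type} [CommRing A] (f g : MvPowerSeries ℕ A) : dX (f + g) = dX f + dX g :=
  map_add _ _ _

theorem dX_sub {A : Type} [CommRing A] (f g : MvPowerSeries ℕ A) : dX (f - g) = dX f - dX g :=
  map_sub _ _ _

theorem dX_C {A : Type} [CommRing A] (a : A) : dX (MvPowerSeries.C a : MvPowerSeries ℕ A) = 0 :=
  MvPowerSeries.pderiv_C

theorem dX_one {A : Type} [CommRing A] : dX (1 : MvPowerSeries ℕ A) = 0 := by
  rw [← map_one MvPowerSeries.C, dX_C]

theorem dX_C_mul {A : Type} [CommRing A] (a : A) (f : MvPowerSeries ℕ A) :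
    dX (MvPowerSeries.C a * f) = MvPowerSeries.C a * dX f := by
  rw [dX_mul, dX_C, zero_mul, zero_add]

theorem dX_invZ_sq_mul (i : Fin n) (f : MultiRing n) :
    dX (invZ i ^ 2 * f) = invZ i ^ 2 * dX f := by
  rw [invZ, ← map_pow, dX_C_mul]

/-- The recursion between consecutive flows of the resolvent. -/
theorem flow_succ_resolvent {τ : TimeSeries} (hτ₀ : MvPowerSeries.constantCoeff τ ≠ 0)
    (hτ : IsTauFunction τ) (k : ℕ) :
    flow (k + 1) (resolvent τ) = zW ^ 2 * flow k (resolvent τ) +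
      toWave (resolventCoeff τ (k + 1)) * dx (resolvent τ) -
      dx (toWave (resolventCoeff τ (k + 1))) * resolvent τ := by
  rw [flow_resolvent hτ₀ hτ, flow_resolvent hτ₀ hτ, polyPart, dx_add, dx_zW_sq_mul]
  ring

theorem invZ_sq_mul_flow_succ_resolventAt {τ : TimeSeries}
    (hτ₀ : MvPowerSeries.constantCoeff τ ≠ 0) (hτ : IsTauFunction τ) (j : Fin n) (k : ℕ) :
    invZ j ^ 2 * flow (k + 1) (resolventAt τ j) = flow k (resolventAt τ j) +
      invZ j ^ 2 * (embed (resolventCoeff τ (k + 1)) * dX (resolventAt τ j) -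
        dX (embed (resolventCoeff τ (k + 1))) * resolventAt τ j) := by
  apply toFraction_injective
  have h := congrArg (specializeW j) (flow_succ_resolvent hτ₀ hτ k)
  simp only [map_add, map_sub, map_mul, map_pow, specializeW_flow, specializeW_dx,
    specializeW_resolvent, specializeW_toWave, specializeW_zW] at h
  simp only [map_add, map_sub, map_mul, map_pow, toFraction_flow, toFraction_dX]
  have hz := C_zAt_mul_toFraction_invZ j
  linear_combination toFraction (invZ j) ^ 2 * h + flow k (toFraction (resolventAt τ j)) *
    (MvPowerSeries.C (zAt j) * toFraction (invZ j) + 1) * hz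

/-- The action of the loop operator on the resolvent: the recursion for the flows, summed over `k`
with weights `z_i ^ (-2 k)`. -/
theorem nabla_resolventAt {τ : TimeSeries} (hτ₀ : MvPowerSeries.constantCoeff τ ≠ 0)
    (hτ : IsTauFunction τ) (i j : Fin n) :
    (invZ j ^ 2 - invZ i ^ 2) * nabla i (resolventAt τ j) =
      invZ i ^ 2 * invZ j ^ 2 * (resolventAt τ i * dX (resolventAt τ j) -
        dX (resolventAt τ i) * resolventAt τ j) := by
  set S := spectralSum i fun k => flow k (resolventAt τ j) with hS
  set S' := spectralSum i fun k => flow (k + 1) (resolventAt τ j) with hS'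
  set r := spectralSum i fun k => (embed (resolventCoeff τ (k + 1)) : MultiRing n) with hr
  have h1 : S = dX (resolventAt τ j) + invZ i ^ 2 * S' := by
    rw [hS, spectralSum_rec, flow_zero_apply]; rfl
  have h2 : invZ j ^ 2 * S' = S + invZ j ^ 2 * (r * dX (resolventAt τ j) -
      dX r * resolventAt τ j) := by
    rw [hS', ← spectralSum_mul_left]
    simp only [invZ_sq_mul_flow_succ_resolventAt hτ₀ hτ]
    rw [hr, ← spectralSum_dX, ← spectralSum_mul, ← spectralSum_mul, ← map_sub,
      ← spectralSum_mul_left, hS, ← map_add]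
    rfl
  have h3 := resolventAt_rec hτ₀ i
  have h4 : dX (resolventAt τ i) = invZ i ^ 2 * dX r := by
    rw [h3, dX_add, dX_one, zero_add, dX_invZ_sq_mul]
  rw [nabla_apply, h4]
  rw [← hr] at h3
  linear_combination invZ i ^ 2 * invZ j ^ 2 * h1 + invZ i ^ 4 * h2 -
    invZ i ^ 2 * invZ j ^ 2 * dX (resolventAt τ j) * h3

/-- The series `2 z_i ^ (-2) ψₓ ψ*ₓ`, in the variable `z_i`. -/
def resolventXAt (i : Fin n) : MultiRing n :=
  invZ i ^ 2 * dX (dX (resolventAt τ i)) -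
    2 * (1 - 2 * embed (potential τ) * invZ i ^ 2) * resolventAt τ i

theorem two_mul_resolventX {τ : TimeSeries} (hτ₀ : MvPowerSeries.constantCoeff τ ≠ 0)
    (hτ : IsTauFunction τ) :
    2 * resolventX τ = dx (dx (resolvent τ)) -
      2 * (zW ^ 2 - 2 * toWave (potential τ)) * resolvent τ := by
  rw [dx_dx_resolvent hτ₀ hτ]; ring

theorem toFraction_resolventXAt {τ : TimeSeries} (hτ₀ : MvPowerSeries.constantCoeff τ ≠ 0)
    (hτ : IsTauFunction τ) (i : Fin n) :
    toFraction (resolventXAt τ i) =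
      2 * (toFraction (invZ i) ^ 2 * specializeW i (resolventX τ)) := by
  have h := congrArg (specializeW i) (two_mul_resolventX hτ₀ hτ)
  simp only [map_sub, map_mul, map_pow, map_ofNat, specializeW_dx,
    specializeW_resolvent, specializeW_toWave, specializeW_zW] at h
  rw [resolventXAt]
  simp only [map_sub, map_mul, map_pow, map_ofNat, map_one, toFraction_dX]
  have hz := C_zAt_mul_toFraction_invZ i
  linear_combination (-toFraction (invZ i) ^ 2) * h + 2 * toFraction (resolventAt τ i) *
    (MvPowerSeries.C (zAt i) * toFraction (invZ i) + 1) * hz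

/-- The `x`-derivative of the one-point function. -/
theorem dX_onePoint {τ : TimeSeries} (hτ₀ : MvPowerSeries.constantCoeff τ ≠ 0)
    (hτ : IsTauFunction τ) (j : Fin n) : dX (onePoint τ j) = resolventAt τ j - 1 := by
  apply toFraction_injective
  have h := congrArg (specializeW j) (flow_zero_nablaLog hτ₀ hτ)
  rw [specializeW_flow, specializeW_nablaLog, map_sub, map_one, specializeW_resolvent,
    flow_zero_apply] at h
  rw [toFraction_dX, map_sub, map_one, ← h, dX]

theorem flow_one_onePoint {τ : TimeSeries} (hτ₀ : MvPowerSeries.constantCoeff τ ≠ 0)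
    (hτ : IsTauFunction τ) (j : Fin n) :
    2 * (invZ j ^ 2 * flow 1 (onePoint τ j)) =
      (4 - 4 * embed (potential τ) * invZ j ^ 2 + 2 * embed (resolventCoeff τ 1) * invZ j ^ 2) *
        resolventAt τ j - resolventXAt τ j - 6 := by
  apply toFraction_injective
  have h := congrArg (specializeW j) (two_mul_flow_one_nablaLog hτ₀ hτ)
  simp only [map_add, map_sub, map_mul, map_pow, map_ofNat, specializeW_flow,
    specializeW_resolvent, specializeW_toWave, specializeW_zW, specializeW_nablaLog] at h
  simp only [map_add, map_sub, map_mul, map_pow, map_ofNat, toFraction_flow,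
    toFraction_resolventXAt hτ₀ hτ]
  have hz := C_zAt_mul_toFraction_invZ j
  linear_combination toFraction (invZ j) ^ 2 * h + (4 * toFraction (resolventAt τ j) - 6) *
    (MvPowerSeries.C (zAt j) * toFraction (invZ j) + 1) * hz

theorem flow_onePoint_rec {τ : TimeSeries} (hτ₀ : MvPowerSeries.constantCoeff τ ≠ 0)
    (hτ : IsTauFunction τ) (j : Fin n) (k : ℕ) :
    2 * (invZ j ^ 4 * flow (k + 2) (onePoint τ j) - 2 * invZ j ^ 2 * flow (k + 1) (onePoint τ j) +
      flow k (onePoint τ j)) =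
    invZ j ^ 4 * resolventAt τ j * (2 * embed (resolventCoeff τ (k + 2)) -
      4 * embed (potential τ) * embed (resolventCoeff τ (k + 1)) -
      dX (dX (embed (resolventCoeff τ (k + 1))))) +
    invZ j ^ 4 * dX (resolventAt τ j) * dX (embed (resolventCoeff τ (k + 1))) -
    invZ j ^ 2 * resolventXAt τ j * embed (resolventCoeff τ (k + 1)) := by
  apply toFraction_injective
  have h := congrArg (specializeW j) (two_mul_flow_nablaLog_rec hτ₀ hτ k)
  simp only [map_add, map_sub, map_mul, map_pow, map_ofNat, specializeW_flow, specializeW_dx,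
    specializeW_resolvent, specializeW_toWave, specializeW_zW, specializeW_nablaLog] at h
  simp only [map_add, map_sub, map_mul, map_pow, map_ofNat, toFraction_flow, toFraction_dX,
    toFraction_resolventXAt hτ₀ hτ]
  have hz := C_zAt_mul_toFraction_invZ j
  set x := toFraction (invZ j)
  set w : FractionSeries n := MvPowerSeries.C (zAt j)
  have hz2 : w ^ 2 * x ^ 2 = 1 := by rw [← mul_pow, hz, one_pow]
  linear_combination x ^ 4 * h + (4 * x ^ 2 * flow (k + 1) (toFraction (onePoint τ j)) -
    2 * flow k (toFraction (onePoint τ j)) * (w ^ 2 * x ^ 2 + 1)) * hz2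

/-- The two-point function in terms of the resolvent: the recursion `flow_onePoint_rec`, summed
over `k` with weights `z_i ^ (-2 k)`. -/
theorem nabla_onePoint {τ : TimeSeries} (hτ₀ : MvPowerSeries.constantCoeff τ ≠ 0)
    (hτ : IsTauFunction τ) (i j : Fin n) :
    2 * ((invZ j ^ 2 - invZ i ^ 2) ^ 2 * nabla i (onePoint τ j)) =
      invZ i ^ 4 * invZ j ^ 4 * (dX (resolventAt τ i) * dX (resolventAt τ j)) -
      invZ i ^ 2 * invZ j ^ 4 * resolventXAt τ i * resolventAt τ j -
      invZ i ^ 4 * invZ j ^ 2 * resolventAt τ i * resolventXAt τ j -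
      2 * invZ i ^ 2 * invZ j ^ 2 * (invZ i ^ 2 + invZ j ^ 2) := by
  set S := spectralSum i fun k => flow k (onePoint τ j) with hS
  set S' := spectralSum i fun k => flow (k + 1) (onePoint τ j) with hS'
  set S'' := spectralSum i fun k => flow (k + 2) (onePoint τ j) with hS''
  set r := spectralSum i fun k => (embed (resolventCoeff τ (k + 1)) : MultiRing n) with hr
  set r' := spectralSum i fun k => (embed (resolventCoeff τ (k + 2)) : MultiRing n) with hr'
  have h1 : S = resolventAt τ j - 1 + invZ i ^ 2 * S' := by
    rw [hS, spectralSum_rec, flow_zero_apply]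
    exact congrArg (· + _) (dX_onePoint hτ₀ hτ j)
  have h2 : S' = flow 1 (onePoint τ j) + invZ i ^ 2 * S'' := by
    rw [hS', spectralSum_rec]
  have h3 : r = embed (resolventCoeff τ 1) + invZ i ^ 2 * r' := by
    rw [hr, spectralSum_rec]
  have h4 := flow_one_onePoint hτ₀ hτ j
  have h5 : 2 * (invZ j ^ 4 * S'' - 2 * invZ j ^ 2 * S' + S) =
      invZ j ^ 4 * resolventAt τ j * (2 * r' - 4 * embed (potential τ) * r - dX (dX r)) +
      invZ j ^ 4 * dX (resolventAt τ j) * dX r - invZ j ^ 2 * resolventXAt τ j * r := by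
    rw [hS, hS', hS'', hr, hr', ← spectralSum_dX, ← spectralSum_dX]
    simp only [← spectralSum_mul_left, ← map_add, ← map_sub]
    congr 1
    funext k
    exact flow_onePoint_rec hτ₀ hτ j k
  have h6 := resolventAt_rec hτ₀ i
  rw [← hr] at h6
  have h7 : dX (resolventAt τ i) = invZ i ^ 2 * dX r := by
    rw [h6, dX_add, dX_one, zero_add, dX_invZ_sq_mul]
  have h8 : dX (dX (resolventAt τ i)) = invZ i ^ 2 * dX (dX r) := by
    rw [h7, dX_invZ_sq_mul]
  rw [nabla_apply, ← hS]
  have h9 : resolventXAt τ i = invZ i ^ 4 * dX (dX r) -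
      2 * (1 - 2 * embed (potential τ) * invZ i ^ 2) * resolventAt τ i := by
    rw [resolventXAt, h8]; ring
  rw [h9, h7]
  have h1' : invZ i ^ 2 * S' = S - resolventAt τ j + 1 := by rw [h1]; ring
  have h2' : invZ i ^ 4 * S'' = invZ i ^ 2 * S' - invZ i ^ 2 * flow 1 (onePoint τ j) := by
    rw [h2]; ring
  have h3' : invZ i ^ 2 * r' = r - embed (resolventCoeff τ 1) := by rw [h3]; ring
  set x := invZ i
  set y := invZ j
  set Ri := resolventAt τ i
  set Rj := resolventAt τ j
  set Xj := resolventXAt τ j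
  set u : MultiRing n := embed (potential τ)
  linear_combination x ^ 6 * h5 - 2 * x ^ 2 * y ^ 4 * h2' + (4 * x ^ 4 * y ^ 2 - 2 * x ^ 2 * y ^ 4) * h1'
    + x ^ 4 * y ^ 2 * h4 + 2 * x ^ 4 * y ^ 4 * Rj * h3' +
    (x ^ 4 * y ^ 2 * Xj - 2 * x ^ 2 * y ^ 4 * Rj + 4 * x ^ 4 * y ^ 4 * u * Rj) * h6

end LoopEquations

/-! ### Loop operators over the field of fractions -/

section HasNabla

variable {n : ℕ} {i : Fin n}

/-- `HasNabla i g h` states that `∇_i g = h` for series with coefficients in the field of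
fractions: the series `g` and `h` become `g'` and `∇_i g'` with integral `g'` after multiplication
by a common denominator. -/
def HasNabla (i : Fin n) (g h : FractionSeries n) : Prop :=
  ∃ (c : MvPowerSeries (Fin n) ℂ) (g' : MultiRing n), c ≠ 0 ∧
    toFraction (MvPowerSeries.C c) * g = toFraction g' ∧
    toFraction (MvPowerSeries.C c) * h = toFraction (nabla i g')

theorem hasNabla_toFraction (i : Fin n) (g : MultiRing n) :
    HasNabla i (toFraction g) (toFraction (nabla i g)) := by
  refine ⟨1, g, one_ne_zero, ?_, ?_⟩ <;> rw [map_one, map_one, one_mul]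

theorem toFraction_C (c : MvPowerSeries (Fin n) ℂ) :
    toFraction (MvPowerSeries.C c) = MvPowerSeries.C (algebraMap _ (SpectralField n) c) :=
  MvPowerSeries.map_C _ _

theorem hasNabla_C (i : Fin n) (a : SpectralField n) : HasNabla i (MvPowerSeries.C a) 0 := by
  obtain ⟨x, y, hy, rfl⟩ := IsFractionRing.div_surjective (A := MvPowerSeries (Fin n) ℂ) a
  have hy0 := nonZeroDivisors.ne_zero hy
  have hy1 : algebraMap _ (SpectralField n) y ≠ 0 := fun h =>
    hy0 (IsFractionRing.injective (MvPowerSeries (Fin n) ℂ) (SpectralField n)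
      (h.trans (map_zero _).symm))
  refine ⟨y, MvPowerSeries.C x, hy0, ?_, ?_⟩
  · rw [toFraction_C, toFraction_C, ← map_mul, mul_div_cancel₀ _ hy1]
  · rw [nabla_C, mul_zero, map_zero]

theorem HasNabla.add {g h g₁ h₁ : FractionSeries n} (H : HasNabla i g h) (H₁ : HasNabla i g₁ h₁) :
    HasNabla i (g + g₁) (h + h₁) := by
  obtain ⟨c, f, hc, e, e'⟩ := H
  obtain ⟨c₁, f₁, hc₁, e₁, e₁'⟩ := H₁
  refine ⟨c * c₁, MvPowerSeries.C c₁ * f + MvPowerSeries.C c * f₁, mul_ne_zero hc hc₁, ?_, ?_⟩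
  · simp only [map_add, map_mul, ← e, ← e₁]; ring
  · rw [map_add (nabla i), nabla_C_mul, nabla_C_mul]
    simp only [map_add, map_mul, ← e', ← e₁']; ring

theorem HasNabla.mul {g h g₁ h₁ : FractionSeries n} (H : HasNabla i g h) (H₁ : HasNabla i g₁ h₁) :
    HasNabla i (g * g₁) (h * g₁ + g * h₁) := by
  obtain ⟨c, f, hc, e, e'⟩ := H
  obtain ⟨c₁, f₁, hc₁, e₁, e₁'⟩ := H₁
  refine ⟨c * c₁, f * f₁, mul_ne_zero hc hc₁, ?_, ?_⟩
  · simp only [map_mul, ← e, ← e₁]; ring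
  · rw [nabla_mul]
    simp only [map_add, map_mul, ← e', ← e₁', ← e, ← e₁]; ring

theorem HasNabla.C_mul {g h : FractionSeries n} (H : HasNabla i g h) (a : SpectralField n) :
    HasNabla i (MvPowerSeries.C a * g) (MvPowerSeries.C a * h) := by
  have := (hasNabla_C i a).mul H
  rwa [zero_mul, zero_add] at this

theorem HasNabla.neg {g h : FractionSeries n} (H : HasNabla i g h) : HasNabla i (-g) (-h) := by
  have := H.C_mul (-1)
  rwa [map_neg, map_one, neg_one_mul, neg_one_mul] at this

theorem HasNabla.sub {g h g₁ h₁ : FractionSeries n} (H : HasNabla i g h) (H₁ : HasNabla i g₁ h₁) :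
    HasNabla i (g - g₁) (h - h₁) := by
  rw [sub_eq_add_neg, sub_eq_add_neg]
  exact H.add H₁.neg

theorem HasNabla.sum {ι : Type} (s : Finset ι) {g h : ι → FractionSeries n}
    (H : ∀ a ∈ s, HasNabla i (g a) (h a)) :
    HasNabla i (∑ a ∈ s, g a) (∑ a ∈ s, h a) := by
  classical
  induction s using Finset.induction_on with
  | empty => simpa using hasNabla_C i 0
  | insert a s ha ih =>
    rw [Finset.sum_insert ha, Finset.sum_insert ha]
    exact (H a (Finset.mem_insert_self a s)).add
      (ih fun b hb => H b (Finset.mem_insert_of_mem hb))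

theorem HasNabla.dX {g h : FractionSeries n} (H : HasNabla i g h) :
    HasNabla i (KdV.dX g) (KdV.dX h) := by
  obtain ⟨c, f, hc, e, e'⟩ := H
  refine ⟨c, KdV.dX f, hc, ?_, ?_⟩
  · rw [toFraction_dX, ← e, toFraction_C, dX_C_mul]
  · have : nabla i (KdV.dX f) = KdV.dX (nabla i f) := nabla_pderiv i 0 f
    rw [this, toFraction_dX, ← e', toFraction_C, dX_C_mul]

theorem toFraction_C_mul_injective {c : MvPowerSeries (Fin n) ℂ} (hc : c ≠ 0)
    {f g : FractionSeries n} (h : toFraction (MvPowerSeries.C c) * f =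
      toFraction (MvPowerSeries.C c) * g) : f = g := by
  have hc1 : algebraMap _ (SpectralField n) c ≠ 0 := fun h =>
    hc (IsFractionRing.injective (MvPowerSeries (Fin n) ℂ) (SpectralField n)
      (h.trans (map_zero _).symm))
  have e : MvPowerSeries.C (algebraMap _ (SpectralField n) c)⁻¹ *
      toFraction (MvPowerSeries.C c) = 1 := by
    rw [toFraction_C, ← map_mul, inv_mul_cancel₀ hc1, map_one]
  linear_combination MvPowerSeries.C (algebraMap _ (SpectralField n) c)⁻¹ * h + (g - f) * e

/-- The derivative does not depend on the choice of a denominator. -/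
theorem HasNabla.unique {g h h₁ : FractionSeries n} (H : HasNabla i g h) (H₁ : HasNabla i g h₁) :
    h = h₁ := by
  obtain ⟨c, f, hc, e, e'⟩ := H
  obtain ⟨c₁, f₁, hc₁, e₁, e₁'⟩ := H₁
  have hf : MvPowerSeries.C c₁ * f = MvPowerSeries.C c * f₁ := by
    apply toFraction_injective
    rw [map_mul, map_mul, ← e, ← e₁]; ring
  have hn := congrArg (fun f => toFraction (nabla i f)) hf
  simp only [nabla_C_mul, map_mul, ← e', ← e₁'] at hn
  refine toFraction_C_mul_injective (mul_ne_zero hc hc₁) ?_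
  rw [map_mul, map_mul]
  linear_combination hn

/-- The entrywise version of `HasNabla`. -/
def HasMatrixNabla {m : Type} (i : Fin n) (G H : Matrix m m (FractionSeries n)) : Prop :=
  ∀ a b, HasNabla i (G a b) (H a b)

theorem HasMatrixNabla.mul {m : Type} [Fintype m] {G H G₁ H₁ : Matrix m m (FractionSeries n)}
    (h : HasMatrixNabla i G H) (h₁ : HasMatrixNabla i G₁ H₁) :
    HasMatrixNabla i (G * G₁) (H * G₁ + G * H₁) := by
  intro a b
  rw [Matrix.add_apply, Matrix.mul_apply, Matrix.mul_apply, Matrix.mul_apply,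
    ← Finset.sum_add_distrib]
  exact HasNabla.sum _ fun c _ => (h a c).mul (h₁ c b)

theorem HasMatrixNabla.trace {m : Type} [Fintype m] {G H : Matrix m m (FractionSeries n)}
    (h : HasMatrixNabla i G H) : HasNabla i G.trace H.trace :=
  HasNabla.sum _ fun a _ => h a a

theorem hasMatrixNabla_one {m : Type} [DecidableEq m] (i : Fin n) :
    HasMatrixNabla i (1 : Matrix m m (FractionSeries n)) 0 := by
  intro a b
  rw [Matrix.one_apply, Matrix.zero_apply]
  split_ifs
  · simpa using hasNabla_C i 1
  · simpa using hasNabla_C i 0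

end HasNabla

/-! ### The loop equation for `Θ` -/

section ThetaLoop

variable {n : ℕ} (τ : TimeSeries)

theorem dx_resolventX {τ : TimeSeries} (hτ₀ : MvPowerSeries.constantCoeff τ ≠ 0)
    (hτ : IsTauFunction τ) :
    dx (resolventX τ) = (zW ^ 2 - 2 * toWave (potential τ)) * dx (resolvent τ) := by
  rw [resolventX, dx_mul, dx_dx_psi hτ₀ hτ, dx_dx_psiStar hτ₀ hτ, dx_resolvent]; ring

instance : CharZero (SpectralField n) :=
  charZero_of_injective_algebraMap (algebraMap ℂ (SpectralField n)).injective

theorem half_mul_two : (MvPowerSeries.C (1 / 2 : SpectralField n) : FractionSeries n) * 2 = 1 := by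
  rw [← map_ofNat MvPowerSeries.C, ← map_mul, one_div, inv_mul_cancel₀ two_ne_zero, map_one]

/-- The loop operator acts on the potential by `∇_i u = ∂ₓ R(z_i)`. -/
theorem hasNabla_potential {τ : TimeSeries} (hτ₀ : MvPowerSeries.constantCoeff τ ≠ 0)
    (hτ : IsTauFunction τ) (i : Fin n) :
    HasNabla i (specializeW i (toWave (potential τ)))
      (dX (specializeW i (resolvent τ))) := by
  have h : nabla i (embed (potential τ)) = dX (resolventAt τ i) := by
    rw [potential, embed_pderiv, embed_pderiv, nabla_pderiv, nabla_pderiv]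
    have := congrArg dX (dX_onePoint hτ₀ hτ i)
    rw [dX_sub, dX_one, sub_zero] at this
    exact this
  rw [specializeW_toWave, specializeW_resolvent, ← toFraction_dX, ← h]
  exact hasNabla_toFraction i _

theorem zAt_sq_sub_ne_zero {i j : Fin n} (h : i ≠ j) : zAt i ^ 2 - zAt j ^ 2 ≠ 0 :=
  sub_ne_zero.mpr fun e => h (zAt_sq_injective e)

theorem C_inv_mul_C_sub {i j : Fin n} (h : i ≠ j) :
    (MvPowerSeries.C (zAt i ^ 2 - zAt j ^ 2)⁻¹ : FractionSeries n) *
      (MvPowerSeries.C (zAt i) ^ 2 - MvPowerSeries.C (zAt j) ^ 2) = 1 := by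
  rw [← map_pow, ← map_pow, ← map_sub, ← map_mul, inv_mul_cancel₀ (zAt_sq_sub_ne_zero h), map_one]

theorem hasNabla_resolvent {τ : TimeSeries} (hτ₀ : MvPowerSeries.constantCoeff τ ≠ 0)
    (hτ : IsTauFunction τ) {i j : Fin n} (hij : i ≠ j) :
    HasNabla i (specializeW j (resolvent τ))
      (MvPowerSeries.C (zAt i ^ 2 - zAt j ^ 2)⁻¹ *
        (specializeW i (resolvent τ) * dX (specializeW j (resolvent τ)) -
          dX (specializeW i (resolvent τ)) * specializeW j (resolvent τ))) := by
  have h := congrArg toFraction (nabla_resolventAt hτ₀ hτ i j)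
  have H := hasNabla_toFraction i (resolventAt τ j)
  simp only [map_sub, map_mul, map_pow, toFraction_dX, ← specializeW_resolvent] at h
  rw [← specializeW_resolvent] at H
  have hd := C_inv_mul_C_sub hij
  have hi := C_zAt_mul_toFraction_invZ i
  have hj := C_zAt_mul_toFraction_invZ j
  convert H using 1
  set y := toFraction (nabla i (resolventAt τ j))
  set d : FractionSeries n := MvPowerSeries.C (zAt i ^ 2 - zAt j ^ 2)⁻¹
  set p : FractionSeries n := MvPowerSeries.C (zAt i)
  set q : FractionSeries n := MvPowerSeries.C (zAt j)
  set x := toFraction (invZ i)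
  set x' := toFraction (invZ j)
  set B := specializeW i (resolvent τ) * dX (specializeW j (resolvent τ)) -
          dX (specializeW i (resolvent τ)) * specializeW j (resolvent τ)
  have hi2 : p ^ 2 * x ^ 2 = 1 := by rw [← mul_pow, hi, one_pow]
  have hj2 : q ^ 2 * x' ^ 2 = 1 := by rw [← mul_pow, hj, one_pow]
  linear_combination (-(d * p ^ 2 * q ^ 2)) * h + y * hd + (- d * B * q ^ 2 * x' ^ 2 - d * y * q ^ 2) * hi2 + (d * y * p ^ 2 - d * B) * hj2

/-- The second derivative of the resolvent in `z_k`.  The potential does not depend on the spectral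
variables; it is written in the variable `z_i`. -/
theorem dX_dX_specializeW_resolvent {τ : TimeSeries} (hτ₀ : MvPowerSeries.constantCoeff τ ≠ 0)
    (hτ : IsTauFunction τ) (i k : Fin n) :
    dX (dX (specializeW k (resolvent τ))) =
      2 * (MvPowerSeries.C (zAt k) ^ 2 - 2 * specializeW i (toWave (potential τ))) *
        specializeW k (resolvent τ) + 2 * specializeW k (resolventX τ) := by
  have h := congrArg (specializeW k) (dx_dx_resolvent hτ₀ hτ)
  simp only [map_add, map_sub, map_mul, map_pow, map_ofNat, specializeW_dx, specializeW_zW] at h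
  rw [h, specializeW_toWave, specializeW_toWave]

theorem hasNabla_resolventX {τ : TimeSeries} (hτ₀ : MvPowerSeries.constantCoeff τ ≠ 0)
    (hτ : IsTauFunction τ) {i j : Fin n} (hij : i ≠ j) :
    HasNabla i (specializeW j (resolventX τ))
      (MvPowerSeries.C (zAt i ^ 2 - zAt j ^ 2)⁻¹ *
        (dX (specializeW i (resolvent τ)) * specializeW j (resolventX τ) -
          specializeW i (resolventX τ) * dX (specializeW j (resolvent τ))) -
        specializeW i (resolvent τ) * dX (specializeW j (resolvent τ))) := by
  have hR := hasNabla_resolvent hτ₀ hτ hij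
  have hu := hasNabla_potential hτ₀ hτ i
  have h1 := dX_dX_specializeW_resolvent hτ₀ hτ i
  have h2 : ∀ k : Fin n, dX (specializeW k (resolventX τ)) =
      (MvPowerSeries.C (zAt k) ^ 2 - 2 * specializeW i (toWave (potential τ))) *
        dX (specializeW k (resolvent τ)) := by
    intro k
    have h := congrArg (specializeW k) (dx_resolventX hτ₀ hτ)
    simp only [map_sub, map_mul, map_pow, map_ofNat, specializeW_dx, specializeW_zW] at h
    rw [h, specializeW_toWave, specializeW_toWave]
  have hd := C_inv_mul_C_sub hij
  have hh := half_mul_two (n := n)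
  set Rj := specializeW j (resolvent τ)
  set Ri := specializeW i (resolvent τ)
  set Pj := specializeW j (resolventX τ)
  set Pi := specializeW i (resolventX τ)
  set u := specializeW i (toWave (potential τ))
  set d : FractionSeries n := MvPowerSeries.C (zAt i ^ 2 - zAt j ^ 2)⁻¹ with hdd
  set p : FractionSeries n := MvPowerSeries.C (zAt i)
  set q : FractionSeries n := MvPowerSeries.C (zAt j) with hq
  have h3 : ∀ k : Fin n, dX (dX (dX (specializeW k (resolvent τ)))) =
      4 * (MvPowerSeries.C (zAt k) ^ 2 - 2 * u) * dX (specializeW k (resolvent τ)) -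
        4 * dX u * specializeW k (resolvent τ) := by
    intro k
    have e2 : ∀ f : FractionSeries n, dX (2 * f) = 2 * dX f := fun f => by
      rw [two_mul, dX_add, two_mul]
    rw [h1 k, dX_add, mul_assoc, e2, e2, dX_mul, dX_sub, e2, h2 k, ← map_pow, dX_C]
    ring
  -- `P_j = ½ ∂ₓ² R_j - (ζ_j - 2 u) R_j`
  have hPj : Pj = MvPowerSeries.C (1 / 2) * dX (dX Rj) -
      (MvPowerSeries.C (zAt j ^ 2) - MvPowerSeries.C 2 * u) * Rj := by
    rw [h1 j, map_pow, ← hq, map_ofNat]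
    linear_combination (-((q ^ 2 - 2 * u) * Rj + Pj)) * hh
  have H := (hR.dX.dX.C_mul (1 / 2)).sub
    (((hasNabla_C i (zAt j ^ 2)).sub (hu.C_mul 2)).mul hR)
  rw [← hPj] at H
  convert H using 1
  rw [hdd, dX_C_mul, dX_C_mul, ← hdd, dX_sub, dX_mul, dX_mul, dX_sub, dX_add, dX_add, dX_mul,
    dX_mul, dX_mul, h3 i, h3 j, h1 i, h1 j, map_pow, ← hq, map_ofNat]
  linear_combination (Ri * dX Rj + 2 * dX Ri * Rj) * hd -
    d * (2 * (q ^ 2 - 2 * u) * Ri * dX Rj - 2 * (p ^ 2 - 2 * u) * dX Ri * Rj +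
      dX Ri * ((q ^ 2 - 2 * u) * Rj + Pj) - ((p ^ 2 - 2 * u) * Ri + Pi) * dX Rj) * hh

theorem ThetaAt_eq {τ : TimeSeries} (hτ₀ : MvPowerSeries.constantCoeff τ ≠ 0)
    (hτ : IsTauFunction τ) (i : Fin n) :
    ThetaAt τ i = !![-(MvPowerSeries.C (1 / 2) * dX (specializeW i (resolvent τ))),
        -specializeW i (resolvent τ);
      specializeW i (resolventX τ), MvPowerSeries.C (1 / 2) * dX (specializeW i (resolvent τ))] := by
  have hh : specializeW i halfW = MvPowerSeries.C (1 / 2) := by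
    have h := congrArg (specializeW i) halfW_mul_two
    rw [map_mul, map_ofNat, map_one] at h
    linear_combination MvPowerSeries.C (1 / 2) * h - specializeW i halfW * half_mul_two
  have h2 := half_mul_two (n := n)
  rw [ThetaAt, Theta_eq hτ₀ hτ]
  change Matrix.map _ (specializeW i) = _
  ext1 a b
  fin_cases a <;> fin_cases b <;>
    simp only [Matrix.map_apply, Matrix.smul_apply, smul_eq_mul, map_mul, hh, Matrix.of_apply,
      Matrix.cons_val', Matrix.cons_val_zero, Matrix.cons_val_one, Fin.zero_eta, Fin.mk_one,
      Matrix.cons_val_fin_one, map_neg, map_ofNat, specializeW_dx]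
  · ring
  · linear_combination (-specializeW i (resolvent τ)) * h2
  · linear_combination specializeW i (resolventX τ) * h2

/-- The gauge term of the loop equation for `Θ`. -/
def gaugeMatrix (i : Fin n) : Matrix (Fin 2) (Fin 2) (FractionSeries n) :=
  !![0, 0; specializeW i (resolvent τ), 0]

/-- The loop equation `∇_i Θ(z_j) = [Θ(z_i) / (z_i² - z_j²) + Q_i, Θ(z_j)]`. -/
theorem hasMatrixNabla_ThetaAt {τ : TimeSeries} (hτ₀ : MvPowerSeries.constantCoeff τ ≠ 0)
    (hτ : IsTauFunction τ) {i j : Fin n} (hij : i ≠ j) :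
    HasMatrixNabla i (ThetaAt τ j)
      ((zAt i ^ 2 - zAt j ^ 2)⁻¹ • (ThetaAt τ i * ThetaAt τ j - ThetaAt τ j * ThetaAt τ i) +
        (gaugeMatrix τ i * ThetaAt τ j - ThetaAt τ j * gaugeMatrix τ i)) := by
  have hR := hasNabla_resolvent hτ₀ hτ hij
  have hP := hasNabla_resolventX hτ₀ hτ hij
  have hd := C_inv_mul_C_sub hij
  have h2 := half_mul_two (n := n)
  have h1 := dX_dX_specializeW_resolvent hτ₀ hτ i
  rw [ThetaAt_eq hτ₀ hτ, ThetaAt_eq hτ₀ hτ, gaugeMatrix]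
  have hsm : ∀ f : FractionSeries n, (zAt i ^ 2 - zAt j ^ 2)⁻¹ • f =
      MvPowerSeries.C (zAt i ^ 2 - zAt j ^ 2)⁻¹ * f := fun f =>
    MvPowerSeries.smul_eq_C_mul _ _
  have hRx := hR.dX.C_mul (1 / 2)
  rw [dX_C_mul, dX_sub, dX_mul, dX_mul, h1 i, h1 j] at hRx
  set Rj := specializeW j (resolvent τ)
  set Ri := specializeW i (resolvent τ)
  set Pj := specializeW j (resolventX τ)
  set Pi := specializeW i (resolventX τ)
  set u := specializeW i (toWave (potential τ))
  set d : FractionSeries n := MvPowerSeries.C (zAt i ^ 2 - zAt j ^ 2)⁻¹ with hdd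
  set p : FractionSeries n := MvPowerSeries.C (zAt i)
  set q : FractionSeries n := MvPowerSeries.C (zAt j) with hq
  set h : FractionSeries n := MvPowerSeries.C (1 / 2)
  have key : h * (d * (dX Ri * dX Rj + Ri * (2 * (q ^ 2 - 2 * u) * Rj + 2 * Pj) -
        ((2 * (p ^ 2 - 2 * u) * Ri + 2 * Pi) * Rj + dX Ri * dX Rj))) =
      d * (Ri * Pj - Pi * Rj) - Ri * Rj := by
    linear_combination d * (Ri * ((q ^ 2 - 2 * u) * Rj + Pj) - ((p ^ 2 - 2 * u) * Ri + Pi) * Rj) *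
      h2 - Ri * Rj * hd
  rw [key] at hRx
  intro a b
  fin_cases a <;> fin_cases b <;>
    simp only [Matrix.add_apply, Matrix.sub_apply, Matrix.smul_apply, Matrix.mul_apply,
      Fin.sum_univ_two, Matrix.of_apply,
      Matrix.cons_val', Matrix.cons_val_zero, Matrix.cons_val_one, Fin.zero_eta, Fin.mk_one,
      Matrix.cons_val_fin_one, hsm]
  · convert hRx.neg using 1
    ring
  · convert hR.neg using 1
    linear_combination d * (dX Ri * Rj - Ri * dX Rj) * h2
  · convert hP using 1
    linear_combination (d * (dX Ri * Pj - Pi * dX Rj) - Ri * dX Rj) * h2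
  · convert hRx using 1
    ring

/-- The two-point function in terms of `Θ`. -/
theorem toFraction_nabla_onePoint {τ : TimeSeries} (hτ₀ : MvPowerSeries.constantCoeff τ ≠ 0)
    (hτ : IsTauFunction τ) {i j : Fin n} (hij : i ≠ j) :
    toFraction (nabla i (onePoint τ j)) = MvPowerSeries.C ((zAt i ^ 2 - zAt j ^ 2)⁻¹ ^ 2) *
      ((ThetaAt τ i * ThetaAt τ j).trace - MvPowerSeries.C (zAt i ^ 2 + zAt j ^ 2)) := by
  have h := congrArg toFraction (nabla_onePoint hτ₀ hτ i j)
  have hd := C_inv_mul_C_sub hij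
  have h2 := half_mul_two (n := n)
  have hi := C_zAt_mul_toFraction_invZ i
  have hj := C_zAt_mul_toFraction_invZ j
  simp only [map_sub, map_add, map_mul, map_pow, map_ofNat, toFraction_dX,
    toFraction_resolventXAt hτ₀ hτ, ← specializeW_resolvent] at h
  rw [ThetaAt_eq hτ₀ hτ, ThetaAt_eq hτ₀ hτ, Matrix.trace_fin_two, Matrix.mul_apply,
    Matrix.mul_apply, Fin.sum_univ_two, Fin.sum_univ_two, map_add, map_pow, map_pow, map_pow]
  simp only [Matrix.of_apply, Matrix.cons_val', Matrix.cons_val_zero, Matrix.cons_val_one,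
      Matrix.cons_val_fin_one]
  set Rj := specializeW j (resolvent τ)
  set Ri := specializeW i (resolvent τ)
  set Pj := specializeW j (resolventX τ)
  set Pi := specializeW i (resolventX τ)
  set N := toFraction (nabla i (onePoint τ j))
  set d : FractionSeries n := MvPowerSeries.C (zAt i ^ 2 - zAt j ^ 2)⁻¹
  set p : FractionSeries n := MvPowerSeries.C (zAt i)
  set q : FractionSeries n := MvPowerSeries.C (zAt j)
  set k : FractionSeries n := MvPowerSeries.C (1 / 2)
  set x := toFraction (invZ i)
  set y := toFraction (invZ j)
  have hi2 : x ^ 2 * p ^ 2 = 1 := by rw [← mul_pow, mul_comm x, hi, one_pow]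
  have hj2 : y ^ 2 * q ^ 2 = 1 := by rw [← mul_pow, mul_comm y, hj, one_pow]
  have e1 : (p ^ 2 - q ^ 2) = p ^ 2 * q ^ 2 * (y ^ 2 - x ^ 2) := by
    linear_combination q ^ 2 * hi2 - p ^ 2 * hj2
  have e2 : 2 * ((p ^ 2 - q ^ 2) ^ 2 * N) = dX Ri * dX Rj - 2 * Pi * Rj - 2 * Ri * Pj -
      2 * (p ^ 2 + q ^ 2) := by
    have hE : p ^ 4 * q ^ 4 * (x ^ 4 * y ^ 4) = 1 := by
      linear_combination (x ^ 2 * p ^ 2 + 1) * (y ^ 2 * q ^ 2) ^ 2 * hi2 +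
        (y ^ 2 * q ^ 2 + 1) * hj2
    have hF : p ^ 4 * q ^ 4 * (x ^ 2 * y ^ 2 * (x ^ 2 + y ^ 2)) = p ^ 2 + q ^ 2 := by
      linear_combination (q ^ 2 * (x ^ 2 * p ^ 2 + 1) * (y ^ 2 * q ^ 2) +
        p ^ 2 * (y ^ 2 * q ^ 2) ^ 2) * hi2 + (q ^ 2 + p ^ 2 * (y ^ 2 * q ^ 2 + 1)) * hj2
    rw [e1]
    linear_combination p ^ 4 * q ^ 4 * h + (dX Ri * dX Rj - 2 * Pi * Rj - 2 * Ri * Pj) * hE -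
      2 * hF
  have e3 : (p ^ 2 - q ^ 2) ^ 2 * N = 2 * (k ^ 2 * (dX Ri * dX Rj)) - Pi * Rj - Ri * Pj -
      (p ^ 2 + q ^ 2) := by
    linear_combination k * e2 - ((p ^ 2 - q ^ 2) ^ 2 * N + Pi * Rj + Ri * Pj + (p ^ 2 + q ^ 2) +
      k * (dX Ri * dX Rj)) * h2
  linear_combination d ^ 2 * e3 - N * (d * (p ^ 2 - q ^ 2) + 1) * hd

end ThetaLoop

/-! ### Insertion of a point in a chain of commutators -/

section Chain

variable {ι K M : Type} [Field K] [Ring M] [Algebra K M] (ζ : ι → K) (Θ : ι → M)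

/-- The weight `∏ 1 / (ζ_s - ζ_t)`, where `s`, `t` run over the consecutive entries of
`a, p, c`. -/
def chainWeight : ι → List ι → ι → K
  | a, [], c => (ζ a - ζ c)⁻¹
  | a, s :: p, c => (ζ a - ζ s)⁻¹ * chainWeight s p c

/-- The derivative of the product of the `Θ_s`, `s ∈ L`, for the derivation that sends `Θ_s` to
the commutator `[Θ_w, Θ_s] / (ζ_w - ζ_s)`. -/
def commutatorSum (w : ι) : List ι → M
  | [] => 0
  | s :: L => (ζ w - ζ s)⁻¹ • (Θ w * Θ s - Θ s * Θ w) * (L.map Θ).prod + Θ s * commutatorSum w L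

/-- The partial fraction identity that makes the commutators telescope. -/
theorem inv_sub_mul_inv_sub {a s w : K} (has : a ≠ s) (hw : w ≠ a) (hws : w ≠ s) :
    (a - s)⁻¹ * ((w - s)⁻¹ - (w - a)⁻¹) = (a - w)⁻¹ * (w - s)⁻¹ := by
  have h1 := sub_ne_zero.mpr has
  have h2 := sub_ne_zero.mpr hw
  have h3 := sub_ne_zero.mpr hws
  have h4 := sub_ne_zero.mpr hw.symm
  field_simp
  ring

/-- The commutators telescope to insertions of `w` at all places of the chain. -/
theorem chainWeight_smul_commutatorSum {ζ : ι → K} (hζ : Function.Injective ζ) {w c : ι}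
    (hwc : w ≠ c) (p : List ι) : ∀ a : ι, (a :: p).Nodup → w ∉ a :: p → c ∉ p →
    (p = [] → a ≠ c) →
    chainWeight ζ a p c • commutatorSum ζ Θ w (a :: p) =
      ((ζ w - ζ a)⁻¹ * chainWeight ζ a p c) • (Θ w * ((a :: p).map Θ).prod) -
      ((ζ w - ζ c)⁻¹ * chainWeight ζ a p c) • (((a :: p).map Θ).prod * Θ w) +
      ((List.permutations'Aux w p).map fun q =>
        chainWeight ζ a q c • ((a :: q).map Θ).prod).sum := by
  induction p with
  | nil =>
    intro a _ hw _ hac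
    have e := inv_sub_mul_inv_sub (hζ.ne (hac rfl)) (hζ.ne (List.ne_of_not_mem_cons hw))
      (hζ.ne hwc)
    simp only [List.permutations'Aux, List.map_cons, List.map_nil, List.prod_cons, List.prod_nil,
      List.sum_cons, List.sum_nil, commutatorSum, chainWeight, mul_one, mul_zero, add_zero, ← e]
    module
  | cons s p ih =>
    intro a hnd hw hc _
    have has : a ≠ s := fun h => (List.nodup_cons.mp hnd).1 (h ▸ List.mem_cons_self)
    have hwa : w ≠ a := List.ne_of_not_mem_cons hw
    have hw' : w ∉ s :: p := List.not_mem_of_not_mem_cons hw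
    have hws : w ≠ s := List.ne_of_not_mem_cons hw'
    have h := ih s (List.nodup_cons.mp hnd).2 hw' (List.not_mem_of_not_mem_cons hc)
      fun _ => (List.ne_of_not_mem_cons hc).symm
    have e := inv_sub_mul_inv_sub (hζ.ne has) (hζ.ne hwa) (hζ.ne hws)
    have hs : ((List.permutations'Aux w (s :: p)).map fun q =>
        chainWeight ζ a q c • ((a :: q).map Θ).prod).sum =
        (((ζ a - ζ s)⁻¹ * ((ζ w - ζ s)⁻¹ - (ζ w - ζ a)⁻¹)) * chainWeight ζ s p c) •
          (Θ a * Θ w * ((s :: p).map Θ).prod) +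
        (ζ a - ζ s)⁻¹ • (Θ a * ((List.permutations'Aux w p).map fun q =>
          chainWeight ζ s q c • ((s :: q).map Θ).prod).sum) := by
      rw [e, List.permutations'Aux, List.map_cons, List.sum_cons, List.map_map]
      congr 1
      · simp only [chainWeight, List.map_cons, List.prod_cons, mul_assoc]
      · rw [← List.sum_map_mul_left, List.smul_sum, List.map_map]
        congr 1
        refine List.map_congr_left fun q _ => ?_
        simp only [Function.comp_apply, chainWeight, List.map_cons, List.prod_cons,
          mul_smul_comm, smul_smul]
    have h' := congrArg (fun f => (ζ a - ζ s)⁻¹ • (Θ a * f)) h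
    simp only [mul_add, mul_sub, mul_smul_comm, smul_add, smul_sub, smul_smul] at h'
    rw [hs, eq_sub_of_add_eq' h'.symm]
    have hM : ((a :: s :: p).map Θ).prod = Θ a * ((s :: p).map Θ).prod := by
      rw [List.map_cons, List.prod_cons]
    rw [commutatorSum, hM, chainWeight]
    simp only [smul_add, smul_sub, sub_mul, smul_mul_assoc, mul_assoc, smul_smul]
    module

/-- The weight of a closed chain times the trace of the product along it. -/
def cycleTrace {A : Type} [CommRing A] [Algebra K A] {m : Type} [Fintype m] [DecidableEq m]
    (Θ : ι → Matrix m m A) (a : ι) (p : List ι) : A :=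
  chainWeight ζ a p a • ((a :: p).map Θ).prod.trace

/-- Along a closed chain the two boundary terms cancel in the trace. -/
theorem chainWeight_smul_trace_commutatorSum {A : Type} [CommRing A] [Algebra K A] {m : Type}
    [Fintype m] [DecidableEq m] {ζ : ι → K} (hζ : Function.Injective ζ) (Θ : ι → Matrix m m A)
    {w a : ι} {p : List ι} (hp : p ≠ []) (hnd : (a :: p).Nodup) (hw : w ∉ a :: p) :
    chainWeight ζ a p a • (commutatorSum ζ Θ w (a :: p)).trace =
      ((List.permutations'Aux w p).map (cycleTrace ζ Θ a)).sum := by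
  have h := congrArg Matrix.trace (chainWeight_smul_commutatorSum (c := a) Θ hζ
    (List.ne_of_not_mem_cons hw) p a hnd hw (List.nodup_cons.mp hnd).1 fun h => absurd h hp)
  rw [Matrix.trace_add, Matrix.trace_sub, Matrix.trace_smul, Matrix.trace_smul, Matrix.trace_smul,
    Matrix.trace_mul_comm (Θ w), sub_self, zero_add] at h
  rw [h]
  change Matrix.traceAddMonoidHom m A _ = _
  rw [map_list_sum, List.map_map]
  congr 1
  refine List.map_congr_left fun q _ => ?_
  exact Matrix.trace_smul _ _

end Chain

section CycleTrace

variable {n : ℕ} {τ : TimeSeries}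

theorem hasMatrixNabla_prod_ThetaAt (hτ₀ : MvPowerSeries.constantCoeff τ ≠ 0)
    (hτ : IsTauFunction τ) {w : Fin n} (L : List (Fin n)) (hw : w ∉ L) :
    HasMatrixNabla w (L.map (ThetaAt τ)).prod
      (commutatorSum (fun i => zAt i ^ 2) (ThetaAt τ) w L +
        (gaugeMatrix τ w * (L.map (ThetaAt τ)).prod -
          (L.map (ThetaAt τ)).prod * gaugeMatrix τ w)) := by
  induction L with
  | nil =>
    rw [List.map_nil, List.prod_nil, commutatorSum, mul_one, one_mul, sub_self, add_zero]
    exact hasMatrixNabla_one w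
  | cons s L ih =>
    have h := (hasMatrixNabla_ThetaAt hτ₀ hτ (List.ne_of_not_mem_cons hw)).mul
      (ih (List.not_mem_of_not_mem_cons hw))
    rw [List.map_cons, List.prod_cons]
    convert h using 1
    rw [commutatorSum]
    noncomm_ring

/-- The loop operator inserts the point `w` at all places of a cycle; the gauge term is traceless. -/
theorem hasNabla_cycleTrace (hτ₀ : MvPowerSeries.constantCoeff τ ≠ 0)
    (hτ : IsTauFunction τ) {w a : Fin n} {p : List (Fin n)} (hp : p ≠ []) (hnd : (a :: p).Nodup)
    (hw : w ∉ a :: p) :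
    HasNabla w (cycleTrace (fun i => zAt i ^ 2) (ThetaAt τ) a p)
      ((List.permutations'Aux w p).map
        (cycleTrace (fun i => zAt i ^ 2) (ThetaAt τ) a)).sum := by
  have h := (hasMatrixNabla_prod_ThetaAt hτ₀ hτ (a :: p) hw).trace.C_mul
    (chainWeight (fun i => zAt i ^ 2) a p a)
  rw [Matrix.trace_add, Matrix.trace_sub, Matrix.trace_mul_comm (gaugeMatrix τ w), sub_self,
    add_zero, ← MvPowerSeries.smul_eq_C_mul, ← MvPowerSeries.smul_eq_C_mul,
    chainWeight_smul_trace_commutatorSum zAt_sq_injective _ hp hnd hw] at h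
  exact h

end CycleTrace

/-! ### Iterated loop operators -/

section Iterate

variable {n : ℕ} {τ : TimeSeries}

theorem HasNabla.list_sum {i : Fin n} {α : Type} {g h : α → FractionSeries n} (L : List α)
    (H : ∀ p ∈ L, HasNabla i (g p) (h p)) : HasNabla i (L.map g).sum (L.map h).sum := by
  induction L with
  | nil => simpa using hasNabla_C i 0
  | cons p L ih =>
    rw [List.map_cons, List.map_cons, List.sum_cons, List.sum_cons]
    exact (H p List.mem_cons_self).add (ih fun q hq => H q (List.mem_cons_of_mem p hq))

/-- The correction term of the two-point function, present only for a single other point. -/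
def selfTerm (a : Fin n) : List (Fin n) → SpectralField n
  | [w] => (zAt w ^ 2 + zAt a ^ 2) / (zAt w ^ 2 - zAt a ^ 2) ^ 2
  | _ => 0

/-- The iterated loop operators on the one-point function, as a sum over cycles through `a`. -/
theorem toFraction_foldr_nabla (hτ₀ : MvPowerSeries.constantCoeff τ ≠ 0) (hτ : IsTauFunction τ)
    {a : Fin n} {l : List (Fin n)} (hl : l ≠ []) (hnd : (a :: l).Nodup) :
    toFraction (l.foldr (fun i f => nabla i f) (onePoint τ a)) =
      -((List.permutations' l).map (cycleTrace (fun i => zAt i ^ 2) (ThetaAt τ) a)).sum -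
        MvPowerSeries.C (selfTerm a l) := by
  induction l with
  | nil => exact absurd rfl hl
  | cons w l ih =>
    have hwa : w ≠ a := fun h => (List.nodup_cons.mp hnd).1 (h ▸ List.mem_cons_self)
    have hnd' : (a :: l).Nodup := hnd.sublist ((List.sublist_cons_self w l).cons_cons a)
    have hw : w ∉ a :: l := by
      rw [List.mem_cons, not_or]
      exact ⟨hwa, (List.nodup_cons.mp (List.nodup_cons.mp hnd).2).1⟩
    rcases eq_or_ne l [] with rfl | hl'
    · have e1 : (List.permutations' [w]) = [[w]] := rfl
      rw [e1, List.foldr_cons, List.foldr_nil, toFraction_nabla_onePoint hτ₀ hτ hwa, selfTerm,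
        List.map_cons, List.map_nil, List.sum_cons, List.sum_nil, add_zero, cycleTrace,
        List.map_cons, List.map_cons, List.map_nil, List.prod_cons, List.prod_cons, List.prod_nil,
        mul_one, Matrix.trace_mul_comm (ThetaAt τ a), MvPowerSeries.smul_eq_C_mul, chainWeight,
        chainWeight, mul_sub, ← map_mul, ← neg_mul, ← map_neg]
      have e2 : (zAt a ^ 2 - zAt w ^ 2)⁻¹ = -(zAt w ^ 2 - zAt a ^ 2)⁻¹ := by
        rw [← inv_neg, neg_sub]
      congr 1
      · congr 2
        rw [e2]; ring
      · rw [div_eq_mul_inv, inv_pow, mul_comm]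
    · have H : HasNabla w (-((List.permutations' l).map
          (cycleTrace (fun i => zAt i ^ 2) (ThetaAt τ) a)).sum -
            MvPowerSeries.C (selfTerm a l))
          (-((List.permutations' l).map fun p => ((List.permutations'Aux w p).map
            (cycleTrace (fun i => zAt i ^ 2) (ThetaAt τ) a)).sum).sum - 0) := by
        refine (HasNabla.list_sum _ fun p hp => ?_).neg.sub (hasNabla_C w _)
        have hpl : p.Perm l := List.mem_permutations'.mp hp
        refine hasNabla_cycleTrace hτ₀ hτ (fun h => hl' ?_) ((hpl.cons a).nodup_iff.mpr hnd')
          fun h => hw ((hpl.cons a).mem_iff.mp h)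
        rw [h] at hpl
        exact hpl.symm.eq_nil
      rw [← ih hl' hnd'] at H
      have e := (hasNabla_toFraction w _).unique H
      have hs : selfTerm a (w :: l) = 0 := by
        cases l with
        | nil => exact absurd rfl hl'
        | cons s l => rfl
      rw [List.foldr_cons, e, hs, map_zero, List.permutations', List.map_flatMap,
        List.flatMap_def, List.sum_flatten, List.map_map]
      rfl

/-- The coefficient of a monomial in the spectral variables. -/
def slice (ε : Fin n →₀ ℕ) (f : MultiRing n) : TimeSeries := fun d =>
  MvPowerSeries.coeff ε (MvPowerSeries.coeff d f)

theorem coeff_slice (ε : Fin n →₀ ℕ) (f : MultiRing n) (d : ℕ →₀ ℕ) :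
    MvPowerSeries.coeff d (slice ε f) = MvPowerSeries.coeff ε (MvPowerSeries.coeff d f) := rfl

theorem slice_flow (ε : Fin n →₀ ℕ) (k : ℕ) (f : MultiRing n) :
    slice ε (flow k f) = flow k (slice ε f) := by
  ext1 d
  rw [coeff_slice, flow_apply, flow_apply, map_nsmul, map_nsmul, map_nsmul,
    MvPowerSeries.coeff_pderiv, MvPowerSeries.coeff_pderiv, coeff_slice]
  congr 1
  have : (((d k : ℕ) : MvPowerSeries (Fin n) ℂ) + 1) = MvPowerSeries.C ((d k : ℂ) + 1) := by
    rw [map_add, map_natCast, map_one]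
  rw [this, mul_comm, MvPowerSeries.coeff_C_mul, mul_comm]

theorem slice_embed (ε : Fin n →₀ ℕ) (t : TimeSeries) :
    slice ε (embed t) = if ε = 0 then t else 0 := by
  classical
  ext1 d
  rw [coeff_slice, embed, MvPowerSeries.coeff_map, MvPowerSeries.coeff_C]
  split_ifs
  · rfl
  · rw [map_zero]

theorem slice_nabla (ε : Fin n →₀ ℕ) (i : Fin n) (f : MultiRing n) :
    slice ε (nabla i f) = ∑ k ∈ Finset.range (ε i + 1),
      if 2 * k + 2 ≤ ε i then flow k (slice (ε - Finsupp.single i (2 * k + 2)) f) else 0 := by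
  ext1 d
  rw [coeff_slice, nabla_apply, invZ, ← map_pow, MvPowerSeries.coeff_C_mul, coeff_spectralSum,
    mul_comm, ← coeffSum_mul, coeff_coeffSum i (Nat.lt_succ_self _), map_sum]
  refine Finset.sum_congr rfl fun k _ => ?_
  rw [mul_comm (MvPowerSeries.coeff d _), ← mul_assoc, ← pow_add, MvPowerSeries.X_pow_eq,
    MvPowerSeries.coeff_monomial_mul, one_mul]
  simp only [Finsupp.single_le_iff]
  split_ifs
  · rw [← slice_flow]; rfl
  · rw [map_zero]

/-- Iterated loop operators collect the iterated flows: the power `z_i ^ (-2 k - 2)` comes with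
the `k`-th flow. -/
theorem slice_foldr_nabla (t : TimeSeries) {l : List (Fin n)} (hl : l.Nodup) (ε : Fin n →₀ ℕ) :
    slice ε (l.foldr (fun i f => nabla i f) (embed t)) =
      open Classical in
      if (∀ i ∈ l, ∃ k, ε i = 2 * k + 2) ∧ ∀ i ∉ l, ε i = 0 then
        l.foldr (fun i f => flow (ε i / 2 - 1) f) t else 0 := by
  classical
  induction l generalizing ε with
  | nil =>
    rw [List.foldr_nil, slice_embed]
    congr 1
    simp [Finsupp.ext_iff]
  | cons i l ih =>
    obtain ⟨hil, hl'⟩ := List.nodup_cons.mp hl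
    rw [List.foldr_cons, slice_nabla]
    simp only [ih hl']
    by_cases hε : ∃ k, ε i = 2 * k + 2
    · obtain ⟨k, hk⟩ := hε
      have hj : ∀ j ∈ l, (ε - Finsupp.single i (2 * k + 2)) j = ε j := by
        intro j hj
        rw [Finsupp.tsub_apply, Finsupp.single_eq_of_ne (ne_of_mem_of_not_mem hj hil),
          Nat.sub_zero]
      rw [Finset.sum_eq_single k]
      · rw [if_pos hk.ge]
        have hP : ((∀ j ∈ l, ∃ m, (ε - Finsupp.single i (2 * k + 2)) j = 2 * m + 2) ∧
            ∀ j ∉ l, (ε - Finsupp.single i (2 * k + 2)) j = 0) ↔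
            (∀ j ∈ i :: l, ∃ m, ε j = 2 * m + 2) ∧ ∀ j ∉ i :: l, ε j = 0 := by
          constructor
          · rintro ⟨h1, h2⟩
            refine ⟨fun j hjl => ?_, fun j hjl => ?_⟩
            · rcases List.mem_cons.mp hjl with rfl | h
              · exact ⟨k, hk⟩
              · rw [← hj j h]; exact h1 j h
            · have := h2 j (List.not_mem_of_not_mem_cons hjl)
              rwa [Finsupp.tsub_apply, Finsupp.single_eq_of_ne (List.ne_of_not_mem_cons hjl),
                Nat.sub_zero] at this
          · rintro ⟨h1, h2⟩
            refine ⟨fun j hjl => ?_, fun j hjl => ?_⟩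
            · rw [hj j hjl]; exact h1 j (List.mem_cons_of_mem i hjl)
            · rw [Finsupp.tsub_apply]
              rcases eq_or_ne j i with rfl | h
              · rw [hk, Finsupp.single_eq_same, Nat.sub_self]
              · rw [h2 j fun h' => (List.mem_cons.mp h').elim h hjl, Nat.zero_sub]
        have hk' : ε i / 2 - 1 = k := by omega
        by_cases hQ : (∀ j ∈ i :: l, ∃ m, ε j = 2 * m + 2) ∧ ∀ j ∉ i :: l, ε j = 0
        · rw [if_pos (hP.mpr hQ), if_pos hQ, List.foldr_cons, hk']
          congr 1
          refine List.foldr_ext _ _ _ fun j hjl f => ?_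
          rw [hj j hjl]
        · rw [if_neg fun h => hQ (hP.mp h), if_neg hQ, map_zero]
      · intro m _ hm
        split_ifs with h1 h2
        · have := h2.2 i hil
          rw [Finsupp.tsub_apply, Finsupp.single_eq_same] at this
          omega
        · exact map_zero _
        · rfl
      · intro h
        exact absurd (Finset.mem_range.mpr (by omega)) h
    · rw [if_neg fun h => hε (h.1 i List.mem_cons_self)]
      refine Finset.sum_eq_zero fun k _ => ?_
      split_ifs with h1 h2
      · have := h2.2 i hil
        rw [Finsupp.tsub_apply, Finsupp.single_eq_same] at this
        exact absurd ⟨k, by omega⟩ hε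
      · exact map_zero _
      · rfl

theorem foldr_flow (t : TimeSeries) (L : List ℕ) :
    L.foldr (fun k f => flow k f) t =
      (L.map fun k => Nat.doubleFactorial (2 * k + 1)).prod •
        L.foldr (fun k f => MvPowerSeries.pderiv ℂ k f) t := by
  induction L with
  | nil => rw [List.foldr_nil, List.map_nil, List.prod_nil, one_smul, List.foldr_nil]
  | cons k L ih =>
    rw [List.foldr_cons, ih, map_nsmul, flow_apply, smul_smul, List.map_cons, List.prod_cons,
      mul_comm, List.foldr_cons]

/-- The generating series is obtained from `log τ` by the loop operators. -/
theorem generatingSeries_eq (τ : TimeSeries) (n : ℕ) :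
    generatingSeries τ n =
      (List.finRange n).foldr (fun i f => nabla i f) (embed (logSeries τ)) := by
  classical
  ext d ε
  rw [← coeff_slice ε (List.foldr _ _ _), slice_foldr_nabla _ (List.nodup_finRange n)]
  change (∑ k ∈ Fintype.piFinset fun i => Finset.range (ε i),
    if ∀ i, ε i = 2 * k i + 2 then
      MvPowerSeries.coeff d (correlation τ k) *
        ∏ i, (Nat.doubleFactorial (2 * k i + 1) : ℂ)
    else 0) = _
  by_cases h : ∀ i, ∃ k, ε i = 2 * k + 2
  · rw [if_pos ⟨fun i _ => h i, fun i hi => absurd (List.mem_finRange i) hi⟩]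
    choose k hk using h
    have hk' : ∀ i, ε i / 2 - 1 = k i := fun i => by have := hk i; omega
    rw [Finset.sum_eq_single k]
    · rw [if_pos hk, correlation]
      simp only [hk']
      have e := foldr_flow (logSeries τ) ((List.finRange n).map k)
      rw [List.foldr_map, List.map_map, ← List.ofFn_eq_map] at e
      rw [e, map_nsmul, nsmul_eq_mul, mul_comm, ← List.ofFn_eq_map, List.prod_ofFn, Nat.cast_prod]
      rfl
    · intro k' _ hk'
      refine if_neg fun h => hk' (funext fun i => ?_)
      have := h i
      have := hk i
      omega
    · intro hn
      refine absurd (Fintype.mem_piFinset.mpr fun i => Finset.mem_range.mpr ?_) hn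
      have := hk i
      omega
  · rw [if_neg fun h' => h fun i => h'.1 i (List.mem_finRange i), map_zero]
    exact Finset.sum_eq_zero fun k _ => if_neg fun h' => h fun i => ⟨k i, h' i⟩

end Iterate

/-! ### Sums over permutations -/

section Cyclic

variable {ι K : Type} [Field K] {A : Type} [CommRing A] [Algebra K A] (ζ : ι → K)
  (Θ : ι → Matrix (Fin 2) (Fin 2) A)

/-- The trace of the product of the `Θ (v j)` divided by the cyclic product of the differences of
the `ζ (v j)`. -/
def cyclicTerm {n : ℕ} (v : Fin n → ι) : A :=
  (∏ j : Fin n, (ζ (v j) - ζ (v (finRotate n j))))⁻¹ •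
    (List.ofFn fun j : Fin n => Θ (v j)).prod.trace

/-- The terms of the sum are invariant under cyclic rotation. -/
theorem cyclicTerm_comp_finRotate {n : ℕ} (v : Fin n → ι) :
    cyclicTerm ζ Θ (fun j => v (finRotate n j)) = cyclicTerm ζ Θ v := by
  rw [cyclicTerm, cyclicTerm]
  congr 1
  · rw [Equiv.prod_comp (finRotate n) fun j => ζ (v j) - ζ (v (finRotate n j))]
  · cases n with
    | zero => rfl
    | succ n =>
      have e : ∀ j : Fin n, finRotate (n + 1) j.castSucc = j.succ := fun j => by
        rw [finRotate_apply, Fin.coeSucc_eq_succ]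
      rw [List.ofFn_succ_last, List.ofFn_succ]
      simp only [e, finRotate_last]
      rw [List.prod_append, List.prod_singleton, Matrix.trace_mul_comm, List.prod_cons]

theorem chainWeight_ofFn {n : ℕ} (v : Fin (n + 1) → ι) (c : ι) :
    chainWeight ζ (v 0) (List.ofFn fun j : Fin n => v j.succ) c =
      (∏ j : Fin n, (ζ (v j.castSucc) - ζ (v j.succ)))⁻¹ * (ζ (v (Fin.last n)) - ζ c)⁻¹ := by
  induction n with
  | zero => rw [List.ofFn_zero, chainWeight, Fin.prod_univ_zero, inv_one, one_mul]; rfl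
  | succ n ih =>
    rw [List.ofFn_succ, chainWeight, ih fun j => v j.succ, Fin.prod_univ_succ, mul_inv, mul_assoc]
    rfl

theorem cyclicTerm_eq_cycleTrace {n : ℕ} (v : Fin (n + 1) → ι) :
    cyclicTerm ζ Θ v = cycleTrace ζ Θ (v 0) (List.ofFn fun j : Fin n => v j.succ) := by
  rw [cyclicTerm, cycleTrace, chainWeight_ofFn, Fin.prod_univ_castSucc, mul_inv, finRotate_last,
    ← List.ofFn_succ (f := v), List.map_ofFn]
  simp only [finRotate_apply, Fin.coeSucc_eq_succ]
  rfl

/-- By cyclic invariance, all the starting points of the cycles contribute equally. -/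
theorem sum_perm_eq {n : ℕ} (F : Equiv.Perm (Fin (n + 1)) → A)
    (hF : ∀ r, F (r * finRotate (n + 1)) = F r) (a : Fin (n + 1)) :
    ∑ r, F r = (n + 1 : ℕ) • ∑ r with r 0 = a, F r := by
  have hc : ∀ k, ∑ r with r k = a, F r = ∑ r with r 0 = a, F r := by
    intro k
    induction k using Fin.induction with
    | zero => rfl
    | succ k ih =>
      rw [← ih]
      refine Finset.sum_equiv (Equiv.mulRight (finRotate (n + 1))) (fun r => ?_) fun r _ =>
        (hF r).symm
      rw [Finset.mem_filter_univ, Finset.mem_filter_univ, Equiv.coe_mulRight, Equiv.Perm.mul_apply,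
        finRotate_apply, Fin.coeSucc_eq_succ]
  have h : ∑ r, F r = ∑ k, ∑ r with r k = a, F r := by
    rw [← Finset.sum_fiberwise Finset.univ fun r : Equiv.Perm (Fin (n + 1)) => r.symm a]
    refine Finset.sum_congr rfl fun k _ => Finset.sum_congr ?_ fun _ _ => rfl
    ext r
    rw [Finset.mem_filter_univ, Finset.mem_filter_univ, Equiv.symm_apply_eq, eq_comm]
  rw [h, Finset.sum_congr rfl fun k _ => hc k, Finset.sum_const, Finset.card_univ, Fintype.card_fin]

/-- The permutations starting at `a` correspond to the orders of the remaining points. -/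
theorem sum_perm_zero_eq {n : ℕ} {a : Fin (n + 1)} {l : List (Fin (n + 1))}
    (hl : (a :: l).Perm (List.finRange (n + 1))) (G : List (Fin (n + 1)) → A) :
    ∑ r : Equiv.Perm (Fin (n + 1)) with r 0 = a, G (List.ofFn fun j : Fin n => r j.succ) =
      ((List.permutations' l).map G).sum := by
  classical
  have hnd : (a :: l).Nodup := hl.nodup_iff.mpr (List.nodup_finRange _)
  have hln : (List.permutations' l).Nodup :=
    (List.permutations_perm_permutations' l).nodup_iff.mp
      (List.nodup_permutations l (List.nodup_cons.mp hnd).2)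
  rw [← List.sum_toFinset G hln]
  refine Finset.sum_nbij (fun r => List.ofFn fun j : Fin n => r j.succ) ?_ ?_ ?_ fun _ _ => rfl
  · intro r hr
    have hr0 := (Finset.mem_filter_univ _).mp hr
    rw [List.mem_toFinset, List.mem_permutations', ← List.perm_cons a]
    refine List.Perm.trans ?_ hl.symm
    rw [← hr0, ← List.ofFn_succ (f := r)]
    refine (List.perm_ext_iff_of_nodup (List.nodup_ofFn.mpr r.injective)
      (List.nodup_finRange _)).mpr fun x => ?_
    rw [List.mem_ofFn]
    exact ⟨fun _ => List.mem_finRange x, fun _ => r.surjective x⟩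
  · intro r hr r' hr' h
    have hr0 := (Finset.mem_filter_univ _).mp (Finset.mem_coe.mp hr)
    have hr0' := (Finset.mem_filter_univ _).mp (Finset.mem_coe.mp hr')
    have h' := congrFun (List.ofFn_injective h)
    ext1 j
    refine Fin.cases ?_ (fun j => h' j) j
    rw [hr0, hr0']
  · intro p hp
    rw [Finset.mem_coe, List.mem_toFinset, List.mem_permutations', ← List.perm_cons a] at hp
    have hp' := hp.trans hl
    have hlen : (a :: p).length = n + 1 := by rw [hp'.length_eq, List.length_finRange]
    have hpn : p.length = n := by simpa using hlen
    set v : Fin (n + 1) → Fin (n + 1) := fun j => (a :: p).get (Fin.cast hlen.symm j) with hv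
    have hinj : Function.Injective v :=
      (List.nodup_iff_injective_get.mp (hp'.nodup_iff.mpr (List.nodup_finRange _))).comp
        (Fin.cast_injective hlen.symm)
    refine ⟨Equiv.ofBijective v (Finite.injective_iff_bijective.mp hinj), ?_, ?_⟩
    · rw [Finset.mem_coe, Finset.mem_filter_univ]
      rfl
    · refine List.ext_getElem (by simp [hpn]) fun k h1 h2 => ?_
      rw [List.getElem_ofFn]
      rfl

end Cyclic

/-- The sum over the permutations in the theorem, as a sum over the orders of the points other
than a fixed one. -/
theorem sum_perm_cyclicTerm {K A : Type} [Field K] [CommRing A] [Algebra K A] {n : ℕ}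
    (ζ : Fin (n + 1) → K) (Θ : Fin (n + 1) → Matrix (Fin 2) (Fin 2) A) {a : Fin (n + 1)}
    {l : List (Fin (n + 1))} (hl : (a :: l).Perm (List.finRange (n + 1))) :
    ∑ r : Equiv.Perm (Fin (n + 1)), cyclicTerm ζ Θ r =
      (n + 1 : ℕ) • ((List.permutations' l).map (cycleTrace ζ Θ a)).sum := by
  rw [sum_perm_eq (fun r => cyclicTerm ζ Θ r) (fun r => cyclicTerm_comp_finRotate ζ Θ r) a,
    ← sum_perm_zero_eq hl]
  congr 1
  refine Finset.sum_congr rfl fun r hr => ?_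
  rw [cyclicTerm_eq_cycleTrace, (Finset.mem_filter_univ _).mp hr]

theorem generatingFunction_eq {τ : TimeSeries}
    (hτ₀ : MvPowerSeries.constantCoeff τ ≠ 0) (hτ : IsTauFunction τ) (n : ℕ) :
    generatingFunction τ (n + 2) =
      -(MvPowerSeries.C ((1 : SpectralField (n + 2)) / (n + 2 : ℕ)) *
        ∑ r : Equiv.Perm (Fin (n + 2)), cyclicTerm (fun i => zAt i ^ 2) (ThetaAt τ) r) -
      MvPowerSeries.C (selfTerm (Fin.last (n + 1)) ((List.finRange (n + 1)).map Fin.castSucc)) := by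
  have hperm : (Fin.last (n + 1) :: (List.finRange (n + 1)).map Fin.castSucc).Perm
      (List.finRange (n + 2)) := by
    rw [List.finRange_succ_last (n := n + 1)]
    exact (List.perm_append_singleton _ _).symm
  have hne : (List.finRange (n + 1)).map Fin.castSucc ≠ [] := by
    rw [List.finRange_succ]
    exact List.cons_ne_nil _ _
  have hn : ((n + 2 : ℕ) : SpectralField (n + 2)) ≠ 0 := Nat.cast_ne_zero.mpr (by omega)
  rw [sum_perm_cyclicTerm _ _ hperm, nsmul_eq_mul, ← mul_assoc,
    ← map_natCast (MvPowerSeries.C (σ := ℕ) (R := SpectralField (n + 2))), ← map_mul,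
    one_div_mul_cancel hn, map_one, one_mul,
    ← toFraction_foldr_nabla hτ₀ hτ hne (hperm.nodup_iff.mpr (List.nodup_finRange _))]
  change toFraction (generatingSeries τ (n + 2)) = _
  rw [generatingSeries_eq, List.finRange_succ_last, List.foldr_append]
  rfl

end KdV

end

theorem theorem1p6 (τ : KdV.TimeSeries) (hτ₀ : MvPowerSeries.constantCoeff τ ≠ 0)
    (hτ : KdV.IsTauFunction τ) :
    IsUnit (KdV.Psi τ).det ∧
    KdV.Theta τ = KdV.halfW •
      !![-KdV.dx (KdV.resolvent τ), -2 * KdV.resolvent τ;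
        KdV.dx (KdV.dx (KdV.resolvent τ)) -
          2 * (KdV.zW ^ 2 - 2 * KdV.toWave (KdV.potential τ)) * KdV.resolvent τ,
        KdV.dx (KdV.resolvent τ)] ∧
    KdV.Theta τ = KdV.halfW •
      !![-KdV.dx (KdV.psi τ * KdV.psiStar τ), -2 * (KdV.psi τ * KdV.psiStar τ);
        2 * (KdV.dx (KdV.psi τ) * KdV.dx (KdV.psiStar τ)),
        KdV.dx (KdV.psi τ * KdV.psiStar τ)] ∧
    ∀ (n : ℕ) (hn : 2 ≤ n),
      KdV.generatingFunction τ n =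
        -MvPowerSeries.C ((1 : KdV.SpectralField n) / n) *
            (∑ r : Equiv.Perm (Fin n),
              MvPowerSeries.C
                  (∏ j : Fin n,
                    (KdV.zAt (r j) ^ 2 - KdV.zAt (r (finRotate n j)) ^ 2))⁻¹ *
                (List.ofFn fun j : Fin n => KdV.ThetaAt τ (r j)).prod.trace) -
          (if n = 2 then
            MvPowerSeries.C
              ((KdV.zAt (⟨0, by omega⟩ : Fin n) ^ 2 + KdV.zAt (⟨1, by omega⟩ : Fin n) ^ 2) /
                (KdV.zAt (⟨0, by omega⟩ : Fin n) ^ 2 -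
                  KdV.zAt (⟨1, by omega⟩ : Fin n) ^ 2) ^ 2)
          else 0) := by
  refine ⟨?_, ?_, KdV.Theta_eq hτ₀ hτ, fun n hn => ?_⟩
  · rw [KdV.det_Psi hτ₀ hτ]
    exact KdV.isUnit_two_zW
  · rw [← KdV.two_mul_resolventX hτ₀ hτ]
    exact KdV.Theta_eq hτ₀ hτ
  · obtain ⟨m, rfl⟩ : ∃ m, n = m + 2 := ⟨n - 2, by omega⟩
    rw [KdV.generatingFunction_eq hτ₀ hτ m, neg_mul]
    simp only [KdV.cyclicTerm, MvPowerSeries.smul_eq_C_mul]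
    congr 1
    cases m with
    | zero => rfl
    | succ m =>
      rw [if_neg (by omega), List.finRange_succ, List.finRange_succ]
      exact map_zero _
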